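/- Let $\rho>1$ and let $\mathcal W_\rho$ be the Banach space of Fourier series $f(\lambda)=\sum_{k\in\mathbb Z}f_k\lambda^k$ with $\|f\|_\rho=\sum_k|f_k|\rho^{|k|}<\infty$; write $f^0=f_0$ for the constant coefficient. Let $\Lambda\mathfrak{sl}(2,\mathbb C)_\rho$ and $\Lambda SL(2,\mathbb C)_\rho$ be the sets of $2\times2$ matrices with entries in $\mathcal W_\rho$ which, for every $\lambda\in\mathbb S^1$, have trace $0$, respectively determinant $1$. Let $D(0,r)=\{|z|<r\}\subset\mathbb C$ and $D^*(0,r)=D(0,r)\setminus\{0\}$, $r>0$. A DPW potential on $D^*(0,r)$ is a 1-form $\eta=A(z,\lambda)\,dz$ with $z\mapsto A(z,\cdot)\in\Lambda\mathfrak{sl}(2,\mathbb C)_\rho$ holomorphic, such that $\lambda A$ has no negative powers of $\lambda$ and the coefficient of $\lambda^{-1}$ in $A$ is nilpotent (possibly zero) at every point. Let $\lambda_1,\lambda_2\in\mathbb C^*$ (Sym points) and $\theta\in\mathbb R$ satisfy $|\lambda_1|,|\lambda_2|<\rho$, $\lambda_1+\lambda_2\in e^{i\theta}\mathbb R$ and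 $\lambda_1\lambda_2=e^{2i\theta}$. If $\Phi$ is a solution of $d\Phi=\Phi\eta$ on the universal cover of $D^*(0,r)$ with values in $\Lambda SL(2,\mathbb C)_\rho$ and $M(\lambda)$ is its monodromy along a generator of $\pi_1(D^*(0,r))$, we say that $\Phi$ solves the Monodromy Problem if $M(\lambda)\in SU(2)$ for all $\lambda\in\mathbb S^1$, $M(\lambda_1)=\mathrm{Id}$, and in addition $M(\lambda_2)=\mathrm{Id}$ if $\lambda_2\ne\lambda_1$, or $M'(\lambda_1)=0$ if $\lambda_2=\lambda_1$. **Theorem.** Fix an integer $m\ge1$ and $\varepsilon>0$. For $t\in(-\varepsilon,\varepsilon)$ let $\eta_t$ be a family of DPW potentials on $D^*(0,r)$ and $\Phi_t$ a family of solutions of $d\Phi_t=\Phi_t\eta_t$ on its universal cover, with $C^1$-dependence on $(t,z)$ as maps into $\Lambda\mathfrak{sl}(2,\mathbb C)_\rho$ and $\Lambda SL(2,\mathbb C)_\rho$ respectively. Assume: 1. there are $a_t,b_t,c_t\in\mathcal W_\rho$ such that $$\eta_t(z,\lambda)=\begin{pmatrix}0&\lambda^{-1}\\0&0\end{pmatrix}\left(\frac{a_t(\lambda)}{z^{2m+1}}+\frac{b_t(\lambda)}{z^{m+1}}+\frac{c_t(\lambda)}{z}\right)dz+\Xi_t(z,\lambda)\,dz,$$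 where $\Xi_t$ is a matrix with entries in $\mathcal W_\rho$, holomorphic with respect to $z$ in $D(0,r)$; 2. $\eta_0=\begin{pmatrix}0&0\\ m z^{m-1}dz&0\end{pmatrix}$; 3. $\Phi_t$ solves the Monodromy Problem for all $t\in(-\varepsilon,\varepsilon)$; 4. $a_t^0=\mathrm{Re}(e^{-i\theta}b_t^0)=0$ for all $t\in(-\varepsilon,\varepsilon)$. Then there is $\delta>0$ such that $a_t=b_t=c_t=0$ for all $|t|<\delta$. In particular, for these $t$ the potential $\eta_t$ extends holomorphically to $z=0$. -/

import Mathlib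

noncomputable section

/-- Families of Fourier coefficients `(f_k)_{k ∈ ℤ}` with `∑ |f_k| ρ^|k| < ∞`. -/
def wienerSubmodule (ρ : ℝ) : Submodule ℂ (ℤ → ℂ) where
  carrier := {f | Summable fun k : ℤ => ‖f k‖ * |ρ| ^ k.natAbs}
  zero_mem' := by
    change Summable fun k : ℤ => ‖(0 : ℂ)‖ * |ρ| ^ k.natAbs
    simp
  add_mem' := by
    intro f g hf hg
    refine Summable.of_nonneg_of_le (fun k => by positivity) (fun k => ?_) (hf.add hg)
    rw [← add_mul]
    exact mul_le_mul_of_nonneg_right (norm_add_le _ _) (by positivity)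
  smul_mem' := by
    intro c f hf
    refine (hf.mul_left ‖c‖).congr (fun k => ?_)
    simp [mul_assoc]

/-- The space `𝒲_ρ` of loops `f = ∑ f_k λ^k` with `‖f‖_ρ = ∑ |f_k| ρ^|k| < ∞`
(only used for `ρ > 1`, where `|ρ| = ρ`). -/
def Wiener (ρ : ℝ) : Type := wienerSubmodule ρ

namespace Wiener

variable {ρ : ℝ}

instance : AddCommGroup (Wiener ρ) := inferInstanceAs (AddCommGroup (wienerSubmodule ρ))

instance : Module ℂ (Wiener ρ) := inferInstanceAs (Module ℂ (wienerSubmodule ρ))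

/-- The Fourier coefficient `f_k`. -/
def coeff (f : Wiener ρ) (k : ℤ) : ℂ := f.1 k

theorem coeff_add (f g : Wiener ρ) (k : ℤ) : (f + g).coeff k = f.coeff k + g.coeff k := rfl

theorem coeff_smul (c : ℂ) (f : Wiener ρ) (k : ℤ) : (c • f).coeff k = c * f.coeff k := rfl

theorem coeff_zero (k : ℤ) : (0 : Wiener ρ).coeff k = 0 := rfl

theorem summable_norm (f : Wiener ρ) :
    Summable fun k : ℤ => ‖f.coeff k‖ * |ρ| ^ k.natAbs := f.2

theorem ext_coeff {f g : Wiener ρ} (h : ∀ k, f.coeff k = g.coeff k) : f = g :=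
  Subtype.ext (funext h)

/-- The norm `‖f‖_ρ = ∑ |f_k| ρ^|k|`. -/
instance : Norm (Wiener ρ) := ⟨fun f => ∑' k : ℤ, ‖f.coeff k‖ * |ρ| ^ k.natAbs⟩

theorem norm_def (f : Wiener ρ) : ‖f‖ = ∑' k : ℤ, ‖f.coeff k‖ * |ρ| ^ k.natAbs := rfl

theorem normCore (hρ : 1 < ρ) : NormedSpace.Core ℂ (Wiener ρ) where
  norm_nonneg f := tsum_nonneg fun k => by positivity
  norm_smul c f := by
    simp only [norm_def, coeff_smul, norm_mul, mul_assoc, tsum_mul_left]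
  norm_triangle f g := by
    simp only [norm_def]
    rw [← (summable_norm f).tsum_add (summable_norm g)]
    refine (summable_norm (f + g)).tsum_le_tsum (fun k => ?_)
      ((summable_norm f).add (summable_norm g))
    rw [← add_mul, coeff_add]
    exact mul_le_mul_of_nonneg_right (norm_add_le _ _) (by positivity)
  norm_eq_zero_iff f := by
    have hpos : 0 < |ρ| := abs_pos.mpr (by linarith)
    constructor
    · intro h
      have h0 := (hasSum_zero_iff_of_nonneg (fun k : ℤ => by positivity)).mp
        (h ▸ (summable_norm f).hasSum :
          HasSum (fun k : ℤ => ‖f.coeff k‖ * |ρ| ^ k.natAbs) 0)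
      refine ext_coeff fun k => ?_
      have hk := congrFun h0 k
      rw [coeff_zero]
      rcases mul_eq_zero.mp hk with h1 | h1
      · exact norm_eq_zero.mp h1
      · exact absurd h1 (pow_pos hpos _).ne'
    · rintro rfl
      simp [norm_def, coeff_zero]

instance [h : Fact (1 < ρ)] : NormedAddCommGroup (Wiener ρ) :=
  NormedAddCommGroup.ofCore (normCore h.out)

instance [h : Fact (1 < ρ)] : NormedSpace ℂ (Wiener ρ) :=
  NormedSpace.ofCore (normCore h.out)

/-- The value `f(λ) = ∑ f_k λ^k`, an absolutely convergent series for `1/ρ ≤ |λ| ≤ ρ`. -/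
def eval (f : Wiener ρ) (lam : ℂ) : ℂ := ∑' k : ℤ, f.coeff k * lam ^ k

end Wiener

/-- `2 × 2` matrices of loops in `𝒲_ρ`. -/
abbrev LoopMatrix (ρ : ℝ) : Type := Matrix (Fin 2) (Fin 2) (Wiener ρ)

/-- The value of a matrix of loops at `λ`. -/
def LoopMatrix.eval {ρ : ℝ} (A : LoopMatrix ρ) (lam : ℂ) : Matrix (Fin 2) (Fin 2) ℂ :=
  Matrix.of fun i j => (A i j).eval lam

/-- The coefficient of `λ^k` of a matrix of loops. -/
def LoopMatrix.coeff {ρ : ℝ} (A : LoopMatrix ρ) (k : ℤ) : Matrix (Fin 2) (Fin 2) ℂ :=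
  Matrix.of fun i j => (A i j).coeff k

/-- The loop group `ΛSL(2,ℂ)_ρ`. -/
def LoopSL (ρ : ℝ) : Set (LoopMatrix ρ) :=
  {A | ∀ lam ∈ Metric.sphere (0 : ℂ) 1, (A.eval lam).det = 1}

/-- The loop algebra `Λsl(2,ℂ)_ρ`. -/
def LoopTraceFree (ρ : ℝ) : Set (LoopMatrix ρ) :=
  {A | ∀ lam ∈ Metric.sphere (0 : ℂ) 1, (A.eval lam).trace = 0}

/-- A map into matrices of loops that is holomorphic on `U`
(as a map into the normed space `𝒲_ρ`, entry by entry). -/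
def LoopHolomorphicOn {ρ : ℝ} [Fact (1 < ρ)] (A : ℂ → LoopMatrix ρ) (U : Set ℂ) : Prop :=
  ∀ i j, DifferentiableOn ℂ (fun z => A z i j) U

/-- A family of matrices of loops with `C¹`-dependence on `(t, z) ∈ I × U`
(as a map into the normed space `𝒲_ρ`, entry by entry; `ℂ` is regarded as a real plane). -/
def LoopC1On {ρ : ℝ} [Fact (1 < ρ)] (A : ℝ → ℂ → LoopMatrix ρ) (I : Set ℝ) (U : Set ℂ) : Prop :=
  ∀ i j, ContDiffOn ℝ 1 (fun p : ℝ × ℂ => A p.1 p.2 i j) (I ×ˢ U)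

/-- The 1-form `A(z) dz` is a DPW potential on the open set `U ⊆ ℂ`: it is holomorphic with
values in `Λsl(2,ℂ)_ρ`, the loop `λ A(z)` has no negative Fourier coefficients, and the residue
of `A(z)` at `λ = 0` is nilpotent. The residue is allowed to vanish, as it does for the
potential `m z^{m-1} dz` in the lower left corner. -/
structure IsDPWPotential {ρ : ℝ} [Fact (1 < ρ)] (A : ℂ → LoopMatrix ρ) (U : Set ℂ) : Prop where
  holomorphic : LoopHolomorphicOn A U
  traceFree : ∀ z ∈ U, A z ∈ LoopTraceFree ρ
  coeff_eq_zero : ∀ z ∈ U, ∀ k : ℤ, k < -1 → (A z).coeff k = 0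
  nilpotent : ∀ z ∈ U, IsNilpotent ((A z).coeff (-1))

/-- The punctured disc `D^*(0,r)`. -/
def puncturedDisc (r : ℝ) : Set ℂ := Metric.ball 0 r \ {0}

/-- The universal cover of `D^*(0,r)`, realised as the half plane `{w | Re w < log r}` with
covering map `w ↦ exp w`; the deck transformations are generated by `w ↦ w + 2πi`. -/
def coverOfPuncturedDisc (r : ℝ) : Set ℂ := {w | Complex.exp w ∈ puncturedDisc r}

/-- `Φ` solves `dΦ = Φ η` on the universal cover of `D^*(0,r)`, where `η = A(z) dz`. The pull
back of `A(z) dz` under `z = exp w` is `A(exp w) exp w dw`. -/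
def SolvesPotential {ρ : ℝ} (A Φ : ℂ → LoopMatrix ρ) (r : ℝ) : Prop :=
  ∀ w ∈ coverOfPuncturedDisc r, ∀ lam ∈ Metric.sphere (0 : ℂ) 1, ∀ i j,
    HasDerivAt (fun u => (Φ u).eval lam i j)
      (((Φ w).eval lam * (Complex.exp w • (A (Complex.exp w)).eval lam)) i j) w

/-- The monodromy `M(λ)` of `Φ` along the generator of the fundamental group of the punctured
disc, with base point `w₀` in the universal cover: `Φ(w₀ + 2πi, λ) = M(λ) Φ(w₀, λ)`. -/
def monodromy {ρ : ℝ} (Φ : ℂ → LoopMatrix ρ) (w₀ lam : ℂ) : Matrix (Fin 2) (Fin 2) ℂ :=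
  (Φ (w₀ + 2 * Real.pi * Complex.I)).eval lam * ((Φ w₀).eval lam)⁻¹

/-- The Monodromy Problem with Sym points `l₁`, `l₂` for a monodromy `M`. -/
def MonodromyProblem (M : ℂ → Matrix (Fin 2) (Fin 2) ℂ) (l₁ l₂ : ℂ) : Prop :=
  (∀ lam ∈ Metric.sphere (0 : ℂ) 1, M lam ∈ Matrix.specialUnitaryGroup (Fin 2) ℂ) ∧
  M l₁ = 1 ∧
  (l₂ ≠ l₁ → M l₂ = 1) ∧
  (l₂ = l₁ → ∀ i j, HasDerivAt (fun lam => M lam i j) 0 l₁)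

end

/-! Write $E$, $F$ for the upper right and lower left elementary matrices. At $t=0$ the potential is
$mz^{m-1}F\,dz$, so $C=\Phi_0(1-z^mF)$ does not depend on $z$. Conjugating the principal part by
$1+z^mF$ and taking the residue at $z=0$ gives $\lambda^{-1}X$ with $X=cE+b[F,E]-aFEF$; this is
`residueMatrix`, and $a,b,c$ sit in different entries of it. For small $t$ the monodromy is
therefore $M_t-1\approx 2\pi i\lambda^{-1}CXC^{-1}$. The essential point is that the error is a
small multiple of $|a|+|b|+|c|$ and not merely of $t$ (`monodromy_estimate`,
`exists_monodromy_estimate`).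

The rest is a rigidity argument at fixed $t$ (`residue_eq_zero_of_estimate`). Since $\lambda A$ has
no negative powers, $a,b,c$ are holomorphic in the disc $|\lambda|<\rho$
(`principal_coeff_eq_zero`). The trace-free part $N$ of $M_t$ is holomorphic in the annulus,
skew-Hermitian on the unit circle and zero at the Sym points. The factor
$e^{-i\theta}\lambda^{-1}(\lambda-\lambda_1)(\lambda-\lambda_2)$ is real on the circle, so the
quotient of $N$ by it is still skew-Hermitian, and its determinant $f$ is a sum of squares there. On
$|\lambda|=1/s$, where $s<\rho$ is chosen so that both Sym points lie in $1/s<|\lambda|<s$, $f$ is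
close to the same expression $g$ formed from $X$. This $g$ is holomorphic in $|\lambda|\le 1/s$, and
the normalisations of $a^0$ and $b^0$ say that $g(0)$ is the square of an imaginary number, hence
$\le0$. The mean of $f$ is the same on both circles, so $N$, and with it $X$, is small in $L^2$ of
the unit circle (`integral_norm_sq_le`).

Let $\mu$ be the maximum of $|a|,|b|,|c|$ on $|\lambda|=s$. The $L^2$ bound makes $X$, then $N$, of
size $o(1)\mu$ on $|\lambda|=1/s$. Schwarz reflection carries this bound on $N$ to $|\lambda|=s$,
where $X$ is recovered from $N$. Hence $\mu\le o(1)\mu$, so $\mu=0$. -/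

section Preliminaries

open Complex Metric Set Filter Topology

/-! ### Loops as holomorphic functions on the annulus. -/

/-- The open annulus `ρ⁻¹ < |λ| < ρ`. -/
def openAnnulus (ρ : ℝ) : Set ℂ := {z | ρ⁻¹ < ‖z‖ ∧ ‖z‖ < ρ}

theorem isOpen_openAnnulus (ρ : ℝ) : IsOpen (openAnnulus ρ) :=
  (isOpen_lt continuous_const continuous_norm).inter (isOpen_lt continuous_norm continuous_const)

theorem sphere_subset_openAnnulus {ρ : ℝ} (hρ : 1 < ρ) : sphere (0 : ℂ) 1 ⊆ openAnnulus ρ := by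
  intro z hz
  rw [mem_sphere_zero_iff_norm] at hz
  exact ⟨by rw [hz]; exact inv_lt_one_of_one_lt₀ hρ, by rw [hz]; exact hρ⟩

theorem ne_zero_of_mem_openAnnulus {ρ : ℝ} (hρ : 1 < ρ) {z : ℂ} (hz : z ∈ openAnnulus ρ) :
    z ≠ 0 := by
  rintro rfl
  have h := hz.1
  rw [norm_zero] at h
  exact absurd h (not_lt.mpr (inv_nonneg.mpr (by linarith)))

theorem norm_zpow_le_pow_natAbs {ρ : ℝ} (hρ : 1 < ρ) {z : ℂ} (h₁ : ρ⁻¹ ≤ ‖z‖) (h₂ : ‖z‖ ≤ ρ)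
    (k : ℤ) : ‖z ^ k‖ ≤ |ρ| ^ k.natAbs := by
  have hρ0 : 0 < ρ := by linarith
  have hz : 0 < ‖z‖ := lt_of_lt_of_le (inv_pos.mpr hρ0) h₁
  rw [abs_of_pos hρ0, norm_zpow]
  rcases Int.natAbs_eq k with h | h
  · rw [h, zpow_natCast, Int.natAbs_natCast]
    exact pow_le_pow_left₀ hz.le h₂ _
  · rw [h, zpow_neg, zpow_natCast, Int.natAbs_neg, Int.natAbs_natCast, ← inv_pow]
    exact pow_le_pow_left₀ (inv_nonneg.mpr hz.le) (inv_le_of_inv_le₀ hρ0 h₁) _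

namespace Wiener

variable {ρ : ℝ}

theorem norm_coeff_mul_zpow_le (hρ : 1 < ρ) (f : Wiener ρ) {z : ℂ} (h₁ : ρ⁻¹ ≤ ‖z‖)
    (h₂ : ‖z‖ ≤ ρ) (k : ℤ) : ‖f.coeff k * z ^ k‖ ≤ ‖f.coeff k‖ * |ρ| ^ k.natAbs := by
  rw [norm_mul]
  exact mul_le_mul_of_nonneg_left (norm_zpow_le_pow_natAbs hρ h₁ h₂ k) (norm_nonneg _)

theorem summable_coeff_mul_zpow (hρ : 1 < ρ) (f : Wiener ρ) {z : ℂ} (h₁ : ρ⁻¹ ≤ ‖z‖)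
    (h₂ : ‖z‖ ≤ ρ) : Summable fun k : ℤ => f.coeff k * z ^ k :=
  (summable_norm f).of_norm_bounded (norm_coeff_mul_zpow_le hρ f h₁ h₂)

theorem norm_eval_le (hρ : 1 < ρ) (f : Wiener ρ) {z : ℂ} (h₁ : ρ⁻¹ ≤ ‖z‖)
    (h₂ : ‖z‖ ≤ ρ) : ‖f.eval z‖ ≤ ‖f‖ :=
  tsum_of_norm_bounded (summable_norm f).hasSum (norm_coeff_mul_zpow_le hρ f h₁ h₂)

theorem norm_coeff_le (hρ : 1 < ρ) (f : Wiener ρ) (k : ℤ) : ‖f.coeff k‖ ≤ ‖f‖ := by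
  have h1 : ‖f.coeff k‖ ≤ ‖f.coeff k‖ * |ρ| ^ k.natAbs :=
    le_mul_of_one_le_right (norm_nonneg _)
      (one_le_pow₀ (by rw [abs_of_pos (by linarith)]; exact hρ.le))
  exact h1.trans ((summable_norm f).le_tsum k fun _ _ => by positivity)

/-- Evaluation at a point of the closed annulus, as a continuous linear map. -/
noncomputable def evalCLM [h : Fact (1 < ρ)] (z : ℂ) (h₁ : ρ⁻¹ ≤ ‖z‖) (h₂ : ‖z‖ ≤ ρ) :
    Wiener ρ →L[ℂ] ℂ :=
  LinearMap.mkContinuous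
    { toFun := fun f => f.eval z
      map_add' := fun f g => by
        simp only [eval, coeff_add, add_mul]
        exact (summable_coeff_mul_zpow h.out f h₁ h₂).tsum_add
          (summable_coeff_mul_zpow h.out g h₁ h₂)
      map_smul' := fun c f => by
        simp only [eval, coeff_smul, mul_assoc, tsum_mul_left, RingHom.id_apply, smul_eq_mul] }
    1 fun f => (norm_eval_le h.out f h₁ h₂).trans_eq (one_mul _).symm

theorem evalCLM_apply [h : Fact (1 < ρ)] (z : ℂ) (h₁ : ρ⁻¹ ≤ ‖z‖) (h₂ : ‖z‖ ≤ ρ) (f : Wiener ρ) :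
    evalCLM z h₁ h₂ f = f.eval z := rfl

/-- A Fourier coefficient, as a continuous linear map. -/
noncomputable def coeffCLM [h : Fact (1 < ρ)] (k : ℤ) : Wiener ρ →L[ℂ] ℂ :=
  LinearMap.mkContinuous
    { toFun := fun f => f.coeff k
      map_add' := fun _ _ => rfl
      map_smul' := fun _ _ => rfl }
    1 fun f => (norm_coeff_le h.out f k).trans_eq (one_mul _).symm

theorem differentiableOn_eval (hρ : 1 < ρ) (f : Wiener ρ) :
    DifferentiableOn ℂ f.eval (openAnnulus ρ) := by
  refine differentiableOn_tsum_of_summable_norm (summable_norm f) (fun k z hz => ?_)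
    (isOpen_openAnnulus ρ)
    (fun k z hz => norm_coeff_mul_zpow_le hρ f hz.1.le hz.2.le k)
  exact ((differentiableAt_zpow.mpr
    (Or.inl (ne_zero_of_mem_openAnnulus hρ hz))).const_mul _).differentiableWithinAt

/-- Applied to `a`, `b`, `c`: without negative powers the maximum principle and Cauchy's formula are
available in the whole disc. -/
theorem differentiableOn_eval_ball (hρ : 1 < ρ) (f : Wiener ρ) (hf : ∀ k < 0, f.coeff k = 0) :
    DifferentiableOn ℂ f.eval (ball 0 ρ) := by
  refine differentiableOn_tsum_of_summable_norm (summable_norm f) (fun k z hz => ?_)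
    isOpen_ball (fun k z hz => ?_)
  · rcases lt_or_ge k 0 with hk | hk
    · simp only [hf k hk, zero_mul]
      exact differentiableWithinAt_const _
    · exact ((differentiableAt_zpow.mpr (Or.inr hk)).const_mul _).differentiableWithinAt
  · rcases lt_or_ge k 0 with hk | hk
    · simp [hf k hk]
    · lift k to ℕ using hk
      rw [norm_mul, zpow_natCast, norm_pow, Int.natAbs_natCast, abs_of_pos (by linarith)]
      exact mul_le_mul_of_nonneg_left
        (pow_le_pow_left₀ (norm_nonneg _) (mem_ball_zero_iff.mp hz).le _) (norm_nonneg _)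

theorem eval_zero_eq_coeff (f : Wiener ρ) :
    f.eval 0 = f.coeff 0 := by
  rw [eval, tsum_eq_single 0]
  · simp
  · intro k hk
    rw [zero_zpow k hk, mul_zero]

theorem circleIntegral_zpow (k : ℤ) :
    (∮ z in C(0, 1), z ^ k) = if k = -1 then 2 * Real.pi * I else 0 := by
  split_ifs with h
  · subst h
    simpa using circleIntegral.integral_sub_center_inv (0 : ℂ) (one_ne_zero : (1 : ℝ) ≠ 0)
  · simpa only [sub_zero] using circleIntegral.integral_sub_zpow_of_ne h 0 0 1

/-- The series may be integrated term by term because the weights dominate it on the unit circle.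
Hence a loop is determined by its values there. -/
theorem coeff_eq_circleIntegral (hρ : 1 < ρ) (f : Wiener ρ) (k : ℤ) :
    (∮ z in C(0, 1), z ^ (-k - 1) * f.eval z) = 2 * Real.pi * I * f.coeff k := by
  have hne : ∀ τ : ℝ, circleMap 0 1 τ ≠ 0 := fun τ => circleMap_ne_center one_ne_zero
  have hn : ∀ τ : ℝ, ‖circleMap 0 1 τ‖ = 1 := fun τ => by simp
  have hterm : ∀ j : ℤ, (∫ τ in (0 : ℝ)..2 * Real.pi,
      deriv (circleMap 0 1) τ • (f.coeff j * circleMap 0 1 τ ^ (j - k - 1))) =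
      if j = k then 2 * Real.pi * I * f.coeff k else 0 := by
    intro j
    have h1 : (∮ z in C(0, 1), f.coeff j * z ^ (j - k - 1)) =
        f.coeff j * ∮ z in C(0, 1), z ^ (j - k - 1) :=
      circleIntegral.integral_const_mul (f.coeff j) (fun z => z ^ (j - k - 1)) 0 1
    rw [circleIntegral_zpow] at h1
    change (∮ z in C(0, 1), f.coeff j * z ^ (j - k - 1)) = _
    rw [h1]
    by_cases hj : j = k
    · subst hj; simp [mul_comm]
    · rw [if_neg (by omega), if_neg hj, mul_zero]
  have hsum := intervalIntegral.hasSum_intervalIntegral_of_summable_norm (a := 0) (b := 2 * Real.pi)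
    (f := fun j : ℤ => (⟨fun τ => deriv (circleMap 0 1) τ •
        (f.coeff j * circleMap 0 1 τ ^ (j - k - 1)), by
      simp only [deriv_circleMap]
      refine ((continuous_circleMap 0 1).mul continuous_const).smul (continuous_const.mul ?_)
      exact (continuous_circleMap 0 1).zpow₀ _ fun τ => Or.inl (hne τ)⟩ : C(ℝ, ℂ))) ?_
  · simp only [ContinuousMap.coe_mk, hterm] at hsum
    have h2 := hsum.unique (hasSum_ite_eq k (2 * Real.pi * I * f.coeff k))
    rw [← h2, circleIntegral]
    refine intervalIntegral.integral_congr fun τ _ => ?_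
    simp only [smul_eq_mul]
    rw [tsum_mul_left, eval, ← tsum_mul_left]
    congr 2
    ext j
    rw [mul_left_comm, ← zpow_add₀ (hne τ)]
    congr 2
    ring
  · refine ((summable_norm f)).of_nonneg_of_le (fun _ => norm_nonneg _) fun j => ?_
    rw [ContinuousMap.norm_le _ (by positivity)]
    rintro ⟨τ, hτ⟩
    simp only [ContinuousMap.restrict_apply, ContinuousMap.coe_mk, norm_smul, deriv_circleMap,
      norm_mul, norm_zpow, hn, one_zpow, mul_one, Complex.norm_I, one_mul]
    exact le_mul_of_one_le_right (norm_nonneg _)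
      (one_le_pow₀ (by rw [abs_of_pos (by linarith)]; exact hρ.le))

/-- Serves to read off Fourier coefficients from an identity of values that contains the factor
$\lambda^{-1}$ of the principal part. -/
theorem coeff_eq_of_zpow_mul_eval_eq (hρ : 1 < ρ) {f g : Wiener ρ} {n : ℤ}
    (h : ∀ z ∈ sphere (0 : ℂ) 1, f.eval z = z ^ n * g.eval z) (k : ℤ) :
    f.coeff (k + n) = g.coeff k := by
  have h1 := coeff_eq_circleIntegral hρ f (k + n)
  have h2 := coeff_eq_circleIntegral hρ g k
  have h3 : (∮ z in C(0, 1), z ^ (-(k + n) - 1) * f.eval z) =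
      ∮ z in C(0, 1), z ^ (-k - 1) * g.eval z := by
    refine circleIntegral.integral_congr zero_le_one fun z hz => ?_
    have hz0 : z ≠ 0 := ne_zero_of_mem_unit_sphere ⟨z, hz⟩
    rw [h z hz, ← mul_assoc, ← zpow_add₀ hz0]
    congr 2; ring
  rw [h1, h2] at h3
  exact mul_left_cancel₀ (by simp [Real.pi_ne_zero]) h3

theorem ext_eval_sphere (hρ : 1 < ρ) {f g : Wiener ρ}
    (h : ∀ z ∈ sphere (0 : ℂ) 1, f.eval z = g.eval z) : f = g :=
  ext_coeff fun k => by
    simpa using coeff_eq_of_zpow_mul_eval_eq hρ (n := 0) (fun z hz => by simpa using h z hz) k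

end Wiener

/-! ### Identity theorem, reflection and division in the annulus. -/

/-- The annulus is the image under `exp` of a vertical strip, which is convex. -/
theorem isPreconnected_openAnnulus {ρ : ℝ} (hρ : 1 < ρ) : IsPreconnected (openAnnulus ρ) := by
  have hρ0 : 0 < ρ := by linarith
  have h : openAnnulus ρ = Complex.exp '' (Complex.reLm ⁻¹' Ioo (-Real.log ρ) (Real.log ρ)) := by
    ext z
    constructor
    · intro hz
      have hz0 : 0 < ‖z‖ := norm_pos_iff.mpr (ne_zero_of_mem_openAnnulus hρ hz)
      refine ⟨Complex.log z, ?_, Complex.exp_log (norm_pos_iff.mp hz0)⟩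
      change (Complex.log z).re ∈ Ioo (-Real.log ρ) (Real.log ρ)
      rw [Complex.log_re, ← Real.log_inv]
      exact ⟨Real.log_lt_log (by positivity) hz.1, Real.log_lt_log hz0 hz.2⟩
    · rintro ⟨w, ⟨h1, h2⟩, rfl⟩
      change -Real.log ρ < w.re at h1
      change w.re < Real.log ρ at h2
      constructor
      · rw [Complex.norm_exp, ← Real.exp_log (inv_pos.mpr hρ0), Real.log_inv]
        exact Real.exp_lt_exp.mpr h1
      · rw [Complex.norm_exp]
        exact (Real.lt_log_iff_exp_lt hρ0).mp h2
  rw [h]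
  exact (((convex_Ioo _ _).linear_preimage Complex.reLm).isPreconnected).image _
    Complex.continuous_exp.continuousOn

theorem frequently_mem_sphere_nhdsNE :
    ∃ᶠ z in 𝓝[≠] (1 : ℂ), z ∈ sphere (0 : ℂ) 1 := by
  have h1 : Tendsto (fun τ : ℝ => Complex.exp (τ * I)) (𝓝[>] 0) (𝓝[≠] 1) := by
    refine tendsto_nhdsWithin_iff.mpr ⟨?_, ?_⟩
    · have : ContinuousAt (fun τ : ℝ => Complex.exp (τ * I)) 0 := by fun_prop
      simpa using this.tendsto.mono_left nhdsWithin_le_nhds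
    · have : Ioo (0 : ℝ) 1 ∈ 𝓝[>] (0 : ℝ) := Ioo_mem_nhdsGT one_pos
      filter_upwards [this] with τ hτ h
      have h2 := congrArg Complex.im h
      rw [Complex.exp_ofReal_mul_I_im, Complex.one_im] at h2
      exact (Real.sin_pos_of_pos_of_lt_pi hτ.1 (by linarith [hτ.2, Real.pi_gt_three])).ne' h2
  exact h1.frequently (Eventually.frequently (Eventually.of_forall fun τ => by
    rw [mem_sphere_zero_iff_norm, Complex.norm_exp_ofReal_mul_I]))

/-- Two holomorphic functions on the annulus that agree on the unit circle are equal. -/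
theorem eqOn_openAnnulus_of_eqOn_sphere {ρ : ℝ} (hρ : 1 < ρ) {f g : ℂ → ℂ}
    (hf : DifferentiableOn ℂ f (openAnnulus ρ)) (hg : DifferentiableOn ℂ g (openAnnulus ρ))
    (h : EqOn f g (sphere 0 1)) : EqOn f g (openAnnulus ρ) :=
  (hf.analyticOnNhd (isOpen_openAnnulus ρ)).eqOn_of_preconnected_of_frequently_eq
    (hg.analyticOnNhd (isOpen_openAnnulus ρ)) (isPreconnected_openAnnulus hρ)
    (sphere_subset_openAnnulus hρ (by simp : (1 : ℂ) ∈ sphere (0 : ℂ) 1))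
    (frequently_mem_sphere_nhdsNE.mono fun _ hz => h hz)

theorem inv_conj_mem_openAnnulus {ρ : ℝ} (hρ : 1 < ρ) {z : ℂ} (hz : z ∈ openAnnulus ρ) :
    (starRingEnd ℂ z)⁻¹ ∈ openAnnulus ρ := by
  have hz0 : 0 < ‖z‖ := norm_pos_iff.mpr (ne_zero_of_mem_openAnnulus hρ hz)
  have hρ0 : 0 < ρ := by linarith
  rw [openAnnulus, mem_ofPred_eq, norm_inv, RCLike.norm_conj]
  exact ⟨(inv_lt_inv₀ hρ0 hz0).mpr hz.2, inv_lt_of_inv_lt₀ hρ0 hz.1⟩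

/-- Schwarz reflection in the unit circle preserves holomorphy. -/
theorem differentiableOn_conj_inv_conj {ρ : ℝ} (hρ : 1 < ρ) {f : ℂ → ℂ}
    (hf : DifferentiableOn ℂ f (openAnnulus ρ)) :
    DifferentiableOn ℂ (fun z => starRingEnd ℂ (f (starRingEnd ℂ z)⁻¹)) (openAnnulus ρ) := by
  intro z hz
  have hz' := inv_conj_mem_openAnnulus hρ hz
  have hz0 := ne_zero_of_mem_openAnnulus hρ hz
  have h1 : DifferentiableAt ℂ f (starRingEnd ℂ z)⁻¹ :=
    hf.differentiableAt ((isOpen_openAnnulus ρ).mem_nhds hz')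
  have h2 : DifferentiableAt ℂ (fun u => f u⁻¹) (starRingEnd ℂ z) :=
    DifferentiableAt.comp (g := f) (starRingEnd ℂ z) h1
      (differentiableAt_inv ((map_ne_zero _).mpr hz0))
  have h3 := h2.conj_conj
  rw [Complex.conj_conj] at h3
  exact h3.differentiableWithinAt

/-- If a function is minus the adjoint of another one on the unit circle, then it is so, after
reflection, on the annulus. -/
theorem conj_reflection_eq_neg {ρ : ℝ} (hρ : 1 < ρ) {f g : ℂ → ℂ}
    (hf : DifferentiableOn ℂ f (openAnnulus ρ)) (hg : DifferentiableOn ℂ g (openAnnulus ρ))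
    (h : ∀ z ∈ sphere (0 : ℂ) 1, starRingEnd ℂ (f z) = -g z) :
    ∀ z ∈ openAnnulus ρ, starRingEnd ℂ (f (starRingEnd ℂ z)⁻¹) = -g z := by
  refine eqOn_openAnnulus_of_eqOn_sphere hρ (differentiableOn_conj_inv_conj hρ hf) hg.neg ?_
  intro z hz
  have h1 : (starRingEnd ℂ z)⁻¹ = z := by
    rw [mem_sphere_zero_iff_norm] at hz
    rw [Complex.inv_eq_conj (by rw [RCLike.norm_conj, hz]), Complex.conj_conj]
  beta_reduce
  rw [h1, h z hz]

/-- Division by `(z - l₁) (z - l₂)`, where `l₁ = l₂` means a double zero. -/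
theorem exists_eq_mul_of_zeros {U : Set ℂ} (hU : IsOpen U) {f : ℂ → ℂ} {l₁ l₂ : ℂ}
    (hf : DifferentiableOn ℂ f U) (h₁U : l₁ ∈ U) (h₂U : l₂ ∈ U) (h₁ : f l₁ = 0)
    (h₂ : l₂ ≠ l₁ → f l₂ = 0) (h₃ : l₂ = l₁ → HasDerivAt f 0 l₁) :
    ∃ g : ℂ → ℂ, DifferentiableOn ℂ g U ∧ ∀ z, f z = (z - l₁) * (z - l₂) * g z := by
  have hd : DifferentiableOn ℂ (dslope f l₁) U :=
    (Complex.differentiableOn_dslope (hU.mem_nhds h₁U)).mpr hf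
  -- The first quotient still vanishes at `l₂`: for distinct zeros because `f l₂ = 0`, for a double
  -- zero because its value there is the derivative of `f`.
  have hz : dslope f l₁ l₂ = 0 := by
    by_cases h : l₂ = l₁
    · rw [h, dslope_same, (h₃ h).deriv]
    · have := sub_smul_dslope f l₁ l₂
      rw [h₁, h₂ h, sub_zero, smul_eq_mul, mul_eq_zero] at this
      exact this.resolve_left (sub_ne_zero.mpr h)
  refine ⟨dslope (dslope f l₁) l₂,
    (Complex.differentiableOn_dslope (hU.mem_nhds h₂U)).mpr hd, fun z => ?_⟩
  have e1 := sub_smul_dslope f l₁ z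
  have e2 := sub_smul_dslope (dslope f l₁) l₂ z
  rw [h₁, sub_zero, smul_eq_mul] at e1
  rw [hz, sub_zero, smul_eq_mul] at e2
  rw [mul_assoc, e2, e1]

/-! ### Cauchy estimates for the principal part in the variable of the disc. -/

theorem circleIntegral_pow_mul_inv_pow {R : ℝ} (hR : 0 < R) (j n : ℕ) :
    (∮ z in C(0, R), z ^ j * (z ^ n)⁻¹) = if n = j + 1 then 2 * Real.pi * I else 0 := by
  have h : (∮ z in C(0, R), z ^ j * (z ^ n)⁻¹) = ∮ z in C(0, R), (z - 0) ^ ((j : ℤ) - n) := by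
    refine circleIntegral.integral_congr hR.le fun z hz => ?_
    have hz0 : z ≠ 0 := ne_of_mem_sphere hz hR.ne'
    rw [sub_zero, zpow_sub₀ hz0, zpow_natCast, zpow_natCast, div_eq_mul_inv]
  rw [h]
  split_ifs with hn
  · rw [hn, show (j : ℤ) - ((j + 1 : ℕ) : ℤ) = -1 by push_cast; ring]
    simpa using circleIntegral.integral_sub_center_inv (0 : ℂ) hR.ne'
  · exact circleIntegral.integral_sub_zpow_of_ne (by omega) 0 0 R

/-- The coefficients of the principal part are bounded by the function on a circle. -/
theorem norm_principal_coeff_le {m : ℕ} (hm : 1 ≤ m) {R r e : ℝ} (hR : 0 < R) (hRr : R < r)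
    {h : ℂ → ℂ} (hh : DifferentiableOn ℂ h (ball 0 r)) {α β γ : ℂ}
    (hb : ∀ z ∈ sphere (0 : ℂ) R,
      ‖α / z ^ (2 * m + 1) + β / z ^ (m + 1) + γ / z + h z‖ ≤ e) :
    ‖α‖ ≤ e * R ^ (2 * m + 1) ∧ ‖β‖ ≤ e * R ^ (m + 1) ∧ ‖γ‖ ≤ e * R := by
  have hcont : ∀ n : ℕ, ContinuousOn (fun z : ℂ => (z ^ n)⁻¹) (sphere 0 R) := fun n =>
    (continuousOn_pow n).inv₀ fun z hz => pow_ne_zero _ (ne_of_mem_sphere hz hR.ne')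
  have hci : ∀ (c : ℂ) (j n : ℕ), CircleIntegrable (fun z => c * (z ^ j * (z ^ n)⁻¹)) 0 R :=
    fun c j n => (continuousOn_const.mul ((continuousOn_pow j).mul (hcont n))).circleIntegrable hR.le
  have hsub : closedBall (0 : ℂ) R ⊆ ball 0 r := closedBall_subset_ball hRr
  -- Integrating against $z^j$ kills the holomorphic part and selects the coefficient of $z^{-j-1}$.
  -- The three exponents are distinct since `m ≥ 1`, so `j = 2m`, `m`, `0` isolate the three
  -- coefficients.
  have key : ∀ j : ℕ, ‖(if 2 * m + 1 = j + 1 then α else 0) + (if m + 1 = j + 1 then β else 0) +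
      (if 1 = j + 1 then γ else 0)‖ ≤ e * R ^ (j + 1) := by
    intro j
    have hd : DifferentiableOn ℂ (fun z => z ^ j * h z) (ball 0 r) :=
      (differentiableOn_pow j).mul hh
    have h0 : (∮ z in C(0, R), z ^ j * h z) = 0 :=
      Complex.circleIntegral_eq_zero_of_differentiable_on_off_countable hR.le countable_empty
        (hd.continuousOn.mono hsub)
        (fun z hz => hd.differentiableAt (isOpen_ball.mem_nhds
          (hsub (ball_subset_closedBall hz.1))))
    have h1 : (∮ z in C(0, R), z ^ j * (α / z ^ (2 * m + 1) + β / z ^ (m + 1) + γ / z + h z)) =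
        2 * Real.pi * I * ((if 2 * m + 1 = j + 1 then α else 0) +
          (if m + 1 = j + 1 then β else 0) + (if 1 = j + 1 then γ else 0)) := by
      have e1 : (fun z : ℂ => z ^ j * (α / z ^ (2 * m + 1) + β / z ^ (m + 1) + γ / z + h z)) =
          fun z => α * (z ^ j * (z ^ (2 * m + 1))⁻¹) + β * (z ^ j * (z ^ (m + 1))⁻¹) +
            γ * (z ^ j * (z ^ 1)⁻¹) + z ^ j * h z := by
        ext z; simp only [div_eq_mul_inv, pow_one]; ring
      have c1 : CircleIntegrable (fun z => α * (z ^ j * (z ^ (2 * m + 1))⁻¹) +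
          β * (z ^ j * (z ^ (m + 1))⁻¹)) 0 R := (hci α _ _).add (hci β _ _)
      have c2 : CircleIntegrable (fun z => α * (z ^ j * (z ^ (2 * m + 1))⁻¹) +
          β * (z ^ j * (z ^ (m + 1))⁻¹) + γ * (z ^ j * (z ^ 1)⁻¹)) 0 R := c1.add (hci γ _ _)
      rw [e1, circleIntegral.integral_add c2
          ((hd.continuousOn.mono (sphere_subset_closedBall.trans hsub)).circleIntegrable hR.le),
        circleIntegral.integral_add c1 (hci γ _ _),
        circleIntegral.integral_add (hci α _ _) (hci β _ _), circleIntegral.integral_const_mul,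
        circleIntegral.integral_const_mul, circleIntegral.integral_const_mul, h0,
        circleIntegral_pow_mul_inv_pow hR, circleIntegral_pow_mul_inv_pow hR,
        circleIntegral_pow_mul_inv_pow hR]
      split_ifs <;> ring
    have h2 := circleIntegral.norm_integral_le_of_norm_le_const (c := 0) (C := R ^ j * e)
      (f := fun z => z ^ j * (α / z ^ (2 * m + 1) + β / z ^ (m + 1) + γ / z + h z)) hR.le
      (fun z hz => by
        rw [norm_mul, norm_pow, mem_sphere_zero_iff_norm.mp hz]
        exact mul_le_mul_of_nonneg_left (hb z hz) (by positivity))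
    rw [h1, norm_mul, norm_mul, norm_mul, Complex.norm_I, Complex.norm_real,
      Real.norm_of_nonneg Real.pi_pos.le, Complex.norm_ofNat, mul_one] at h2
    have h3 : 0 < 2 * Real.pi := by positivity
    refine le_of_mul_le_mul_left (h2.trans_eq ?_) h3
    ring
  refine ⟨?_, ?_, ?_⟩
  · simpa [show ¬ m = 2 * m by omega, show ¬ (2 * m = 0) by omega, show m ≠ 0 by omega]
      using key (2 * m)
  · simpa [show ¬ 2 * m = m by omega, show m ≠ 0 by omega] using key m
  · simpa [show m ≠ 0 by omega] using key 0

/-! ### The Sym factor and means over circles. -/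

/-- The function `e^{-iθ} λ⁻¹ (λ - l₁) (λ - l₂)`, real on the unit circle for Sym points. -/
noncomputable def symFactor (θ : ℝ) (l₁ l₂ z : ℂ) : ℂ :=
  Complex.exp (-θ * I) * z⁻¹ * ((z - l₁) * (z - l₂))

/-- Expanded, the factor is $e^{-i\theta}z-s+e^{i\theta}z^{-1}$ with $s$ real; on the unit circle
the outer terms are conjugate to each other. -/
theorem conj_symFactor {θ : ℝ} {l₁ l₂ : ℂ}
    (hsum : ∃ s : ℝ, l₁ + l₂ = Complex.exp (θ * I) * s)
    (hprod : l₁ * l₂ = Complex.exp (2 * θ * I)) {z : ℂ} (hz : z ∈ sphere (0 : ℂ) 1) :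
    starRingEnd ℂ (symFactor θ l₁ l₂ z) = symFactor θ l₁ l₂ z := by
  obtain ⟨s, hs⟩ := hsum
  have hz0 : z ≠ 0 := ne_zero_of_mem_unit_sphere ⟨z, hz⟩
  have hzc : starRingEnd ℂ z = z⁻¹ :=
    (Complex.inv_eq_conj (mem_sphere_zero_iff_norm.mp hz)).symm
  have h1 : Complex.exp (-θ * I) * Complex.exp (θ * I) = 1 := by
    rw [← Complex.exp_add]; simp
  have h2 : Complex.exp (2 * θ * I) = Complex.exp (θ * I) * Complex.exp (θ * I) := by
    rw [← Complex.exp_add]; ring_nf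
  have h3 : starRingEnd ℂ (Complex.exp (θ * I)) = Complex.exp (-θ * I) := by
    rw [← Complex.exp_conj]; simp
  have h4 : starRingEnd ℂ (Complex.exp (-θ * I)) = Complex.exp (θ * I) := by
    rw [← Complex.exp_conj]; simp
  have h5 : symFactor θ l₁ l₂ z = Complex.exp (-θ * I) * z - s + Complex.exp (θ * I) * z⁻¹ := by
    have : (z - l₁) * (z - l₂) = z * z - (l₁ + l₂) * z + l₁ * l₂ := by ring
    rw [symFactor, this, hs, hprod, h2]
    have hzz : z⁻¹ * z = 1 := inv_mul_cancel₀ hz0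
    linear_combination (Complex.exp (-θ * I) * z - s * Complex.exp (-θ * I) * Complex.exp (θ * I)) *
      hzz + (-s + z⁻¹ * Complex.exp (θ * I)) * h1
  rw [h5]
  simp only [map_add, map_sub, map_mul, map_inv₀, h3, h4, hzc, Complex.conj_ofReal, inv_inv]
  ring

/-- Sym points may lie on the unit circle, so the real factor cannot be cancelled pointwise. It is
cancelled among holomorphic functions on the annulus, with the conjugate replaced by its Schwarz
reflection. -/
theorem conj_quotient_symFactor {ρ : ℝ} (hρ : 1 < ρ) {θ : ℝ} {l₁ l₂ : ℂ}
    (hsum : ∃ s : ℝ, l₁ + l₂ = Complex.exp (θ * I) * s)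
    (hprod : l₁ * l₂ = Complex.exp (2 * θ * I)) {f g : ℂ → ℂ}
    (hf : DifferentiableOn ℂ f (openAnnulus ρ)) (hg : DifferentiableOn ℂ g (openAnnulus ρ))
    (h : ∀ z ∈ sphere (0 : ℂ) 1,
      starRingEnd ℂ (symFactor θ l₁ l₂ z * f z) = -(symFactor θ l₁ l₂ z * g z)) :
    ∀ z ∈ sphere (0 : ℂ) 1, starRingEnd ℂ (f z) = -g z := by
  intro w hw
  have hrefl : ∀ z ∈ sphere (0 : ℂ) 1, (starRingEnd ℂ z)⁻¹ = z := fun z hz => by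
    rw [← (Complex.inv_eq_conj (mem_sphere_zero_iff_norm.mp hz)), inv_inv]
  set H : ℂ → ℂ := fun z => starRingEnd ℂ (f (starRingEnd ℂ z)⁻¹) + g z with hH
  have hHd : DifferentiableOn ℂ H (openAnnulus ρ) :=
    (differentiableOn_conj_inv_conj hρ hf).add hg
  have hpd : DifferentiableOn ℂ (fun z => (z - l₁) * (z - l₂)) (openAnnulus ρ) := by fun_prop
  have hS : EqOn (fun z => (z - l₁) * (z - l₂) * H z) (fun _ => 0) (sphere 0 1) := by
    intro z hz
    have hz0 : z ≠ 0 := ne_zero_of_mem_unit_sphere ⟨z, hz⟩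
    have h1 := h z hz
    rw [map_mul, conj_symFactor hsum hprod hz] at h1
    have h2 : symFactor θ l₁ l₂ z * H z = 0 := by
      rw [hH]; beta_reduce; rw [hrefl z hz, mul_add, h1]; ring
    rw [symFactor, mul_assoc, mul_eq_zero] at h2
    exact h2.resolve_left (mul_ne_zero (Complex.exp_ne_zero _) (inv_ne_zero hz0))
  have hA := eqOn_openAnnulus_of_eqOn_sphere hρ (hpd.mul hHd) (differentiableOn_const 0) hS
  have h0 := AnalyticOnNhd.eq_zero_or_eq_zero_of_mul_eq_zero
    (hpd.analyticOnNhd (isOpen_openAnnulus ρ)) (hHd.analyticOnNhd (isOpen_openAnnulus ρ))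
    (fun z hz => hA hz) (isPreconnected_openAnnulus hρ)
  have hsub := sphere_subset_openAnnulus hρ
  rcases h0 with h0 | h0
  · exfalso
    -- A quadratic polynomial cannot vanish at the three points `1`, `-1`, `I`.
    have e1 := h0 1 (hsub (by simp))
    have e2 := h0 (-1) (hsub (by simp))
    have e3 := h0 I (hsub (by simp))
    simp only [mul_eq_zero, sub_eq_zero] at e1 e2 e3
    have d1 : (1 : ℂ) ≠ -1 := by norm_num
    have d2 : (1 : ℂ) ≠ I := fun h => by simpa using congrArg Complex.re h
    have d3 : (-1 : ℂ) ≠ I := fun h => by simpa using congrArg Complex.re h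
    rcases e1 with e1 | e1 <;> rcases e2 with e2 | e2 <;> rcases e3 with e3 | e3 <;>
      simp_all
  · have h2 : H w = 0 := h0 w (hsub hw)
    rw [hH] at h2
    beta_reduce at h2
    rw [hrefl w hw] at h2
    exact eq_neg_of_add_eq_zero_left h2

/-- The mean over the unit circle of a function holomorphic in an annulus, compared on a smaller
circle with a function holomorphic in the disc. -/
theorem integral_re_le_of_norm_sub_le {ρ s δ : ℝ} (hs : 1 < s) (hsρ : s < ρ) {f g : ℂ → ℂ}
    (hf : DifferentiableOn ℂ f (openAnnulus ρ)) (hg : DifferentiableOn ℂ g (closedBall 0 s⁻¹))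
    (hg0 : (g 0).re ≤ 0) (hfg : ∀ z ∈ sphere (0 : ℂ) s⁻¹, ‖f z - g z‖ ≤ δ) :
    (∫ τ in (0 : ℝ)..2 * Real.pi, (f (circleMap 0 1 τ)).re) ≤ 2 * Real.pi * δ := by
  have hs0 : 0 < s := by linarith
  have hsi : 0 < s⁻¹ := inv_pos.mpr hs0
  have hs1 : s⁻¹ < 1 := inv_lt_one_of_one_lt₀ hs
  have hρs : ρ⁻¹ < s⁻¹ := (inv_lt_inv₀ (by linarith) hs0).mpr hsρ
  have hsub : closedBall (0 : ℂ) 1 \ ball 0 s⁻¹ ⊆ openAnnulus ρ := by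
    intro z hz
    have h1 : ‖z‖ ≤ 1 := by simpa using hz.1
    have h2 : s⁻¹ ≤ ‖z‖ := by simpa using hz.2
    exact ⟨by linarith, by linarith⟩
  have hsub' : sphere (0 : ℂ) s⁻¹ ⊆ openAnnulus ρ := by
    intro z hz
    rw [mem_sphere_zero_iff_norm] at hz
    exact ⟨by rw [hz]; exact hρs, by rw [hz]; linarith⟩
  have h1 := Complex.circleIntegral_sub_center_inv_smul_eq_of_differentiable_on_annulus_off_countable
    (c := 0) hsi hs1.le (f := f) countable_empty (hf.continuousOn.mono hsub)
    (fun z hz => hf.differentiableAt ((isOpen_openAnnulus ρ).mem_nhds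
      (hsub ⟨ball_subset_closedBall hz.1.1, fun h => hz.1.2 (ball_subset_closedBall h)⟩)))
  have h2 : (∮ z in C(0, s⁻¹), (z - 0)⁻¹ • g z) = (2 * Real.pi * I : ℂ) • g 0 :=
    hg.circleIntegral_sub_inv_smul (by simpa using hsi)
  have hinv : ∀ R : ℝ, 0 < R → ContinuousOn (fun z : ℂ => (z - 0)⁻¹) (sphere 0 R) := by
    intro R hR
    refine (continuousOn_id.sub continuousOn_const).inv₀ fun z hz => ?_
    simpa using ne_of_mem_sphere hz hR.ne'
  have i1 : CircleIntegrable (fun z => (z - 0)⁻¹ • f z) 0 s⁻¹ :=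
    ((hinv _ hsi).smul (hf.continuousOn.mono hsub')).circleIntegrable hsi.le
  have i2 : CircleIntegrable (fun z => (z - 0)⁻¹ • g z) 0 s⁻¹ :=
    ((hinv _ hsi).smul (hg.continuousOn.mono sphere_subset_closedBall)).circleIntegrable hsi.le
  have h3 := circleIntegral.integral_sub i1 i2
  -- The bound `s * δ` absorbs $|z|^{-1}=s$ on the inner circle; the length $2\pi/s$ then cancels
  -- the `s`.
  have h4 : ‖∮ z in C(0, s⁻¹), ((z - 0)⁻¹ • f z - (z - 0)⁻¹ • g z)‖ ≤
      2 * Real.pi * s⁻¹ * (s * δ) := by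
    refine circleIntegral.norm_integral_le_of_norm_le_const hsi.le fun z hz => ?_
    rw [← smul_sub, norm_smul, norm_inv, sub_zero, mem_sphere_zero_iff_norm.mp hz, inv_inv]
    exact mul_le_mul_of_nonneg_left (hfg z hz) hs0.le
  rw [h3, h2, ← h1] at h4
  have h5 : (∮ z in C(0, 1), (z - 0)⁻¹ • f z) =
      I * ∫ τ in (0 : ℝ)..2 * Real.pi, f (circleMap 0 1 τ) := by
    rw [circleIntegral, ← intervalIntegral.integral_const_mul]
    refine intervalIntegral.integral_congr fun τ _ => ?_
    have hne : circleMap 0 1 τ ≠ 0 := circleMap_ne_center one_ne_zero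
    simp only [deriv_circleMap, sub_zero, smul_eq_mul]
    field_simp
  have h6 : IntervalIntegrable (fun τ => f (circleMap 0 1 τ)) MeasureTheory.volume 0
      (2 * Real.pi) := by
    refine ContinuousOn.intervalIntegrable ?_
    exact (hf.continuousOn.comp_continuous (continuous_circleMap 0 1) fun τ =>
      sphere_subset_openAnnulus (hs.trans hsρ) (circleMap_mem_sphere 0 zero_le_one τ)).continuousOn
  have h7 : (∫ τ in (0 : ℝ)..2 * Real.pi, (f (circleMap 0 1 τ)).re) =
      (∫ τ in (0 : ℝ)..2 * Real.pi, f (circleMap 0 1 τ)).re := by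
    exact (Complex.reCLM.intervalIntegral_comp_comm h6)
  rw [h7]
  rw [h5] at h4
  -- The integral of $f(z)\,dz/z$ is $i$ times the integral of $f$ over the angle, so real parts of
  -- means appear as imaginary parts.
  have h8 := (Complex.abs_im_le_norm _).trans h4
  have h9 := (le_abs_self _).trans h8
  simp only [Complex.sub_im, Complex.mul_im, smul_eq_mul, Complex.I_re, Complex.I_im, zero_mul,
    one_mul, zero_add, mul_assoc] at h9
  simp at h9
  have h10 : 2 * (Real.pi * (s⁻¹ * (s * δ))) = 2 * Real.pi * δ := by
    field_simp
  rw [h10] at h9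
  nlinarith [Real.pi_pos]

/-- Cauchy's formula for $x^2$ on the unit circle, with the kernel bounded by $(1-s^{-1})^{-1}$.
Working with $x^2$ makes the $L^2$ norm appear directly. -/
theorem norm_sq_le_of_integral_le {ρ s B : ℝ} (hs : 1 < s) (hsρ : s < ρ) {x : ℂ → ℂ}
    (hx : DifferentiableOn ℂ x (ball 0 ρ))
    (hB : (∫ τ in (0 : ℝ)..2 * Real.pi, ‖x (circleMap 0 1 τ)‖ ^ 2) ≤ B) {w : ℂ}
    (hw : ‖w‖ ≤ s⁻¹) : ‖x w‖ ^ 2 ≤ B * (1 - s⁻¹)⁻¹ := by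
  have hs1 : s⁻¹ < 1 := inv_lt_one_of_one_lt₀ hs
  have hd : 0 < 1 - s⁻¹ := by linarith
  have hsub : closedBall (0 : ℂ) 1 ⊆ ball 0 ρ := closedBall_subset_ball (hs.trans hsρ)
  have hwb : w ∈ ball (0 : ℂ) 1 := mem_ball_zero_iff.mpr (hw.trans_lt hs1)
  have hsq : DifferentiableOn ℂ (fun z => x z ^ 2) (closedBall 0 1) := (hx.mono hsub).pow 2
  have h1 : (∮ z in C(0, 1), (z - w)⁻¹ • (x z ^ 2)) = (2 * Real.pi * I : ℂ) • x w ^ 2 :=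
    hsq.circleIntegral_sub_inv_smul hwb
  have hc : Continuous fun τ : ℝ => x (circleMap 0 1 τ) :=
    hx.continuousOn.comp_continuous (continuous_circleMap 0 1) fun τ =>
      hsub (sphere_subset_closedBall (circleMap_mem_sphere 0 zero_le_one τ))
  have h2 : ‖∮ z in C(0, 1), (z - w)⁻¹ • (x z ^ 2)‖ ≤
      ∫ τ in (0 : ℝ)..2 * Real.pi, (1 - s⁻¹)⁻¹ * ‖x (circleMap 0 1 τ)‖ ^ 2 := by
    refine intervalIntegral.norm_integral_le_of_norm_le Real.two_pi_pos.le
      (Eventually.of_forall fun τ _ => ?_)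
      ((continuous_const.mul (hc.norm.pow 2)).intervalIntegrable _ _)
    have h3 : 1 - s⁻¹ ≤ ‖circleMap 0 1 τ - w‖ := by
      have := norm_sub_norm_le (circleMap 0 1 τ) w
      simp only [norm_circleMap_zero, abs_one] at this
      linarith
    simp only [norm_smul, deriv_circleMap, norm_mul, norm_circleMap_zero, abs_one,
      Complex.norm_I, one_mul, norm_inv, norm_pow]
    exact mul_le_mul_of_nonneg_right (inv_anti₀ hd h3) (by positivity)
  rw [h1, intervalIntegral.integral_const_mul, norm_smul, norm_pow] at h2
  have h4 : ‖(2 * Real.pi * I : ℂ)‖ = 2 * Real.pi := by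
    simp [abs_of_pos Real.pi_pos]
  rw [h4] at h2
  have h5 : (1 - s⁻¹)⁻¹ * (∫ τ in (0 : ℝ)..2 * Real.pi, ‖x (circleMap 0 1 τ)‖ ^ 2) ≤
      (1 - s⁻¹)⁻¹ * B := mul_le_mul_of_nonneg_left hB (inv_nonneg.mpr hd.le)
  have h6 : 1 ≤ 2 * Real.pi := by linarith [Real.pi_gt_three]
  have h7 : ‖x w‖ ^ 2 ≤ 2 * Real.pi * ‖x w‖ ^ 2 := le_mul_of_one_le_left (by positivity) h6
  linarith

-- The row-sum norm on 2 × 2 matrices.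

attribute [local instance] Matrix.linftyOpNormedRing Matrix.linftyOpNormedAlgebra

theorem Matrix.norm_entry_le_linftyOp (A : Matrix (Fin 2) (Fin 2) ℂ) (i j : Fin 2) :
    ‖A i j‖ ≤ ‖A‖ := by
  have h1 : ∑ j, ‖A i j‖₊ ≤ ‖A‖₊ := by
    rw [Matrix.linfty_opNNNorm_def]
    exact Finset.le_sup (f := fun i => ∑ j, ‖A i j‖₊) (Finset.mem_univ i)
  have h2 : ‖A i j‖₊ ≤ ∑ j, ‖A i j‖₊ :=
    Finset.single_le_sum (f := fun j => ‖A i j‖₊) (fun _ _ => zero_le) (Finset.mem_univ j)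
  exact_mod_cast h2.trans h1

theorem Matrix.linftyOp_norm_le_of_rows {A : Matrix (Fin 2) (Fin 2) ℂ} {x : ℝ}
    (h : ∀ i, ‖A i 0‖ + ‖A i 1‖ ≤ x) : ‖A‖ ≤ x := by
  have hx : 0 ≤ x := le_trans (by positivity) (h 0)
  lift x to NNReal using hx
  have : ‖A‖₊ ≤ x := by
    rw [Matrix.linfty_opNNNorm_def]
    refine Finset.sup_le fun i _ => ?_
    rw [Fin.sum_univ_two]
    exact_mod_cast h i
  exact_mod_cast this

theorem Matrix.linftyOp_norm_le_of_entries {A : Matrix (Fin 2) (Fin 2) ℂ} {x : ℝ}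
    (h : ∀ i j, ‖A i j‖ ≤ x) : ‖A‖ ≤ 2 * x :=
  Matrix.linftyOp_norm_le_of_rows fun i => by linarith [h i 0, h i 1]

/-- The difference expands into six products, each with a factor from `Y - X`; `δ ≤ μ` covers the
quadratic ones. -/
theorem Matrix.norm_det_sub_det_le {X Y : Matrix (Fin 2) (Fin 2) ℂ} {μ δ : ℝ} (hδ : δ ≤ μ)
    (hX : ∀ i j, ‖X i j‖ ≤ μ) (hY : ‖Y - X‖ ≤ δ) : ‖Y.det - X.det‖ ≤ 6 * (δ * μ) := by
  have hE : ∀ i j, ‖(Y - X) i j‖ ≤ δ := fun i j => (Matrix.norm_entry_le_linftyOp _ i j).trans hY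
  have hδ0 : 0 ≤ δ := (norm_nonneg _).trans hY
  have hμ0 : 0 ≤ μ := hδ0.trans hδ
  set E := Y - X with hEdef
  have hYE : Y = X + E := by rw [hEdef]; abel
  have h1 : Y.det - X.det = E 0 0 * X 1 1 + X 0 0 * E 1 1 + E 0 0 * E 1 1 -
      (E 0 1 * X 1 0 + X 0 1 * E 1 0 + E 0 1 * E 1 0) := by
    rw [hYE, Matrix.det_fin_two, Matrix.det_fin_two]
    simp only [Matrix.add_apply]
    ring
  have m : ∀ {x y : ℂ} {p q : ℝ}, ‖x‖ ≤ p → ‖y‖ ≤ q → ‖x * y‖ ≤ p * q := fun hx hy => by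
    rw [norm_mul]; exact mul_le_mul hx hy (norm_nonneg _) ((norm_nonneg _).trans hx)
  have hEE : ∀ i j k l, ‖E i j * E k l‖ ≤ δ * μ := fun i j k l => m (hE i j) ((hE k l).trans hδ)
  have hEX : ∀ i j k l, ‖E i j * X k l‖ ≤ δ * μ := fun i j k l => m (hE i j) (hX k l)
  have hXE : ∀ i j k l, ‖X i j * E k l‖ ≤ δ * μ := fun i j k l => by
    rw [mul_comm]; exact hEX _ _ _ _
  rw [h1]
  refine (norm_sub_le _ _).trans ?_
  have t1 := norm_add₃_le (a := E 0 0 * X 1 1) (b := X 0 0 * E 1 1) (c := E 0 0 * E 1 1)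
  have t2 := norm_add₃_le (a := E 0 1 * X 1 0) (b := X 0 1 * E 1 0) (c := E 0 1 * E 1 0)
  linarith [hEX 0 0 1 1, hXE 0 0 1 1, hEE 0 0 1 1, hEX 0 1 1 0, hXE 0 1 1 0, hEE 0 1 1 0]

theorem norm_mul_mul_le {𝔸 : Type*} [NormedRing 𝔸] {x y z : 𝔸} {p q : ℝ} (hx : ‖x‖ ≤ p)
    (hz : ‖z‖ ≤ q) : ‖x * y * z‖ ≤ p * q * ‖y‖ := by
  have hp := (norm_nonneg _).trans hx
  calc ‖x * y * z‖ ≤ ‖x * y‖ * ‖z‖ := norm_mul_le _ _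
    _ ≤ (‖x‖ * ‖y‖) * ‖z‖ := mul_le_mul_of_nonneg_right (norm_mul_le _ _) (norm_nonneg _)
    _ ≤ (p * ‖y‖) * q := by gcongr
    _ = p * q * ‖y‖ := by ring

/-! ### Rigidity: a small relative error forces the residue to vanish. -/

/-- The trace-free matrix with first row `(-b, c)` and second row `(-a, b)`. -/
def residueMatrix (a b c : ℂ) : Matrix (Fin 2) (Fin 2) ℂ := !![-b, c; -a, b]

theorem norm_residueMatrix_entry_le {a b c : ℂ} {x : ℝ} (ha : ‖a‖ ≤ x) (hb : ‖b‖ ≤ x)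
    (hc : ‖c‖ ≤ x) (i j : Fin 2) : ‖residueMatrix a b c i j‖ ≤ x := by
  fin_cases i <;> fin_cases j <;> simpa [residueMatrix]

theorem norm_le_norm_residueMatrix (a b c : ℂ) :
    ‖a‖ ≤ ‖residueMatrix a b c‖ ∧ ‖b‖ ≤ ‖residueMatrix a b c‖ ∧
      ‖c‖ ≤ ‖residueMatrix a b c‖ :=
  ⟨by simpa [residueMatrix] using Matrix.norm_entry_le_linftyOp (residueMatrix a b c) 1 0,
    by simpa [residueMatrix] using Matrix.norm_entry_le_linftyOp (residueMatrix a b c) 1 1,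
    by simpa [residueMatrix] using Matrix.norm_entry_le_linftyOp (residueMatrix a b c) 0 1⟩

theorem det_residueMatrix (a b c : ℂ) : (residueMatrix a b c).det = -b ^ 2 + a * c := by
  simp [residueMatrix, Matrix.det_fin_two]; ring

/-- The constant in the `L²` estimate of `integral_norm_sq_le`. -/
noncomputable def meanConst (s κ : ℝ) (l₁ l₂ : ℂ) : ℝ :=
  16 * κ ^ 4 * (1 + s) ^ 4 * (48 * Real.pi ^ 3 / ((‖l₁‖ - s⁻¹) * (‖l₂‖ - s⁻¹)) ^ 2) + 4 * Real.pi

section Rigidity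

variable {ρ s κ θ : ℝ} {l₁ l₂ : ℂ} {a b c n₁ n₂ n₃ : ℂ → ℂ}
  {C C' Y : ℂ → Matrix (Fin 2) (Fin 2) ℂ} {e μ : ℝ}

-- Here `z` is the loop parameter, the matrix of the `nᵢ` is the trace-free part of the monodromy
-- and `Y` is that matrix conjugated back by `C`. The estimate compares determinants: on the unit
-- circle that of the quotient by the Sym factor is a sum of squares, while its mean is at most
-- about `g 0`, which is not positive.
set_option maxHeartbeats 1000000 in
theorem integral_norm_sq_le (hs : 1 < s) (hsρ : s < ρ) (hl₁ : s⁻¹ < ‖l₁‖ ∧ ‖l₁‖ < s)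
    (hl₂ : s⁻¹ < ‖l₂‖ ∧ ‖l₂‖ < s)
    (hsum : ∃ s : ℝ, l₁ + l₂ = Complex.exp (θ * I) * s)
    (hprod : l₁ * l₂ = Complex.exp (2 * θ * I))
    (hC : ∀ z ∈ openAnnulus ρ, C z * C' z = 1)
    (hCκ : ∀ z, s⁻¹ ≤ ‖z‖ → ‖z‖ ≤ s → ‖C z‖ ≤ κ ∧ ‖C' z‖ ≤ κ)
    (ha : DifferentiableOn ℂ a (ball 0 ρ)) (hb : DifferentiableOn ℂ b (ball 0 ρ))
    (hc : DifferentiableOn ℂ c (ball 0 ρ))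
    (hn₁ : DifferentiableOn ℂ n₁ (openAnnulus ρ)) (hn₂ : DifferentiableOn ℂ n₂ (openAnnulus ρ))
    (hn₃ : DifferentiableOn ℂ n₃ (openAnnulus ρ))
    (ha0 : a 0 = 0) (hb0 : (Complex.exp (-θ * I) * b 0).re = 0)
    (hz₁ : n₁ l₁ = 0 ∧ n₂ l₁ = 0 ∧ n₃ l₁ = 0)
    (hz₂ : l₂ ≠ l₁ → n₁ l₂ = 0 ∧ n₂ l₂ = 0 ∧ n₃ l₂ = 0)
    (hz₃ : l₂ = l₁ → HasDerivAt n₁ 0 l₁ ∧ HasDerivAt n₂ 0 l₁ ∧ HasDerivAt n₃ 0 l₁)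
    (hsk₁ : ∀ z ∈ sphere (0 : ℂ) 1, starRingEnd ℂ (n₁ z) = -n₁ z)
    (hsk₂ : ∀ z ∈ sphere (0 : ℂ) 1, starRingEnd ℂ (n₂ z) = -n₃ z)
    (hY : ∀ z ∈ openAnnulus ρ, !![n₁ z, n₂ z; n₃ z, -n₁ z] =
      (2 * Real.pi * I * z⁻¹) • (C z * Y z * C' z))
    (he : 0 ≤ e) (he1 : e ≤ 1)
    (hμ : ∀ z ∈ closedBall (0 : ℂ) s, ‖a z‖ ≤ μ ∧ ‖b z‖ ≤ μ ∧ ‖c z‖ ≤ μ)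
    (hYX : ∀ z, s⁻¹ ≤ ‖z‖ → ‖z‖ ≤ s → ‖Y z - residueMatrix (a z) (b z) (c z)‖ ≤ e * μ) :
    (∫ τ in (0 : ℝ)..2 * Real.pi, ‖residueMatrix (a (circleMap 0 1 τ)) (b (circleMap 0 1 τ))
      (c (circleMap 0 1 τ))‖ ^ 2) ≤ meanConst s κ l₁ l₂ * (e * μ ^ 2) := by
  have hρ : 1 < ρ := hs.trans hsρ
  have hs0 : 0 < s := by linarith
  have hsi : 0 < s⁻¹ := inv_pos.mpr hs0
  have hs1 : s⁻¹ < 1 := inv_lt_one_of_one_lt₀ hs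
  have hρs : ρ⁻¹ < s⁻¹ := (inv_lt_inv₀ (by linarith) hs0).mpr hsρ
  have hμ0 : 0 ≤ μ := (norm_nonneg _).trans (hμ 0 (by simp [hs0.le])).1
  have heμ : e * μ ≤ μ := mul_le_of_le_one_left hμ0 he1
  have hA : ∀ {l : ℂ}, s⁻¹ < ‖l‖ ∧ ‖l‖ < s → l ∈ openAnnulus ρ := fun h =>
    ⟨hρs.trans h.1, h.2.trans hsρ⟩
  obtain ⟨g₁, hg₁, e₁⟩ := exists_eq_mul_of_zeros (isOpen_openAnnulus ρ) hn₁ (hA hl₁) (hA hl₂)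
    hz₁.1 (fun h => (hz₂ h).1) (fun h => (hz₃ h).1)
  obtain ⟨g₂, hg₂, e₂⟩ := exists_eq_mul_of_zeros (isOpen_openAnnulus ρ) hn₂ (hA hl₁) (hA hl₂)
    hz₁.2.1 (fun h => (hz₂ h).2.1) (fun h => (hz₃ h).2.1)
  obtain ⟨g₃, hg₃, e₃⟩ := exists_eq_mul_of_zeros (isOpen_openAnnulus ρ) hn₃ (hA hl₁) (hA hl₂)
    hz₁.2.2 (fun h => (hz₂ h).2.2) (fun h => (hz₃ h).2.2)
  set ω := Complex.exp (θ * I) with hω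
  have hω1 : Complex.exp (-θ * I) * ω = 1 := by rw [hω, ← Complex.exp_add]; simp
  have hω2 : Complex.exp (2 * θ * I) = ω ^ 2 := by
    rw [hω, ← Complex.exp_nat_mul]; push_cast; ring_nf
  have hω0 : ω ≠ 0 := Complex.exp_ne_zero _
  have hωn : ‖ω‖ = 1 := Complex.norm_exp_ofReal_mul_I θ
  have hq : ∀ (g : ℂ → ℂ), ∀ z ∈ openAnnulus ρ,
      symFactor θ l₁ l₂ z * (ω * z * g z) = (z - l₁) * (z - l₂) * g z := by
    intro g z hz
    have hz0 : z⁻¹ * z = 1 := inv_mul_cancel₀ (ne_zero_of_mem_openAnnulus hρ hz)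
    rw [symFactor]
    linear_combination ((z - l₁) * (z - l₂) * g z) * (z⁻¹ * z) * hω1 +
      ((z - l₁) * (z - l₂) * g z) * hz0
  have hS := sphere_subset_openAnnulus hρ
  have hk : ∀ {g : ℂ → ℂ}, DifferentiableOn ℂ g (openAnnulus ρ) →
      DifferentiableOn ℂ (fun z => ω * z * g z) (openAnnulus ρ) := fun hg =>
    ((differentiableOn_const ω).mul differentiableOn_id).mul hg
  have hk₁ := conj_quotient_symFactor hρ hsum hprod (hk hg₁) (hk hg₁) (fun z hz => by
    rw [hq g₁ z (hS hz), ← e₁]; exact hsk₁ z hz)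
  have hk₂ := conj_quotient_symFactor hρ hsum hprod (hk hg₂) (hk hg₃) (fun z hz => by
    rw [hq g₂ z (hS hz), hq g₃ z (hS hz), ← e₂, ← e₃]; exact hsk₂ z hz)
  -- The determinant of the trace-free matrix divided by the Sym factor; `ω * z * gᵢ z` are the
  -- quotients.
  set f : ℂ → ℂ := fun z => -((ω * z * g₁ z) ^ 2 + (ω * z * g₂ z) * (ω * z * g₃ z)) with hf
  have hfd : DifferentiableOn ℂ f (openAnnulus ρ) :=
    (((hk hg₁).pow 2).add ((hk hg₂).mul (hk hg₃))).neg
  have hfre : ∀ z ∈ sphere (0 : ℂ) 1,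
      (f z).re = ‖ω * z * g₁ z‖ ^ 2 + ‖ω * z * g₂ z‖ ^ 2 := by
    intro z hz
    have h1 := hk₁ z hz
    have h2 := hk₂ z hz
    have h3 : f z = ((‖ω * z * g₁ z‖ ^ 2 + ‖ω * z * g₂ z‖ ^ 2 : ℝ) : ℂ) := by
      push_cast
      rw [← Complex.mul_conj', ← Complex.mul_conj', h1, h2, hf]
      ring
    rw [h3, Complex.ofReal_re]
  set p : ℂ → ℂ := fun z => (z - l₁) * (z - l₂) with hp
  have hp0 : ∀ z : ℂ, ‖z‖ ≤ s⁻¹ → p z ≠ 0 := by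
    intro z hz
    refine mul_ne_zero (sub_ne_zero.mpr ?_) (sub_ne_zero.mpr ?_)
    · rintro rfl; exact absurd hl₁.1 (not_lt.mpr hz)
    · rintro rfl; exact absurd hl₂.1 (not_lt.mpr hz)
  have hsubρ : closedBall (0 : ℂ) s⁻¹ ⊆ ball 0 ρ := closedBall_subset_ball (by linarith)
  -- What `f` becomes when `Y` is replaced by the residue matrix. Both zeros of `p` lie outside the
  -- inner disc, so `g` is holomorphic there.
  set g : ℂ → ℂ := fun z => -(4 * Real.pi ^ 2 * ω ^ 2) * (-b z ^ 2 + a z * c z) / p z ^ 2 with hg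
  have hgd : DifferentiableOn ℂ g (closedBall 0 s⁻¹) := by
    refine DifferentiableOn.div ?_ ?_ fun z hz => pow_ne_zero 2 (hp0 z (by simpa using hz))
    · exact (((hb.mono hsubρ).pow 2).neg.add ((ha.mono hsubρ).mul (hc.mono hsubρ))).const_mul _
    · rw [hp]; fun_prop
  have hg0 : (g 0).re ≤ 0 := by
    -- Both normalisations enter here: `a 0 = 0` removes the product `a c`, and
    -- $p(0)=l_1l_2=e^{2i\theta}$ leaves the square of the imaginary number $e^{-i\theta}b(0)$, up
    -- to $4\pi^2$.
    have h1 : g 0 = ((4 * Real.pi ^ 2 : ℝ) : ℂ) * (Complex.exp (-θ * I) * b 0) ^ 2 := by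
      have h2 : Complex.exp (-θ * I) = ω⁻¹ := eq_inv_of_mul_eq_one_left hω1
      have h3 : p 0 = ω ^ 2 := by rw [hp, ← hω2, ← hprod]; ring
      rw [hg]; beta_reduce
      rw [h3, h2, ha0]
      push_cast
      field_simp
      ring
    rw [h1, Complex.re_ofReal_mul, sq (Complex.exp (-θ * I) * b 0), Complex.mul_re, hb0]
    have : 0 ≤ 4 * Real.pi ^ 2 := by positivity
    nlinarith [mul_self_nonneg (Complex.exp (-θ * I) * b 0).im]
  set d : ℝ := (‖l₁‖ - s⁻¹) * (‖l₂‖ - s⁻¹) with hd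
  have hd0 : 0 < d := mul_pos (by linarith [hl₁.1]) (by linarith [hl₂.1])
  have hfg : ∀ z ∈ sphere (0 : ℂ) s⁻¹, ‖f z - g z‖ ≤ 4 * Real.pi ^ 2 * (6 * (e * μ * μ)) / d ^ 2 := by
    intro z hz
    rw [mem_sphere_zero_iff_norm] at hz
    have hzA : z ∈ openAnnulus ρ := ⟨by rw [hz]; exact hρs, by rw [hz]; linarith⟩
    have hz0 : z ≠ 0 := ne_zero_of_mem_openAnnulus hρ hzA
    have h1 := congrArg Matrix.det (hY z hzA)
    rw [Matrix.det_smul, Matrix.det_mul, Matrix.det_mul, Fintype.card_fin,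
      Matrix.det_fin_two_of, e₁, e₂, e₃] at h1
    have h2 : (C z).det * (C' z).det = 1 := by rw [← Matrix.det_mul, hC z hzA, Matrix.det_one]
    have hzz : z⁻¹ * z = 1 := inv_mul_cancel₀ hz0
    have h3 : f z * p z ^ 2 = -(4 * Real.pi ^ 2 * ω ^ 2) * (Y z).det := by
      have h4 : f z * p z ^ 2 = ω ^ 2 * z ^ 2 * ((2 * Real.pi * I * z⁻¹) ^ 2 *
          ((C z).det * (Y z).det * (C' z).det)) := by
        rw [← h1, hf, hp]; ring
      rw [h4]
      have h5 : (C z).det * (Y z).det * (C' z).det = (Y z).det := by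
        linear_combination (Y z).det * h2
      rw [h5]
      have h6 : z ^ 2 * (2 * Real.pi * I * z⁻¹) ^ 2 = -(4 * Real.pi ^ 2) := by
        have : z ^ 2 * (2 * Real.pi * I * z⁻¹) ^ 2 = 4 * Real.pi ^ 2 * I ^ 2 * (z⁻¹ * z) ^ 2 := by
          ring
        rw [this, hzz, I_sq]; ring
      linear_combination (ω ^ 2 * (Y z).det) * h6
    have hpz := hp0 z hz.le
    have h7 : f z - g z = -(4 * Real.pi ^ 2 * ω ^ 2) *
        ((Y z).det - (residueMatrix (a z) (b z) (c z)).det) / p z ^ 2 := by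
      rw [det_residueMatrix, mul_sub, ← h3, hg]
      field_simp
    have h8 : ‖(Y z).det - (residueMatrix (a z) (b z) (c z)).det‖ ≤ 6 * (e * μ * μ) := by
      obtain ⟨m1, m2, m3⟩ := hμ z (by simp only [mem_closedBall_zero_iff]; linarith)
      exact Matrix.norm_det_sub_det_le heμ (norm_residueMatrix_entry_le m1 m2 m3)
        (hYX z hz.ge (by linarith))
    have h9 : d ≤ ‖p z‖ := by
      rw [hp, norm_mul]
      refine mul_le_mul ?_ ?_ (by linarith [hl₂.1]) (norm_nonneg _)
      · rw [← hz, norm_sub_rev]; exact norm_sub_norm_le _ _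
      · rw [← hz, norm_sub_rev]; exact norm_sub_norm_le _ _
    rw [h7, norm_div, norm_mul, norm_neg, norm_mul, norm_pow ω, hωn, one_pow, mul_one, norm_pow]
    have h10 : ‖(4 * Real.pi ^ 2 : ℂ)‖ = 4 * Real.pi ^ 2 := by
      simp [abs_of_pos Real.pi_pos]
    rw [h10]
    gcongr
  have hint := integral_re_le_of_norm_sub_le hs hsρ hfd hgd hg0 hfg
  have hpt : ∀ τ : ℝ, ‖residueMatrix (a (circleMap 0 1 τ)) (b (circleMap 0 1 τ))
      (c (circleMap 0 1 τ))‖ ^ 2 ≤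
      16 * κ ^ 4 * (1 + s) ^ 4 * (f (circleMap 0 1 τ)).re + 2 * e ^ 2 * μ ^ 2 := by
    intro τ
    set z := circleMap 0 1 τ with hz
    have hzS : z ∈ sphere (0 : ℂ) 1 := circleMap_mem_sphere 0 zero_le_one τ
    have hzn : ‖z‖ = 1 := mem_sphere_zero_iff_norm.mp hzS
    have hzA := hS hzS
    have hz0 : z ≠ 0 := ne_zero_of_mem_openAnnulus hρ hzA
    obtain ⟨k1, k2⟩ := hCκ z (by rw [hzn]; exact hs1.le) (by rw [hzn]; exact hs.le)
    have hκ0 : 0 ≤ κ := (norm_nonneg _).trans k1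
    rw [hfre z hzS]
    set u := ‖ω * z * g₁ z‖ with hu
    set v := ‖ω * z * g₂ z‖ with hv
    have hv' : ‖ω * z * g₃ z‖ = v := by
      rw [hv, ← norm_neg, ← hk₂ z hzS, RCLike.norm_conj]
    have hpn : ‖p z‖ ≤ (1 + s) ^ 2 := by
      rw [hp, norm_mul, sq]
      have t1 := norm_sub_le z l₁
      have t2 := norm_sub_le z l₂
      rw [hzn] at t1 t2
      exact mul_le_mul (by linarith [hl₁.2]) (by linarith [hl₂.2]) (norm_nonneg _) (by linarith)
    have hun : ‖ω * z‖ = 1 := by rw [norm_mul, hωn, hzn, mul_one]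
    have hent : ∀ {n g : ℂ → ℂ}, (∀ z, n z = (z - l₁) * (z - l₂) * g z) →
        ‖n z‖ ≤ (1 + s) ^ 2 * ‖ω * z * g z‖ := fun {n g} h => by
      rw [h z, norm_mul, norm_mul (ω * z), hun, one_mul]
      exact mul_le_mul_of_nonneg_right hpn (norm_nonneg _)
    have hN : ‖!![n₁ z, n₂ z; n₃ z, -n₁ z]‖ ≤ (1 + s) ^ 2 * (u + v) := by
      refine Matrix.linftyOp_norm_le_of_rows fun i => ?_
      have t1 := hent e₁
      have t2 := hent e₂
      have t3 := hent e₃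
      rw [hv'] at t3
      fin_cases i
      · simp; linarith
      · simp; linarith
    have hYN : ‖Y z‖ ≤ κ * κ * ‖!![n₁ z, n₂ z; n₃ z, -n₁ z]‖ := by
      have h1 : C' z * C z = 1 := mul_eq_one_comm.mp (hC z hzA)
      have h2 : (2 * Real.pi * I * z⁻¹) • Y z = C' z * !![n₁ z, n₂ z; n₃ z, -n₁ z] * C z := by
        rw [hY z hzA, mul_smul_comm, smul_mul_assoc]
        congr 1
        rw [← mul_assoc, ← mul_assoc, h1, one_mul, mul_assoc, h1, mul_one]
      have h3 := norm_mul_mul_le (y := !![n₁ z, n₂ z; n₃ z, -n₁ z]) k2 k1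
      rw [← h2, norm_smul] at h3
      have h4 : ‖(2 * Real.pi * I * z⁻¹ : ℂ)‖ = 2 * Real.pi := by
        simp [abs_of_pos Real.pi_pos, hzn]
      rw [h4] at h3
      refine le_trans (le_mul_of_one_le_left (norm_nonneg _) ?_) h3
      linarith [Real.pi_gt_three]
    have hXY : ‖residueMatrix (a z) (b z) (c z)‖ ≤ ‖Y z‖ + e * μ := by
      have t1 := hYX z (by rw [hzn]; exact hs1.le) (by rw [hzn]; exact hs.le)
      have t2 := norm_sub_norm_le (residueMatrix (a z) (b z) (c z)) (Y z)
      rw [norm_sub_rev] at t2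
      linarith
    have hX2 : ‖residueMatrix (a z) (b z) (c z)‖ ≤
        κ ^ 2 * (1 + s) ^ 2 * (u + v) + e * μ := by
      refine hXY.trans ?_
      have := mul_le_mul_of_nonneg_left hN (mul_nonneg hκ0 hκ0)
      linarith [show κ * κ * ((1 + s) ^ 2 * (u + v)) = κ ^ 2 * (1 + s) ^ 2 * (u + v) by ring]
    set T := κ ^ 2 * (1 + s) ^ 2 with hT
    have h5 : ‖residueMatrix (a z) (b z) (c z)‖ ^ 2 ≤ (T * (u + v) + e * μ) ^ 2 :=
      pow_le_pow_left₀ (norm_nonneg _) hX2 2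
    have h6 : κ ^ 4 * (1 + s) ^ 4 = T ^ 2 := by rw [hT]; ring
    rw [mul_assoc 16, h6]
    have h7 : 0 ≤ T ^ 2 * (u ^ 2 + v ^ 2) := by positivity
    -- The parallelogram identity, applied twice; it would give the factor `4` where `16` is
    -- claimed.
    have h8 : (T * (u + v) + e * μ) ^ 2 + (T * (u + v) - e * μ) ^ 2 + 2 * (T * (u - v)) ^ 2 =
        4 * (T ^ 2 * (u ^ 2 + v ^ 2)) + 2 * e ^ 2 * μ ^ 2 := by ring
    have h9 : 16 * (T ^ 2) * (u ^ 2 + v ^ 2) = 16 * (T ^ 2 * (u ^ 2 + v ^ 2)) := by ring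
    linarith [sq_nonneg (T * (u + v) - e * μ), sq_nonneg (T * (u - v))]
  have hcm : ∀ {F : ℂ → ℂ}, DifferentiableOn ℂ F (openAnnulus ρ) →
      Continuous fun τ : ℝ => F (circleMap 0 1 τ) := fun hF =>
    hF.continuousOn.comp_continuous (continuous_circleMap 0 1) fun τ =>
      hS (circleMap_mem_sphere 0 zero_le_one τ)
  have hcb : ∀ {F : ℂ → ℂ}, DifferentiableOn ℂ F (ball 0 ρ) →
      Continuous fun τ : ℝ => F (circleMap 0 1 τ) := fun hF =>
    hF.continuousOn.comp_continuous (continuous_circleMap 0 1) fun τ => by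
      simpa using hρ
  have hXc : Continuous fun τ : ℝ => residueMatrix (a (circleMap 0 1 τ)) (b (circleMap 0 1 τ))
      (c (circleMap 0 1 τ)) := by
    refine continuous_matrix fun i j => ?_
    fin_cases i <;> fin_cases j
    · exact (hcb hb).neg
    · exact hcb hc
    · exact (hcb ha).neg
    · exact hcb hb
  have hI : IntervalIntegrable
      (fun τ : ℝ => 16 * κ ^ 4 * (1 + s) ^ 4 * (f (circleMap 0 1 τ)).re)
      MeasureTheory.volume 0 (2 * Real.pi) :=
    (continuous_const.mul (Complex.continuous_re.comp (hcm hfd))).intervalIntegrable _ _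
  have hmono := intervalIntegral.integral_mono (μ := MeasureTheory.volume) Real.two_pi_pos.le
    (f := fun τ => ‖residueMatrix (a (circleMap 0 1 τ)) (b (circleMap 0 1 τ))
      (c (circleMap 0 1 τ))‖ ^ 2)
    (g := fun τ => 16 * κ ^ 4 * (1 + s) ^ 4 * (f (circleMap 0 1 τ)).re + 2 * e ^ 2 * μ ^ 2)
    ((hXc.norm.pow 2).intervalIntegrable _ _)
    (hI.add (continuous_const.intervalIntegrable _ _)) hpt
  refine hmono.trans ?_
  rw [intervalIntegral.integral_add hI (continuous_const.intervalIntegrable _ _),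
    intervalIntegral.integral_const_mul,
    intervalIntegral.integral_const, sub_zero, smul_eq_mul, meanConst, ← hd]
  have hfin := mul_le_mul_of_nonneg_left hint
    (by positivity : (0 : ℝ) ≤ 16 * κ ^ 4 * (1 + s) ^ 4)
  -- By `e ≤ 1` the quadratic error is linear in `e`; it accounts for the summand `4 * π` of
  -- `meanConst`.
  have hee : e ^ 2 * μ ^ 2 ≤ e * μ ^ 2 :=
    mul_le_mul_of_nonneg_right (by nlinarith) (sq_nonneg μ)
  have hpe := mul_le_mul_of_nonneg_left hee (by positivity : 0 ≤ 4 * Real.pi)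
  calc _ ≤ 16 * κ ^ 4 * (1 + s) ^ 4 *
        (2 * Real.pi * (4 * Real.pi ^ 2 * (6 * (e * μ * μ)) / d ^ 2)) +
        4 * Real.pi * (e * μ ^ 2) := by
        refine add_le_add hfin (le_trans (le_of_eq ?_) hpe); ring
    _ = _ := by ring

-- The tolerance depends only on `C`, `s` and the Sym points and not on `a`, `b`, `c`, so a single
-- one serves every small `t`.
set_option maxHeartbeats 1000000 in
theorem residue_eq_zero_of_estimate (hs : 1 < s) (hsρ : s < ρ) (hl₁ : s⁻¹ < ‖l₁‖ ∧ ‖l₁‖ < s)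
    (hl₂ : s⁻¹ < ‖l₂‖ ∧ ‖l₂‖ < s)
    (hsum : ∃ s : ℝ, l₁ + l₂ = Complex.exp (θ * I) * s)
    (hprod : l₁ * l₂ = Complex.exp (2 * θ * I))
    (hC : ∀ z ∈ openAnnulus ρ, C z * C' z = 1)
    (hCκ : ∀ z, s⁻¹ ≤ ‖z‖ → ‖z‖ ≤ s → ‖C z‖ ≤ κ ∧ ‖C' z‖ ≤ κ) :
    ∃ η > 0, ∀ a b c n₁ n₂ n₃ : ℂ → ℂ,
      DifferentiableOn ℂ a (ball 0 ρ) → DifferentiableOn ℂ b (ball 0 ρ) →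
      DifferentiableOn ℂ c (ball 0 ρ) →
      DifferentiableOn ℂ n₁ (openAnnulus ρ) → DifferentiableOn ℂ n₂ (openAnnulus ρ) →
      DifferentiableOn ℂ n₃ (openAnnulus ρ) →
      a 0 = 0 → (Complex.exp (-θ * I) * b 0).re = 0 →
      (n₁ l₁ = 0 ∧ n₂ l₁ = 0 ∧ n₃ l₁ = 0) →
      (l₂ ≠ l₁ → n₁ l₂ = 0 ∧ n₂ l₂ = 0 ∧ n₃ l₂ = 0) →
      (l₂ = l₁ → HasDerivAt n₁ 0 l₁ ∧ HasDerivAt n₂ 0 l₁ ∧ HasDerivAt n₃ 0 l₁) →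
      (∀ z ∈ sphere (0 : ℂ) 1, starRingEnd ℂ (n₁ z) = -n₁ z) →
      (∀ z ∈ sphere (0 : ℂ) 1, starRingEnd ℂ (n₂ z) = -n₃ z) →
      (∀ z, s⁻¹ ≤ ‖z‖ → ‖z‖ ≤ s → ‖!![n₁ z, n₂ z; n₃ z, -n₁ z] -
        (2 * Real.pi * I * z⁻¹) • (C z * residueMatrix (a z) (b z) (c z) * C' z)‖ ≤
          η * (‖a z‖ + ‖b z‖ + ‖c z‖)) →
      ∀ z ∈ closedBall (0 : ℂ) s, a z = 0 ∧ b z = 0 ∧ c z = 0 := by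
  have hρ : 1 < ρ := hs.trans hsρ
  have hs0 : 0 < s := by linarith
  have hsi : 0 < s⁻¹ := inv_pos.mpr hs0
  have hs1 : s⁻¹ < 1 := inv_lt_one_of_one_lt₀ hs
  have hρs : ρ⁻¹ < s⁻¹ := (inv_lt_inv₀ (by linarith) hs0).mpr hsρ
  have hκ0 : 0 ≤ κ := (norm_nonneg _).trans (hCκ 1 (by simpa using hs1.le) (by simpa using hs.le)).1
  set K := meanConst s κ l₁ l₂ * (1 - s⁻¹)⁻¹ with hK
  set P := s * (κ * κ) with hP
  have hP0 : 0 ≤ P := mul_nonneg hs0.le (mul_nonneg hκ0 hκ0)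
  -- This expression is the factor in the final inequality `μ ≤ (…) * μ`. It is continuous and
  -- vanishes at `e = 0`, so it is below `1` for some positive `e`.
  obtain ⟨e, he0, he1, hesm⟩ : ∃ e : ℝ, 0 < e ∧ e ≤ 1 ∧
      P * (2 * (2 * Real.pi * P * (2 * √(K * e) + e))) + e < 1 := by
    have hcont : Continuous fun e : ℝ =>
        P * (2 * (2 * Real.pi * P * (2 * √(K * e) + e))) + e := by fun_prop
    have h1 : ∀ᶠ e in 𝓝 (0 : ℝ), P * (2 * (2 * Real.pi * P * (2 * √(K * e) + e))) + e < 1 :=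
      hcont.continuousAt.eventually_lt_const (by simp)
    have h2 : ∀ᶠ e in 𝓝[>] (0 : ℝ), e ∈ Ioo (0 : ℝ) 1 := Ioo_mem_nhdsGT one_pos
    obtain ⟨e, h3, h4⟩ := ((h1.filter_mono nhdsWithin_le_nhds).and h2).exists
    exact ⟨e, h4.1, h4.2.le, h3⟩
  -- Each of three norms is at most `μ`, and conjugating back by `C` costs at most `P`; this leaves
  -- an error of `e * μ`.
  refine ⟨e / (3 * (P + 1)), by positivity, ?_⟩
  intro a b c n₁ n₂ n₃ ha hb hc hn₁ hn₂ hn₃ ha0 hb0 hz₁ hz₂ hz₃ hsk₁ hsk₂ hest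
  have hcb : closedBall (0 : ℂ) s ⊆ ball 0 ρ := closedBall_subset_ball hsρ
  -- a maximum on the circle of radius `s`
  obtain ⟨μ, hμ, w, hw, hwμ⟩ : ∃ μ : ℝ,
      (∀ z ∈ closedBall (0 : ℂ) s, ‖a z‖ ≤ μ ∧ ‖b z‖ ≤ μ ∧ ‖c z‖ ≤ μ) ∧
      ∃ w ∈ sphere (0 : ℂ) s, μ ≤ ‖residueMatrix (a w) (b w) (c w)‖ := by
    have hsph : (sphere (0 : ℂ) s).Nonempty := NormedSpace.sphere_nonempty.mpr hs0.le
    have hco : ∀ {F : ℂ → ℂ}, DifferentiableOn ℂ F (ball 0 ρ) → ContinuousOn F (sphere 0 s) :=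
      fun hF => hF.continuousOn.mono (sphere_subset_closedBall.trans hcb)
    obtain ⟨w, hw, hmax⟩ := (isCompact_sphere (0 : ℂ) s).exists_isMaxOn hsph
      ((hco ha).norm.sup ((hco hb).norm.sup (hco hc).norm))
    have hmax : ∀ z ∈ sphere (0 : ℂ) s,
        max ‖a z‖ (max ‖b z‖ ‖c z‖) ≤ max ‖a w‖ (max ‖b w‖ ‖c w‖) := isMaxOn_iff.mp hmax
    refine ⟨max ‖a w‖ (max ‖b w‖ ‖c w‖), ?_, w, hw, ?_⟩
    · have hmx : ∀ {F : ℂ → ℂ}, DifferentiableOn ℂ F (ball 0 ρ) →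
          (∀ z ∈ sphere (0 : ℂ) s, ‖F z‖ ≤ max ‖a w‖ (max ‖b w‖ ‖c w‖)) →
          ∀ z ∈ closedBall (0 : ℂ) s, ‖F z‖ ≤ max ‖a w‖ (max ‖b w‖ ‖c w‖) := by
        intro F hF hbd z hz
        refine Complex.norm_le_of_forall_mem_frontier_norm_le (U := ball (0 : ℂ) s) isBounded_ball
          ?_ (fun z hz => hbd z ?_) ?_
        · exact DifferentiableOn.diffContOnCl (by
            rw [closure_ball _ hs0.ne']; exact hF.mono hcb)
        · rwa [frontier_ball _ hs0.ne'] at hz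
        · rwa [closure_ball _ hs0.ne']
      intro z hz
      exact ⟨hmx ha (fun z hz => (le_max_left _ _).trans (hmax z hz)) z hz,
        hmx hb (fun z hz => ((le_max_left _ _).trans (le_max_right _ _)).trans (hmax z hz)) z hz,
        hmx hc (fun z hz => ((le_max_right _ _).trans (le_max_right _ _)).trans (hmax z hz)) z hz⟩
    · obtain ⟨t1, t2, t3⟩ := norm_le_norm_residueMatrix (a w) (b w) (c w)
      exact max_le t1 (max_le t2 t3)
  have hμ0 : 0 ≤ μ := (norm_nonneg _).trans (hμ 0 (by simp [hs0.le])).1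
  suffices hμz : μ ≤ 0 by
    intro z hz
    obtain ⟨t1, t2, t3⟩ := hμ z hz
    exact ⟨norm_le_zero_iff.mp (t1.trans hμz), norm_le_zero_iff.mp (t2.trans hμz),
      norm_le_zero_iff.mp (t3.trans hμz)⟩
  have hD0 : ∀ z : ℂ, z ≠ 0 → (2 * Real.pi * I * z⁻¹ : ℂ) ≠ 0 := fun z hz =>
    mul_ne_zero (by simp [Real.pi_ne_zero]) (inv_ne_zero hz)
  have hDn : ∀ z : ℂ, ‖(2 * Real.pi * I * z⁻¹ : ℂ)‖ = 2 * Real.pi * ‖z‖⁻¹ := fun z => by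
    simp [abs_of_pos Real.pi_pos]
  set N : ℂ → Matrix (Fin 2) (Fin 2) ℂ := fun z => !![n₁ z, n₂ z; n₃ z, -n₁ z] with hN
  set X : ℂ → Matrix (Fin 2) (Fin 2) ℂ := fun z => residueMatrix (a z) (b z) (c z) with hX
  set Y : ℂ → Matrix (Fin 2) (Fin 2) ℂ := fun z =>
    (2 * Real.pi * I * z⁻¹ : ℂ)⁻¹ • (C' z * N z * C z) with hYdef
  have hcl : ∀ z, s⁻¹ ≤ ‖z‖ → ‖z‖ ≤ s → z ∈ openAnnulus ρ := fun z h1 h2 =>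
    ⟨hρs.trans_le h1, h2.trans_lt hsρ⟩
  have hYN : ∀ z ∈ openAnnulus ρ, N z = (2 * Real.pi * I * z⁻¹) • (C z * Y z * C' z) := by
    intro z hz
    rw [hYdef]; beta_reduce
    rw [mul_smul_comm, smul_mul_assoc, smul_inv_smul₀ (hD0 z (ne_zero_of_mem_openAnnulus hρ hz)),
      ← mul_assoc, ← mul_assoc, hC z hz, one_mul, mul_assoc, hC z hz, mul_one]
  have hconj : ∀ z (A : Matrix (Fin 2) (Fin 2) ℂ), s⁻¹ ≤ ‖z‖ → ‖z‖ ≤ s →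
      ‖(2 * Real.pi * I * z⁻¹ : ℂ)⁻¹ • (C' z * A * C z)‖ ≤ P * ‖A‖ := by
    intro z A h1 h2
    obtain ⟨k1, k2⟩ := hCκ z h1 h2
    rw [norm_smul, norm_inv, hDn, mul_inv, inv_inv]
    have h3 : (2 * Real.pi)⁻¹ * ‖z‖ ≤ s := by
      have : (2 * Real.pi)⁻¹ ≤ 1 := inv_le_one_of_one_le₀ (by linarith [Real.pi_gt_three])
      nlinarith [norm_nonneg z]
    calc _ ≤ s * (κ * κ * ‖A‖) := mul_le_mul h3 (norm_mul_mul_le k2 k1) (norm_nonneg _) hs0.le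
      _ = P * ‖A‖ := by rw [hP]; ring
  have hYX : ∀ z, s⁻¹ ≤ ‖z‖ → ‖z‖ ≤ s → ‖Y z - X z‖ ≤ e * μ := by
    intro z h1 h2
    have hz := hcl z h1 h2
    have hCC : C' z * C z = 1 := mul_eq_one_comm.mp (hC z hz)
    have h3 : Y z - X z = (2 * Real.pi * I * z⁻¹ : ℂ)⁻¹ • (C' z *
        (N z - (2 * Real.pi * I * z⁻¹) • (C z * X z * C' z)) * C z) := by
      rw [mul_sub, sub_mul, smul_sub, mul_smul_comm, smul_mul_assoc,
        inv_smul_smul₀ (hD0 z (ne_zero_of_mem_openAnnulus hρ hz)), ← mul_assoc, ← mul_assoc, hCC,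
        one_mul, mul_assoc (X z), hCC, mul_one]
    rw [h3]
    refine (hconj z _ h1 h2).trans ?_
    obtain ⟨t1, t2, t3⟩ := hμ z (by simpa using h2)
    have h4 : e / (3 * (P + 1)) * (‖a z‖ + ‖b z‖ + ‖c z‖) ≤ e / (3 * (P + 1)) * (3 * μ) :=
      mul_le_mul_of_nonneg_left (by linarith) (by positivity)
    calc _ ≤ P * (e / (3 * (P + 1)) * (3 * μ)) :=
          mul_le_mul_of_nonneg_left ((hest z h1 h2).trans h4) hP0
      _ = P / (P + 1) * (e * μ) := by field_simp
      _ ≤ 1 * (e * μ) := mul_le_mul_of_nonneg_right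
          ((div_le_one (by positivity)).mpr (by linarith)) (by positivity)
      _ = e * μ := one_mul _
  have hint := integral_norm_sq_le hs hsρ hl₁ hl₂ hsum hprod hC hCκ ha hb hc hn₁ hn₂ hn₃ ha0 hb0
    hz₁ hz₂ hz₃ hsk₁ hsk₂ hYN he0.le he1 hμ hYX
  -- smallness on the inner circle
  have hS := sphere_subset_openAnnulus hρ
  have hcirc : ∀ {F : ℂ → ℂ}, DifferentiableOn ℂ F (ball 0 ρ) →
      Continuous fun τ : ℝ => F (circleMap 0 1 τ) := fun hF =>
    hF.continuousOn.comp_continuous (continuous_circleMap 0 1) fun τ => by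
      simpa using hρ
  have hXc : Continuous fun τ : ℝ => X (circleMap 0 1 τ) := by
    refine continuous_matrix fun i j => ?_
    fin_cases i <;> fin_cases j
    · exact (hcirc hb).neg
    · exact hcirc hc
    · exact (hcirc ha).neg
    · exact hcirc hb
  set ν := √(K * e) * μ with hν
  have hinner : ∀ {F : ℂ → ℂ}, DifferentiableOn ℂ F (ball 0 ρ) → (∀ z, ‖F z‖ ≤ ‖X z‖) →
      ∀ z, ‖z‖ ≤ s⁻¹ → ‖F z‖ ≤ ν := by
    intro F hF hFX z hz
    have h1 : (∫ τ in (0 : ℝ)..2 * Real.pi, ‖F (circleMap 0 1 τ)‖ ^ 2) ≤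
        ∫ τ in (0 : ℝ)..2 * Real.pi, ‖X (circleMap 0 1 τ)‖ ^ 2 :=
      intervalIntegral.integral_mono Real.two_pi_pos.le
        (((hcirc hF).norm.pow 2).intervalIntegrable _ _)
        ((hXc.norm.pow 2).intervalIntegrable _ _)
        fun τ => pow_le_pow_left₀ (norm_nonneg _) (hFX _) 2
    have h2 := norm_sq_le_of_integral_le hs hsρ hF (h1.trans hint) hz
    have h3 : ‖F z‖ ^ 2 ≤ K * e * μ ^ 2 := h2.trans_eq (by rw [hK]; ring)
    have h4 := Real.sqrt_le_sqrt h3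
    rwa [Real.sqrt_sq (norm_nonneg _), Real.sqrt_mul' _ (sq_nonneg μ), Real.sqrt_sq hμ0] at h4
  have hXbound : ∀ z, ‖z‖ ≤ s⁻¹ → ‖X z‖ ≤ 2 * ν := fun z hz =>
    Matrix.linftyOp_norm_le_of_entries (norm_residueMatrix_entry_le
      (hinner ha (fun z => (norm_le_norm_residueMatrix _ _ _).1) z hz)
      (hinner hb (fun z => (norm_le_norm_residueMatrix _ _ _).2.1) z hz)
      (hinner hc (fun z => (norm_le_norm_residueMatrix _ _ _).2.2) z hz))
  have hNbound : ∀ z, ‖z‖ = s⁻¹ → ‖N z‖ ≤ 2 * Real.pi * P * (2 * ν + e * μ) := by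
    intro z hz
    have h2 : ‖z‖ ≤ s := by rw [hz]; linarith
    obtain ⟨k1, k2⟩ := hCκ z hz.ge h2
    rw [hYN z (hcl z hz.ge h2), norm_smul, hDn, hz, inv_inv]
    have h3 : ‖Y z‖ ≤ 2 * ν + e * μ := by
      have t1 := hYX z hz.ge h2
      have t2 := norm_sub_norm_le (Y z) (X z)
      linarith [hXbound z hz.le]
    calc _ ≤ 2 * Real.pi * s * (κ * κ * ‖Y z‖) :=
          mul_le_mul_of_nonneg_left (norm_mul_mul_le k1 k2) (by positivity)
      _ ≤ 2 * Real.pi * s * (κ * κ * (2 * ν + e * μ)) := by gcongr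
      _ = _ := by rw [hP]; ring
  -- reflection to the outer circle
  have hwn : ‖w‖ = s := mem_sphere_zero_iff_norm.mp hw
  have hwi : ‖(starRingEnd ℂ w)⁻¹‖ = s⁻¹ := by rw [norm_inv, RCLike.norm_conj, hwn]
  have hwA : w ∈ openAnnulus ρ := hcl w (by linarith) hwn.le
  have hNw : ‖N w‖ ≤ 2 * (2 * Real.pi * P * (2 * ν + e * μ)) := by
    have hE := fun i j => (Matrix.norm_entry_le_linftyOp (N (starRingEnd ℂ w)⁻¹) i j).trans
      (hNbound _ hwi)
    have r1 := conj_reflection_eq_neg hρ hn₁ hn₁ hsk₁ w hwA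
    have r2 := conj_reflection_eq_neg hρ hn₂ hn₃ hsk₂ w hwA
    have r3 := conj_reflection_eq_neg hρ hn₃ hn₂ (fun z hz => by
      have := congrArg (starRingEnd ℂ) (hsk₂ z hz)
      rw [Complex.conj_conj, map_neg] at this
      rw [this, neg_neg]) w hwA
    have r1' := congrArg norm r1
    have r2' := congrArg norm r2
    have r3' := congrArg norm r3
    rw [RCLike.norm_conj, norm_neg] at r1' r2' r3'
    refine Matrix.linftyOp_norm_le_of_entries fun i j => ?_
    fin_cases i <;> fin_cases j
    · simpa [hN, ← r1'] using hE 0 0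
    · simpa [hN, ← r3'] using hE 1 0
    · simpa [hN, ← r2'] using hE 0 1
    · simpa [hN, ← r1'] using hE 0 0
  have hYw : ‖Y w‖ ≤ P * ‖N w‖ := hconj w (N w) (by linarith) hwn.le
  have hXw : ‖X w‖ ≤ ‖Y w‖ + e * μ := by
    have t1 := hYX w (by linarith) hwn.le
    have t2 := norm_sub_norm_le (X w) (Y w)
    rw [norm_sub_rev] at t2
    linarith
  -- `w` is a point where the maximum `μ` is attained, so the estimate at `w` bounds `μ` by itself.
  have hfin : μ ≤ (P * (2 * (2 * Real.pi * P * (2 * √(K * e) + e))) + e) * μ := by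
    have h1 := mul_le_mul_of_nonneg_left hNw hP0
    calc μ ≤ P * (2 * (2 * Real.pi * P * (2 * ν + e * μ))) + e * μ := by linarith
      _ = _ := by rw [hν]; ring
  nlinarith

end Rigidity

/-! ### The monodromy of a perturbed linear differential equation. -/

section ODE

theorem sub_eq_sub_mul_add {𝔸 : Type*} [Ring 𝔸] (x c ψ : 𝔸) : x * ψ - c = (x - c) * ψ + c * (ψ - 1) := by
  rw [sub_mul, mul_sub, mul_one]; abel

theorem mul_mul_sub_eq_sub_mul_add {𝔸 : Type*} [Ring 𝔸] (x c y ψ : 𝔸) :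
    x * y * ψ - c * y = (x - c) * y * ψ + c * y * (ψ - 1) := by
  rw [sub_mul, sub_mul, mul_sub, mul_one]; abel

variable {𝔸 : Type*} [NormedRing 𝔸] [NormedAlgebra ℂ 𝔸]

/-- The coefficients of the power series solution of `Ψ' = -Θ Ψ`, `Ψ(0) = 1`. -/
noncomputable def linearODECoeff (θ : ℕ → 𝔸) : ℕ → 𝔸
  | 0 => 1
  | n + 1 => -(((n : ℂ) + 1)⁻¹ • ∑ k : Fin (n + 1), θ k * linearODECoeff θ (n - k))
termination_by n => n
decreasing_by omega

theorem linearODECoeff_zero (θ : ℕ → 𝔸) : linearODECoeff θ 0 = 1 := by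
  rw [linearODECoeff]

theorem linearODECoeff_succ (θ : ℕ → 𝔸) (n : ℕ) :
    ((n : ℂ) + 1) • linearODECoeff θ (n + 1) =
      -∑ k ∈ Finset.range (n + 1), θ k * linearODECoeff θ (n - k) := by
  have h : (n : ℂ) + 1 ≠ 0 := Nat.cast_add_one_ne_zero n
  rw [linearODECoeff, smul_neg, smul_inv_smul₀ h,
    Finset.sum_range fun k => θ k * linearODECoeff θ (n - k)]

/-- The residue of the conjugated principal part. -/
theorem conj_one_add_smul {F : 𝔸} (E : 𝔸) (x : ℂ) :
    (1 + x • F) * E * (1 - x • F) =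
      E + x • (F * E - E * F) - x ^ 2 • (F * E * F) := by
  simp only [add_mul, mul_sub, mul_one, one_mul, smul_mul_assoc, mul_smul_comm]
  module

theorem mul_conj_cancel {F : 𝔸} (hF : F * F = 0) (x : ℂ) (y : 𝔸) :
    (1 - x • F) * ((1 + x • F) * y) = y := by
  have h : (1 - x • F) * (1 + x • F) = 1 := by
    simp only [sub_mul, mul_add, mul_one, one_mul, smul_mul_assoc, mul_smul_comm, hF, smul_zero]
    module
  rw [← mul_assoc, h, one_mul]

/-- The product rule for `U * (1 - z ^ m • F) * Ψ`, with `x = z ^ m`, `e = dz/dw` and `d = m z ^ (m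
- 1)`. The equation for `Ψ` is chosen so that everything holomorphic at `z = 0` cancels and only the
principal part `f` is left. -/
theorem gauge_derivative {F : 𝔸} (hF : F * F = 0) (E U Ψ Ξ : 𝔸) (x e f d : ℂ) :
    (U * (e • (f • E + Ξ)) * (1 - x • F) + U * -((e * d) • F)) * Ψ +
      U * (1 - x • F) * (e • -((1 + x • F) * (Ξ - d • F) * (1 - x • F) * Ψ)) =
    U * (1 - x • F) * ((e * f) • ((1 + x • F) * E * (1 - x • F))) * Ψ := by
  have h1 : F * (1 - x • F) = F := by
    rw [mul_sub, mul_smul_comm, hF, smul_zero, mul_one, sub_zero]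
  have h2 : U * (1 - x • F) * ((e * f) • ((1 + x • F) * E * (1 - x • F))) =
      (e * f) • (U * E * (1 - x • F)) := by
    rw [mul_smul_comm, mul_assoc U, mul_assoc (1 + x • F), mul_conj_cancel hF, ← mul_assoc]
  have h3 : U * (1 - x • F) * (e • -((1 + x • F) * (Ξ - d • F) * (1 - x • F) * Ψ)) =
      -(e • (U * (Ξ - d • F) * (1 - x • F) * Ψ)) := by
    rw [mul_smul_comm, mul_neg, smul_neg, mul_assoc U]
    simp only [mul_assoc]
    rw [mul_conj_cancel hF]
  have h4 : U * (d • F) * (1 - x • F) = d • (U * F) := by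
    rw [mul_smul_comm, smul_mul_assoc, mul_assoc U F, h1]
  have h5 : U * (e • (f • E + Ξ)) * (1 - x • F) =
      (e * f) • (U * E * (1 - x • F)) + e • (U * Ξ * (1 - x • F)) := by
    rw [mul_smul_comm, smul_mul_assoc, mul_add, add_mul, smul_add, mul_smul_comm, smul_mul_assoc,
      mul_smul]
  rw [h2, h3, h5, mul_sub U, sub_mul, h4]
  simp only [add_mul, sub_mul, mul_neg, neg_mul, smul_mul_assoc, mul_smul_comm]
  module

/-- In the variable `w` the integrand is a combination of $e^{kmw}$ with $-2\le k\le2$. All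
primitives are `2πi`-periodic except that of the constant term, whose coefficient is the residue. -/
theorem exists_primitive_principal {m : ℕ} (hm : 1 ≤ m) (α β γ : ℂ) (E B H : 𝔸) :
    ∃ Q : ℂ → 𝔸, (∀ w, HasDerivAt Q ((Complex.exp w * (α / Complex.exp w ^ (2 * m + 1) +
      β / Complex.exp w ^ (m + 1) + γ / Complex.exp w)) •
        (E + Complex.exp w ^ m • B - (Complex.exp w ^ m) ^ 2 • H)) w) ∧
      ∀ w, Q (w + 2 * Real.pi * I) - Q w = (2 * Real.pi * I) • (γ • E + β • B - α • H) := by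
  have hm0 : (m : ℂ) ≠ 0 := by exact_mod_cast (by omega : m ≠ 0)
  have hexp : ∀ (c w : ℂ) (v : 𝔸), HasDerivAt (fun w : ℂ => Complex.exp (c * w) • v)
      ((Complex.exp (c * w) * c) • v) w := fun c w v => by
    have h1 : HasDerivAt (fun w : ℂ => c * w) c w := by simpa using (hasDerivAt_id w).const_mul c
    exact h1.cexp.smul_const v
  have hper : ∀ (c w : ℂ) (v : 𝔸), (∃ n : ℤ, c = n) →
      Complex.exp (c * (w + 2 * Real.pi * I)) • v = Complex.exp (c * w) • v := by
    rintro c w v ⟨n, rfl⟩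
    rw [mul_add, Complex.exp_add, Complex.exp_int_mul_two_pi_mul_I, mul_one]
  refine ⟨fun w => w • (γ • E + β • B - α • H) +
    Complex.exp (-(2 * m) * w) • ((-(2 * m : ℂ))⁻¹ • α • E) +
    Complex.exp (-m * w) • ((-(m : ℂ))⁻¹ • (α • B + β • E)) +
    Complex.exp (m * w) • ((m : ℂ)⁻¹ • (γ • B - β • H)) -
    Complex.exp (2 * m * w) • ((2 * m : ℂ)⁻¹ • γ • H), fun w => ?_, fun w => ?_⟩
  · have h1 := ((((hasDerivAt_id w).smul_const (γ • E + β • B - α • H)).fun_add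
      (hexp (-(2 * m)) w ((-(2 * m : ℂ))⁻¹ • α • E))).fun_add
      (hexp (-m) w ((-(m : ℂ))⁻¹ • (α • B + β • E)))).fun_add
      (hexp m w ((m : ℂ)⁻¹ • (γ • B - β • H)))
    have h2 := h1.fun_sub (hexp (2 * m) w ((2 * m : ℂ)⁻¹ • γ • H))
    refine h2.congr_deriv ?_
    have e1 : Complex.exp (m * w) = Complex.exp w ^ m := by rw [← Complex.exp_nat_mul]
    have e2 : Complex.exp (2 * m * w) = (Complex.exp w ^ m) ^ 2 := by
      rw [← e1, ← Complex.exp_nat_mul]; push_cast; ring_nf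
    have e3 : Complex.exp (-m * w) = (Complex.exp w ^ m)⁻¹ := by
      rw [← e1, ← Complex.exp_neg]; ring_nf
    have e4 : Complex.exp (-(2 * m) * w) = ((Complex.exp w ^ m) ^ 2)⁻¹ := by
      rw [← e2, ← Complex.exp_neg]; ring_nf
    have e5 : Complex.exp w * (α / Complex.exp w ^ (2 * m + 1) +
        β / Complex.exp w ^ (m + 1) + γ / Complex.exp w) =
        α * ((Complex.exp w ^ m) ^ 2)⁻¹ + β * (Complex.exp w ^ m)⁻¹ + γ := by
      have hx : Complex.exp w ≠ 0 := Complex.exp_ne_zero w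
      rw [pow_succ, pow_succ, mul_comm 2 m, pow_mul]
      field_simp
    rw [e1, e2, e3, e4, e5]
    have hx : Complex.exp w ^ m ≠ 0 := pow_ne_zero _ (Complex.exp_ne_zero w)
    generalize Complex.exp w ^ m = x at hx
    match_scalars <;> field_simp <;> ring
  · beta_reduce
    rw [hper _ _ _ ⟨-(2 * m), by push_cast; ring⟩, hper _ _ _ ⟨-m, by push_cast; ring⟩,
      hper _ _ _ ⟨m, by push_cast; ring⟩, hper _ _ _ ⟨2 * m, by push_cast; ring⟩, add_smul]
    abel

variable [NormOneClass 𝔸]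

/-- In the recursion each of the `n + 1` products is at most $eR^{-n}$, and their number cancels the
factor `n + 1`. The condition `e * R ≤ 1` keeps the earlier coefficients below $R^{-k}$. -/
theorem norm_linearODECoeff_le {θ : ℕ → 𝔸} {e R : ℝ} (hR : 0 < R) (he : 0 ≤ e) (he1 : e * R ≤ 1)
    (hθ : ∀ n, ‖θ n‖ ≤ e * R⁻¹ ^ n) (n : ℕ) :
    ‖linearODECoeff θ (n + 1)‖ ≤ e * R * R⁻¹ ^ (n + 1) := by
  induction n using Nat.strong_induction_on with
  | _ n ih =>
    have hall : ∀ k ≤ n, ‖linearODECoeff θ k‖ ≤ R⁻¹ ^ k := by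
      intro k hk
      rcases k with _ | k
      · simp [linearODECoeff_zero]
      · exact (ih k (by omega)).trans (mul_le_of_le_one_left (by positivity) he1)
    have h1 := congrArg norm (linearODECoeff_succ θ n)
    rw [norm_smul, norm_neg] at h1
    have h2 : ‖((n : ℂ) + 1)‖ = n + 1 := by
      rw [← Nat.cast_add_one, Complex.norm_natCast, Nat.cast_add_one]
    have h3 : ‖∑ k ∈ Finset.range (n + 1), θ k * linearODECoeff θ (n - k)‖ ≤
        ∑ k ∈ Finset.range (n + 1), e * R⁻¹ ^ n := by
      refine norm_sum_le_of_le _ fun k hk => (norm_mul_le _ _).trans ?_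
      have hk' : k ≤ n := by simpa [Nat.lt_succ_iff] using hk
      calc _ ≤ e * R⁻¹ ^ k * R⁻¹ ^ (n - k) :=
            mul_le_mul (hθ k) (hall _ (Nat.sub_le _ _)) (norm_nonneg _) (by positivity)
        _ = e * R⁻¹ ^ n := by rw [mul_assoc, ← pow_add, Nat.add_sub_cancel' hk']
    rw [Finset.sum_const, Finset.card_range, nsmul_eq_mul, ← h1, h2, Nat.cast_add_one] at h3
    refine (le_of_mul_le_mul_left h3 (by positivity)).trans_eq ?_
    rw [pow_succ]
    field_simp

/-- A holomorphic linear differential equation on a disc with a small coefficient has a solution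
close to the identity. -/
theorem exists_linearODE_solution [CompleteSpace 𝔸] {Θ : ℂ → 𝔸} {r R e : ℝ} (hR : 0 < R)
    (hRr : R < r) (he1 : e * R ≤ 1) (hΘ : DifferentiableOn ℂ Θ (ball 0 r))
    (hb : ∀ z ∈ sphere (0 : ℂ) R, ‖Θ z‖ ≤ e) :
    ∃ Ψ : ℂ → 𝔸, ∀ z ∈ ball (0 : ℂ) R, HasDerivAt Ψ (-(Θ z * Ψ z)) z ∧
      ‖Ψ z - 1‖ ≤ e * R * (1 - ‖z‖ * R⁻¹)⁻¹ := by
  have he : 0 ≤ e := (norm_nonneg _).trans (hb R (by simp [hR.le]))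
  lift R to NNReal using hR.le
  have hps := (hΘ.mono (closedBall_subset_ball hRr)).hasFPowerSeriesOnBall (by exact_mod_cast hR)
  set θ : ℕ → 𝔸 := fun n => (cauchyPowerSeries Θ 0 R).coeff n with hθdef
  have hθ : ∀ n, ‖θ n‖ ≤ e * (R : ℝ)⁻¹ ^ n := by
    intro n
    rw [hθdef]; beta_reduce
    rw [← FormalMultilinearSeries.norm_apply_eq_norm_coef]
    refine (norm_cauchyPowerSeries_le Θ 0 R n).trans ?_
    rw [abs_of_pos hR]
    refine mul_le_mul_of_nonneg_right ?_ (by positivity)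
    have h1 : ‖∫ τ in (0 : ℝ)..2 * Real.pi, ‖Θ (circleMap 0 R τ)‖‖ ≤ e * |2 * Real.pi - 0| :=
      intervalIntegral.norm_integral_le_of_norm_le_const fun τ _ => by
        rw [norm_norm]; exact hb _ (circleMap_mem_sphere 0 hR.le τ)
    rw [sub_zero, abs_of_pos Real.two_pi_pos] at h1
    rw [inv_mul_le_iff₀ Real.two_pi_pos]
    linarith [le_abs_self (∫ τ in (0 : ℝ)..2 * Real.pi, ‖Θ (circleMap 0 R τ)‖),
      Real.norm_eq_abs (∫ τ in (0 : ℝ)..2 * Real.pi, ‖Θ (circleMap 0 R τ)‖)]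
  have hsum : ∀ z ∈ ball (0 : ℂ) R, HasSum (fun n => z ^ n • θ n) (Θ z) := by
    intro z hz
    have h1 := hps.hasSum (y := z) (by simpa using hz)
    simpa [hθdef, zero_add] using h1
  set ψ := linearODECoeff θ with hψ
  have hψb := norm_linearODECoeff_le hR he he1 hθ
  have hψ1 : ∀ n, ‖ψ n‖ ≤ (R : ℝ)⁻¹ ^ n := by
    intro n
    rcases n with _ | n
    · simp [hψ, linearODECoeff_zero]
    · exact (hψb n).trans (mul_le_of_le_one_left (by positivity) he1)
  have hq : ∀ {x : ℝ}, 0 ≤ x → x < R → 0 ≤ x * (R : ℝ)⁻¹ ∧ x * (R : ℝ)⁻¹ < 1 := fun h0 h1 =>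
    ⟨by positivity, by rwa [← div_eq_mul_inv, div_lt_one hR]⟩
  have hnorm : ∀ z ∈ ball (0 : ℂ) R, ∀ n, ‖z ^ n • ψ n‖ ≤ (‖z‖ * (R : ℝ)⁻¹) ^ n := by
    intro z hz n
    rw [norm_smul, norm_pow, mul_pow]
    exact mul_le_mul_of_nonneg_left (hψ1 n) (by positivity)
  have hgeo : ∀ z ∈ ball (0 : ℂ) R, Summable fun n : ℕ => (‖z‖ * (R : ℝ)⁻¹) ^ n := fun z hz =>
    have h := hq (norm_nonneg z) (by simpa using hz)
    summable_geometric_of_lt_one h.1 h.2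
  have hsψ : ∀ z ∈ ball (0 : ℂ) R, Summable fun n => ‖z ^ n • ψ n‖ := fun z hz =>
    (hgeo z hz).of_nonneg_of_le (fun _ => norm_nonneg _) (hnorm z hz)
  have hsθ : ∀ z ∈ ball (0 : ℂ) R, Summable fun n => ‖z ^ n • θ n‖ := fun z hz =>
    ((hgeo z hz).mul_left e).of_nonneg_of_le (fun _ => norm_nonneg _) fun n => by
      rw [norm_smul, norm_pow, mul_pow]
      calc _ ≤ ‖z‖ ^ n * (e * (R : ℝ)⁻¹ ^ n) :=
            mul_le_mul_of_nonneg_left (hθ n) (by positivity)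
        _ = _ := by ring
  refine ⟨fun z => ∑' n, z ^ n • ψ n, fun z hz => ⟨?_, ?_⟩⟩
  -- A smaller disc around `0` containing `z` provides the uniform summable bound needed to
  -- differentiate termwise.
  · obtain ⟨R₁, hzR, hR₁⟩ := exists_between (show ‖z‖ < R by simpa using hz)
    have hR₁0 : 0 ≤ R₁ := (norm_nonneg z).trans hzR.le
    have hq1 := hq hR₁0 hR₁
    have hu : Summable fun n : ℕ => (R : ℝ)⁻¹ * (n * (R₁ * (R : ℝ)⁻¹) ^ (n - 1)) := by
      refine Summable.mul_left _ ((summable_nat_add_iff 1).mp ?_)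
      have hn : ‖R₁ * (R : ℝ)⁻¹‖ < 1 := by rw [Real.norm_of_nonneg hq1.1]; exact hq1.2
      refine ((summable_pow_mul_geometric_of_norm_lt_one 1 hn).add
        (summable_geometric_of_norm_lt_one hn)).congr fun n => ?_
      rw [pow_one, Nat.cast_add_one, Nat.add_sub_cancel]
      ring
    have hbd : ∀ (n : ℕ) (y : ℂ), y ∈ ball (0 : ℂ) R₁ → ‖((n : ℂ) * y ^ (n - 1)) • ψ n‖ ≤
        (R : ℝ)⁻¹ * (n * (R₁ * (R : ℝ)⁻¹) ^ (n - 1)) := by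
      intro n y hy
      have hy' : ‖y‖ ≤ R₁ := (mem_ball_zero_iff.mp hy).le
      rcases n with _ | n
      · simp
      · rw [norm_smul, norm_mul, Complex.norm_natCast, norm_pow, Nat.add_sub_cancel]
        calc _ ≤ ((n + 1 : ℕ) : ℝ) * R₁ ^ n * (R : ℝ)⁻¹ ^ (n + 1) :=
              mul_le_mul (mul_le_mul_of_nonneg_left (pow_le_pow_left₀ (norm_nonneg _) hy' n)
                (by positivity)) (hψ1 _) (norm_nonneg _) (by positivity)
          _ = _ := by rw [mul_pow, pow_succ]; ring
    have hder := hasDerivAt_tsum_of_isPreconnected (𝕜 := ℂ)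
      (g := fun n z => z ^ n • ψ n) (g' := fun n z => ((n : ℂ) * z ^ (n - 1)) • ψ n)
      (t := ball 0 R₁) (y := z) (y₀ := z) hu isOpen_ball (convex_ball _ _).isPreconnected
      (fun n y _ => by simpa using ((hasDerivAt_pow n y).smul_const (ψ n))) hbd
      (by simpa using hzR) (hsψ z hz).of_norm (by simpa using hzR)
    · refine hder.congr_deriv ?_
      have hs1 : Summable fun n : ℕ => ((n : ℂ) * z ^ (n - 1)) • ψ n :=
        hu.of_norm_bounded fun n => hbd n z (by simpa using hzR)
      rw [hs1.tsum_eq_zero_add]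
      have h2 := tsum_mul_tsum_eq_tsum_sum_range_of_summable_norm (hsθ z hz) (hsψ z hz)
      rw [(hsum z hz).tsum_eq] at h2
      rw [h2, ← tsum_neg]
      simp only [Nat.cast_zero, zero_mul, zero_smul, zero_add, Nat.add_sub_cancel]
      refine tsum_congr fun n => ?_
      rw [mul_comm, mul_smul, Nat.cast_add_one, linearODECoeff_succ, smul_neg, Finset.smul_sum]
      congr 1
      refine Finset.sum_congr rfl fun k hk => ?_
      have hk' : k ≤ n := by simpa [Nat.lt_succ_iff] using hk
      rw [smul_mul_smul_comm, ← pow_add, Nat.add_sub_cancel' hk']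
  · have h1 : (∑' n, z ^ n • ψ n) - 1 = ∑' n, z ^ (n + 1) • ψ (n + 1) := by
      rw [(hsψ z hz).of_norm.tsum_eq_zero_add, hψ, linearODECoeff_zero]
      simp
    rw [h1]
    have h := hq (norm_nonneg z) (by simpa using hz)
    refine tsum_of_norm_bounded ((hasSum_geometric_of_lt_one h.1 h.2).mul_left (e * R)) fun n => ?_
    rw [norm_smul, norm_pow]
    calc _ ≤ ‖z‖ ^ (n + 1) * (e * R * (R : ℝ)⁻¹ ^ (n + 1)) :=
          mul_le_mul_of_nonneg_left (hψb n) (by positivity)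
      _ = e * R * (‖z‖ * (R : ℝ)⁻¹) ^ n * (‖z‖ * (R : ℝ)⁻¹) := by rw [mul_pow]; ring
      _ ≤ e * R * (‖z‖ * (R : ℝ)⁻¹) ^ n := mul_le_of_le_one_right (by positivity) h.2.le

-- A correction `Ψ`, single-valued in the disc, removes the holomorphic part of the gauged potential
-- without changing the monodromy. What remains is driven by the principal part alone, so the error
-- is proportional to `‖α‖ + ‖β‖ + ‖γ‖`.
set_option maxHeartbeats 1000000 in
theorem monodromy_estimate [CompleteSpace 𝔸] {m : ℕ} (hm : 1 ≤ m) {w₀ : ℂ} {R r κ η : ℝ}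
    (hwR : ‖Complex.exp w₀‖ < R) (hRr : R < r) (E : 𝔸) {F : 𝔸} (hF : F * F = 0) (hη : 0 < η) :
    ∃ ε > 0, ∀ (C C' D : 𝔸) (U Ξ : ℂ → 𝔸) (α β γ : ℂ), C * C' = 1 → ‖C‖ ≤ κ → ‖C'‖ ≤ κ →
      DifferentiableOn ℂ Ξ (ball 0 r) →
      (∀ w ∈ segment ℝ w₀ (w₀ + 2 * Real.pi * I), HasDerivAt U
        (U w * (Complex.exp w • ((α / Complex.exp w ^ (2 * m + 1) + β / Complex.exp w ^ (m + 1) +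
          γ / Complex.exp w) • E + Ξ (Complex.exp w)))) w) →
      (∀ z ∈ sphere (0 : ℂ) R, ‖Ξ z - ((m : ℂ) * z ^ (m - 1)) • F‖ ≤ ε) →
      (∀ w ∈ segment ℝ w₀ (w₀ + 2 * Real.pi * I),
        ‖U w * (1 - Complex.exp w ^ m • F) - C‖ ≤ ε) →
      (1 + D) * U w₀ = U (w₀ + 2 * Real.pi * I) →
      ‖D - (2 * Real.pi * I) • (C * (γ • E + β • (F * E - E * F) - α • (F * E * F)) * C')‖ ≤
        η * (‖α‖ + ‖β‖ + ‖γ‖) := by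
  have hr0 : 0 < ‖Complex.exp w₀‖ := norm_pos_iff.mpr (Complex.exp_ne_zero _)
  set r₀ := ‖Complex.exp w₀‖ with hr₀
  have hR : 0 < R := hr0.trans hwR
  set g := 1 + R ^ m * ‖F‖ with hg
  have hg0 : 0 ≤ g := by positivity
  set K₁ := g * g * R * (1 - r₀ * R⁻¹)⁻¹ with hK₁
  have hrR : r₀ * R⁻¹ < 1 := by rwa [← div_eq_mul_inv, div_lt_one hR]
  have hK₁0 : 0 ≤ K₁ := mul_nonneg (by positivity) (inv_nonneg.mpr (by linarith))
  set k := |κ| with hk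
  set K₂ := 1 + K₁ + k * K₁ with hK₂
  have hK₂0 : 0 ≤ K₂ := by positivity
  set p := (r₀⁻¹ ^ (2 * m) + r₀⁻¹ ^ m + 1) * (g * g * ‖E‖) with hp
  set j := ‖E‖ + ‖F * E - E * F‖ + ‖F * E * F‖ with hj
  set K₃ := k * K₂ * (2 * Real.pi * p + (4 * Real.pi * k * k * j + 2 * Real.pi * p)) with hK₃
  have hK₃0 : 0 ≤ K₃ := by positivity
  -- The four bounds serve, in order, to bound `Ψ`, to solve the auxiliary equation, to absorb
  -- `‖D‖`, and to reach the tolerance `η`.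
  refine ⟨min (min 1 (g * g * R + 1)⁻¹) (min (2 * k * K₂ + 1)⁻¹ (η / (K₃ + 1))), by positivity, ?_⟩
  generalize hε : min (min 1 (g * g * R + 1)⁻¹) (min (2 * k * K₂ + 1)⁻¹ (η / (K₃ + 1))) = ε
  have hε0 : 0 < ε := by rw [← hε]; positivity
  have hε1 : ε ≤ 1 := by rw [← hε]; exact (min_le_left _ _).trans (min_le_left _ _)
  have hεR : ε * (g * g * R + 1) ≤ 1 := by
    have : ε ≤ (g * g * R + 1)⁻¹ := by rw [← hε]; exact (min_le_left _ _).trans (min_le_right _ _)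
    rwa [le_inv_comm₀ hε0 (by positivity), ← one_div, le_div_iff₀ hε0, mul_comm] at this
  have hεK : ε * (2 * k * K₂ + 1) ≤ 1 := by
    have : ε ≤ (2 * k * K₂ + 1)⁻¹ := by
      rw [← hε]; exact (min_le_right _ _).trans (min_le_left _ _)
    rwa [le_inv_comm₀ hε0 (by positivity), ← one_div, le_div_iff₀ hε0, mul_comm] at this
  have hεη : ε * (K₃ + 1) ≤ η := by
    have : ε ≤ η / (K₃ + 1) := by rw [← hε]; exact (min_le_right _ _).trans (min_le_right _ _)
    rwa [le_div_iff₀ (by positivity)] at this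
  clear hε
  intro C C' D U Ξ α β γ hCC hC hC' hΞ hU hΞε hUε hD
  replace hC : ‖C‖ ≤ k := hC.trans (le_abs_self κ)
  replace hC' : ‖C'‖ ≤ k := hC'.trans (le_abs_self κ)
  set W := ‖α‖ + ‖β‖ + ‖γ‖ with hW
  have hW0 : 0 ≤ W := by positivity
  have hG : ∀ z : ℂ, ‖z‖ ≤ R → ‖1 + z ^ m • F‖ ≤ g ∧ ‖1 - z ^ m • F‖ ≤ g := by
    intro z hz
    have h1 : ‖z ^ m • F‖ ≤ R ^ m * ‖F‖ := by
      rw [norm_smul, norm_pow]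
      exact mul_le_mul_of_nonneg_right (pow_le_pow_left₀ (norm_nonneg _) hz m) (norm_nonneg _)
    constructor
    · refine (norm_add_le _ _).trans ?_
      rw [norm_one]; linarith
    · refine (norm_sub_le _ _).trans ?_
      rw [norm_one]; linarith
  -- the auxiliary solution
  obtain ⟨Ψ, hΨ⟩ : ∃ Ψ : ℂ → 𝔸, ∀ z ∈ ball (0 : ℂ) R, HasDerivAt Ψ
      (-((1 + z ^ m • F) * (Ξ z - ((m : ℂ) * z ^ (m - 1)) • F) * (1 - z ^ m • F) * Ψ z)) z ∧
      ‖Ψ z - 1‖ ≤ g * g * ε * R * (1 - ‖z‖ * R⁻¹)⁻¹ := by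
    refine exists_linearODE_solution (r := r)
      (Θ := fun z => (1 + z ^ m • F) * (Ξ z - ((m : ℂ) * z ^ (m - 1)) • F) * (1 - z ^ m • F))
      hR hRr (by linarith [show g * g * ε * R = ε * (g * g * R + 1) - ε by ring]) ?_ ?_
    · have hpow : ∀ n : ℕ, DifferentiableOn ℂ (fun z : ℂ => z ^ n • F) (ball 0 r) := fun n =>
        (differentiableOn_pow n).smul_const F
      have hd : DifferentiableOn ℂ (fun z : ℂ => ((m : ℂ) * z ^ (m - 1)) • F) (ball 0 r) :=
        ((differentiableOn_pow (m - 1)).const_mul (m : ℂ)).smul_const F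
      exact (((differentiableOn_const 1).add (hpow m)).mul (hΞ.sub hd)).mul
        ((differentiableOn_const 1).sub (hpow m))
    · intro z hz
      obtain ⟨g1, g2⟩ := hG z (mem_sphere_zero_iff_norm.mp hz).le
      exact (norm_mul_mul_le g1 g2).trans
        (mul_le_mul_of_nonneg_left (hΞε z hz) (mul_nonneg hg0 hg0))
  set s := segment ℝ w₀ (w₀ + 2 * Real.pi * I) with hs
  have hws : w₀ ∈ s := left_mem_segment ℝ _ _
  have hes : w₀ + 2 * Real.pi * I ∈ s := right_mem_segment ℝ _ _
  have hnorm : ∀ w ∈ s, ‖Complex.exp w‖ = r₀ := by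
    intro w hw
    rw [hs, segment_eq_image'] at hw
    obtain ⟨τ, -, rfl⟩ := hw
    rw [hr₀, Complex.norm_exp, Complex.norm_exp]
    simp
  have hΨs : ∀ w ∈ s, ‖Ψ (Complex.exp w) - 1‖ ≤ ε * K₁ := by
    intro w hw
    have h1 := (hΨ (Complex.exp w) (by rw [mem_ball_zero_iff, hnorm w hw]; exact hwR)).2
    rw [hnorm w hw] at h1
    exact h1.trans_eq (by rw [hK₁]; ring)
  have hΨn : ∀ w ∈ s, ‖Ψ (Complex.exp w)‖ ≤ 1 + K₁ := by
    intro w hw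
    have h1 := norm_sub_norm_le (Ψ (Complex.exp w)) 1
    rw [norm_one] at h1
    linarith [hΨs w hw, mul_le_of_le_one_left hK₁0 hε1]
  -- `V = U G⁻¹ Ψ`
  set V : ℂ → 𝔸 := fun w => U w * (1 - Complex.exp w ^ m • F) * Ψ (Complex.exp w) with hV
  set P : ℂ → 𝔸 := fun w => (Complex.exp w * (α / Complex.exp w ^ (2 * m + 1) +
    β / Complex.exp w ^ (m + 1) + γ / Complex.exp w)) •
    ((1 + Complex.exp w ^ m • F) * E * (1 - Complex.exp w ^ m • F)) with hP
  have hVd : ∀ w ∈ s, HasDerivAt V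
      (U w * (1 - Complex.exp w ^ m • F) * P w * Ψ (Complex.exp w)) w := by
    intro w hw
    have h1 : HasDerivAt (fun w => 1 - Complex.exp w ^ m • F)
        (-((Complex.exp w * ((m : ℂ) * Complex.exp w ^ (m - 1))) • F)) w := by
      have := ((((Complex.hasDerivAt_exp w).fun_pow m).smul_const F).const_sub 1)
      refine this.congr_deriv ?_
      rw [mul_comm (Complex.exp w)]
    have h2 : HasDerivAt (fun w => Ψ (Complex.exp w)) _ w :=
      ((hΨ (Complex.exp w) (by rw [mem_ball_zero_iff, hnorm w hw]; exact hwR)).1).scomp w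
        (Complex.hasDerivAt_exp w)
    have h3 := ((hU w hw).mul h1).mul h2
    refine h3.congr_deriv ?_
    exact gauge_derivative hF E (U w) (Ψ (Complex.exp w)) (Ξ (Complex.exp w)) _ _ _ _
  have hPn : ∀ w ∈ s, ‖P w‖ ≤ p * W := by
    intro w hw
    have hx : Complex.exp w ≠ 0 := Complex.exp_ne_zero w
    have hwn := hnorm w hw
    obtain ⟨g1, g2⟩ := hG (Complex.exp w) (by rw [hwn]; exact hwR.le)
    have h1 : ‖Complex.exp w * (α / Complex.exp w ^ (2 * m + 1) +
        β / Complex.exp w ^ (m + 1) + γ / Complex.exp w)‖ ≤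
        (r₀⁻¹ ^ (2 * m) + r₀⁻¹ ^ m + 1) * W := by
      have h2 : Complex.exp w * (α / Complex.exp w ^ (2 * m + 1) +
          β / Complex.exp w ^ (m + 1) + γ / Complex.exp w) =
          α * (Complex.exp w)⁻¹ ^ (2 * m) + β * (Complex.exp w)⁻¹ ^ m + γ := by
        rw [inv_pow, inv_pow, pow_succ, pow_succ]
        field_simp
      rw [h2]
      refine norm_add₃_le.trans ?_
      rw [norm_mul, norm_mul, norm_pow, norm_pow, norm_inv, hwn]
      have h3 : (r₀⁻¹ ^ (2 * m) + r₀⁻¹ ^ m + 1) * W =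
          ‖α‖ * r₀⁻¹ ^ (2 * m) + ‖β‖ * r₀⁻¹ ^ m + ‖γ‖ + (r₀⁻¹ ^ (2 * m) * (‖β‖ + ‖γ‖) +
            r₀⁻¹ ^ m * (‖α‖ + ‖γ‖) + (‖α‖ + ‖β‖)) := by rw [hW]; ring
      rw [h3]
      exact le_add_of_nonneg_right (by positivity)
    rw [hP]; beta_reduce
    rw [norm_smul]
    calc _ ≤ (r₀⁻¹ ^ (2 * m) + r₀⁻¹ ^ m + 1) * W * (g * g * ‖E‖) :=
          mul_le_mul h1 (norm_mul_mul_le g1 g2) (norm_nonneg _) (by positivity)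
      _ = p * W := by rw [hp]; ring
  -- a primitive of `P`
  obtain ⟨Q, hQd, hQ⟩ : ∃ Q : ℂ → 𝔸, (∀ w, HasDerivAt Q (P w) w) ∧
      Q (w₀ + 2 * Real.pi * I) - Q w₀ =
        (2 * Real.pi * I) • (γ • E + β • (F * E - E * F) - α • (F * E * F)) := by
    obtain ⟨Q, h1, h2⟩ := exists_primitive_principal hm α β γ E (F * E - E * F) (F * E * F)
    refine ⟨Q, fun w => (h1 w).congr_deriv ?_, h2 w₀⟩
    rw [hP]; beta_reduce
    rw [conj_one_add_smul]
  set J := (2 * Real.pi * I) • (γ • E + β • (F * E - E * F) - α • (F * E * F)) with hJ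
  have hJn : ‖J‖ ≤ 2 * Real.pi * j * W := by
    have h1 : ‖(2 * Real.pi * I : ℂ)‖ = 2 * Real.pi := by simp [abs_of_pos Real.pi_pos]
    rw [hJ, norm_smul, h1, mul_assoc _ j]
    refine mul_le_mul_of_nonneg_left ?_ Real.two_pi_pos.le
    refine (norm_sub_le _ _).trans ((add_le_add_left (norm_add_le _ _) _).trans ?_)
    rw [norm_smul, norm_smul, norm_smul, hj, hW]
    have h2 : (‖E‖ + ‖F * E - E * F‖ + ‖F * E * F‖) * (‖α‖ + ‖β‖ + ‖γ‖) =
        ‖γ‖ * ‖E‖ + ‖β‖ * ‖F * E - E * F‖ + ‖α‖ * ‖F * E * F‖ +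
          (‖E‖ * ‖α‖ + ‖E‖ * ‖β‖ + ‖F * E - E * F‖ * ‖α‖ + ‖F * E - E * F‖ * ‖γ‖ +
            ‖F * E * F‖ * ‖β‖ + ‖F * E * F‖ * ‖γ‖) := by ring
    rw [h2]
    exact le_add_of_nonneg_right (by positivity)
  -- The derivative of `V - C * Q` is at most `ε * K₂ * ‖P‖`, and the segment has length `2π`.
  have hVC : ‖V (w₀ + 2 * Real.pi * I) - V w₀ - C * J‖ ≤ ε * K₂ * (p * W) * (2 * Real.pi) := by
    have h1 := (convex_segment w₀ (w₀ + 2 * Real.pi * I)).norm_image_sub_le_of_norm_hasDerivWithin_le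
      (f := fun w => V w - C * Q w) (C := ε * K₂ * (p * W))
      (fun w hw => ((hVd w hw).sub ((hQd w).const_mul C)).hasDerivWithinAt) ?_ hws hes
    · have h2 : V (w₀ + 2 * Real.pi * I) - C * Q (w₀ + 2 * Real.pi * I) - (V w₀ - C * Q w₀) =
          V (w₀ + 2 * Real.pi * I) - V w₀ - C * J := by
        rw [← hQ, mul_sub]; abel
      rw [h2, add_sub_cancel_left] at h1
      refine h1.trans_eq ?_
      simp [abs_of_pos Real.pi_pos]
    · intro w hw
      have h2 : U w * (1 - Complex.exp w ^ m • F) * P w * Ψ (Complex.exp w) - C * P w =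
          (U w * (1 - Complex.exp w ^ m • F) - C) * P w * Ψ (Complex.exp w) +
            C * P w * (Ψ (Complex.exp w) - 1) := mul_mul_sub_eq_sub_mul_add _ _ _ _
      rw [h2]
      refine (norm_add_le _ _).trans ?_
      have h3 := norm_mul_mul_le (y := P w) (hUε w hw) (hΨn w hw)
      have h4 := norm_mul_mul_le (y := P w) hC (hΨs w hw)
      have h5 := mul_le_mul_of_nonneg_left (hPn w hw)
        (by positivity : (0 : ℝ) ≤ ε * K₂)
      calc _ ≤ ε * (1 + K₁) * ‖P w‖ + k * (ε * K₁) * ‖P w‖ := add_le_add h3 h4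
        _ = ε * K₂ * ‖P w‖ := by rw [hK₂]; ring
        _ ≤ _ := h5
  have hV0 : ‖C - V w₀‖ ≤ ε * K₂ := by
    have h1 : V w₀ - C = (U w₀ * (1 - Complex.exp w₀ ^ m • F) - C) * Ψ (Complex.exp w₀) +
        C * (Ψ (Complex.exp w₀) - 1) := sub_eq_sub_mul_add _ _ _
    rw [norm_sub_rev, h1]
    refine (norm_add_le _ _).trans ?_
    calc _ ≤ ε * (1 + K₁) + k * (ε * K₁) := by
          refine add_le_add ((norm_mul_le _ _).trans ?_) ((norm_mul_le _ _).trans ?_)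
          · exact mul_le_mul (hUε _ hws) (hΨn _ hws) (norm_nonneg _) hε0.le
          · exact mul_le_mul hC (hΨs _ hws) (norm_nonneg _) (abs_nonneg _)
      _ = ε * K₂ := by rw [hK₂]; ring
  -- The gauge and `Ψ` depend on `w` only through `exp w`, so they agree at both ends of the
  -- segment.
  have hVD : V (w₀ + 2 * Real.pi * I) - V w₀ = D * V w₀ := by
    have h1 : Complex.exp (w₀ + 2 * Real.pi * I) = Complex.exp w₀ := Complex.exp_periodic w₀
    rw [hV]; beta_reduce
    rw [h1, ← hD, add_mul, one_mul, add_mul, add_mul, add_sub_cancel_left, mul_assoc D, mul_assoc D]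
  rw [hVD] at hVC
  have hmain : D - C * J * C' = ((D * V w₀ - C * J) + D * (C - V w₀)) * C' := by
    have h1 : D * V w₀ - C * J + D * (C - V w₀) = D * C - C * J := by rw [mul_sub]; abel
    rw [h1, sub_mul, mul_assoc D, hCC, mul_one]
  have hb1 : ‖D - C * J * C'‖ ≤ (ε * K₂ * (p * W) * (2 * Real.pi) + ‖D‖ * (ε * K₂)) * k := by
    rw [hmain]
    refine (norm_mul_le _ _).trans (mul_le_mul ((norm_add_le _ _).trans (add_le_add hVC
      ((norm_mul_le _ _).trans (mul_le_mul_of_nonneg_left hV0 (norm_nonneg _))))) hC'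
      (norm_nonneg _) (by positivity))
  have hb2 : ‖C * J * C'‖ ≤ k * k * (2 * Real.pi * j * W) :=
    (norm_mul_mul_le hC hC').trans (mul_le_mul_of_nonneg_left hJn (by positivity))
  have hp0 : 0 ≤ p := by positivity
  -- The bound `hb1` contains `‖D‖` with a factor at most `1 / 2`, which is absorbed on the left.
  have hDn : ‖D‖ ≤ (4 * Real.pi * k * k * j + 2 * Real.pi * p) * W := by
    have h1 : ‖D‖ ≤ ‖D - C * J * C'‖ + ‖C * J * C'‖ := by
      simpa using norm_add_le (D - C * J * C') (C * J * C')
    have h2 : ε * (k * K₂) ≤ 1 / 2 := by linarith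
    have h3 := mul_le_mul_of_nonneg_right h2 (norm_nonneg D)
    have h4 := mul_le_mul_of_nonneg_right h2 (by positivity : 0 ≤ p * W * (2 * Real.pi))
    have h5 : (ε * K₂ * (p * W) * (2 * Real.pi) + ‖D‖ * (ε * K₂)) * k =
      ε * (k * K₂) * (p * W * (2 * Real.pi)) + ε * (k * K₂) * ‖D‖ := by ring
    have h6 : (4 * Real.pi * k * k * j + 2 * Real.pi * p) * W =
      2 * (k * k * (2 * Real.pi * j * W)) + p * W * (2 * Real.pi) := by ring
    linarith
  have hJs : (2 * Real.pi * I) • (C * (γ • E + β • (F * E - E * F) - α • (F * E * F)) * C') =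
      C * J * C' := by
    rw [hJ, mul_smul_comm, smul_mul_assoc]
  rw [hJs]
  calc _ ≤ (ε * K₂ * (p * W) * (2 * Real.pi) + ‖D‖ * (ε * K₂)) * k := hb1
    _ ≤ (ε * K₂ * (p * W) * (2 * Real.pi) +
        (4 * Real.pi * k * k * j + 2 * Real.pi * p) * W * (ε * K₂)) * k := by gcongr
    _ = ε * K₃ * W := by rw [hK₃]; ring
    _ ≤ η * W := mul_le_mul_of_nonneg_right
        (by linarith [show ε * (K₃ + 1) = ε * K₃ + ε by ring]) hW0

end ODE

/-! ### From equations on the unit circle to equations on the annulus. -/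

theorem hasDerivAt_matrix {f : ℂ → Matrix (Fin 2) (Fin 2) ℂ} {f' : Matrix (Fin 2) (Fin 2) ℂ} {x : ℂ}
    (h : ∀ i j, HasDerivAt (fun u => f u i j) (f' i j) x) : HasDerivAt f f' x := by
  have h1 : ∀ A : Matrix (Fin 2) (Fin 2) ℂ,
      A = ∑ i, ∑ j, A i j • (Matrix.single i j 1 : Matrix (Fin 2) (Fin 2) ℂ) := fun A => by
    simpa using Matrix.matrix_eq_sum_single A
  rw [h1 f', show f = fun u => ∑ i, ∑ j, f u i j • Matrix.single i j 1 from funext fun u => h1 _]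
  exact HasDerivAt.fun_sum fun i _ => HasDerivAt.fun_sum fun j _ => (h i j).smul_const _

theorem differentiableOn_matrix {f : ℂ → Matrix (Fin 2) (Fin 2) ℂ} {U : Set ℂ} (hU : IsOpen U)
    (h : ∀ i j, DifferentiableOn ℂ (fun u => f u i j) U) : DifferentiableOn ℂ f U := fun x hx =>
  (hasDerivAt_matrix (f' := Matrix.of fun i j => deriv (fun u => f u i j) x) fun i j =>
    ((h i j).differentiableAt (hU.mem_nhds hx)).hasDerivAt).differentiableAt.differentiableWithinAt

/-- Uniform convergence on compact sets of a jointly continuous family. -/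
theorem exists_forall_norm_sub_le {E : Type*} [NormedAddCommGroup E] {f : ℝ × ℂ → E} {I : Set ℝ}
    {U K : Set ℂ} (hI : IsOpen I) (hU : IsOpen U) (hf : ContinuousOn f (I ×ˢ U)) (h0 : (0 : ℝ) ∈ I)
    (hK : IsCompact K) (hKU : K ⊆ U) {e : ℝ} (he : 0 < e) :
    ∃ δ > 0, ∀ t : ℝ, |t| < δ → ∀ w ∈ K, ‖f (t, w) - f (0, w)‖ ≤ e := by
  have hg : ContinuousOn (fun p : ℝ × ℂ => ‖f p - f (0, p.2)‖) (I ×ˢ U) :=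
    (hf.sub (hf.comp (t := I ×ˢ U) (g := f) (f := fun p : ℝ × ℂ => (0, p.2)) (by fun_prop)
      fun p hp => ⟨h0, hp.2⟩)).norm
  have ho := hg.isOpen_inter_preimage (hI.prod hU) (isOpen_Iio (a := e))
  obtain ⟨u, v, hu, -, h0u, hKv, huv⟩ := generalized_tube_lemma (isCompact_singleton (x := (0 : ℝ)))
    hK ho (by
      rintro ⟨t, w⟩ ⟨ht, hw⟩
      obtain rfl : t = 0 := ht
      exact ⟨⟨h0, hKU hw⟩, by simpa using he⟩)
  obtain ⟨δ, hδ, hb⟩ := Metric.isOpen_iff.mp hu 0 (h0u rfl)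
  refine ⟨δ, hδ, fun t ht w hw => ?_⟩
  have := (huv (⟨hb (by simpa using ht), hKv hw⟩ : (t, w) ∈ u ×ˢ v)).2
  exact le_of_lt this

theorem isOpen_puncturedDisc (r : ℝ) : IsOpen (puncturedDisc r) :=
  isOpen_ball.sdiff isClosed_singleton

theorem isOpen_coverOfPuncturedDisc (r : ℝ) : IsOpen (coverOfPuncturedDisc r) :=
  (isOpen_puncturedDisc r).preimage Complex.continuous_exp

theorem mem_puncturedDisc {r : ℝ} {z : ℂ} : z ∈ puncturedDisc r ↔ ‖z‖ < r ∧ z ≠ 0 := by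
  simp [puncturedDisc]

theorem mem_coverOfPuncturedDisc {r : ℝ} {w : ℂ} :
    w ∈ coverOfPuncturedDisc r ↔ ‖Complex.exp w‖ < r := by
  rw [coverOfPuncturedDisc, mem_ofPred_eq, mem_puncturedDisc]
  exact and_iff_left (Complex.exp_ne_zero w)

section Loops

variable {ρ : ℝ}

theorem LoopMatrix.eval_apply (A : LoopMatrix ρ) (z : ℂ) (i j : Fin 2) :
    A.eval z i j = (A i j).eval z := rfl

theorem LoopMatrix.differentiableOn_eval (hρ : 1 < ρ) (A : LoopMatrix ρ) (i j : Fin 2) :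
    DifferentiableOn ℂ (fun z => A.eval z i j) (openAnnulus ρ) :=
  Wiener.differentiableOn_eval hρ (A i j)

theorem LoopMatrix.norm_eval_le (hρ : 1 < ρ) (A : LoopMatrix ρ) {e : ℝ}
    (h : ∀ i j, ‖A i j‖ ≤ e) {z : ℂ} (hz : z ∈ openAnnulus ρ) : ‖A.eval z‖ ≤ 2 * e :=
  Matrix.linftyOp_norm_le_of_entries fun i j =>
    (Wiener.norm_eval_le hρ (A i j) hz.1.le hz.2.le).trans (h i j)

theorem LoopMatrix.eval_sub_apply [Fact (1 < ρ)] (A B : LoopMatrix ρ) {z : ℂ}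
    (hz : z ∈ openAnnulus ρ) (i j : Fin 2) :
    A.eval z i j - B.eval z i j = (A i j - B i j).eval z :=
  (map_sub (Wiener.evalCLM z hz.1.le hz.2.le) (A i j) (B i j)).symm

theorem LoopMatrix.norm_eval_sub_le [h : Fact (1 < ρ)] (A B : LoopMatrix ρ) {e : ℝ}
    (hAB : ∀ i j, ‖A i j - B i j‖ ≤ e) {z : ℂ} (hz : z ∈ openAnnulus ρ) (i j : Fin 2) :
    ‖(A.eval z - B.eval z) i j‖ ≤ e := by
  rw [Matrix.sub_apply, LoopMatrix.eval_sub_apply A B hz]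
  exact (Wiener.norm_eval_le h.out _ hz.1.le hz.2.le).trans (hAB i j)

theorem LoopSL.det_eval (hρ : 1 < ρ) {A : LoopMatrix ρ} (hA : A ∈ LoopSL ρ) {z : ℂ}
    (hz : z ∈ openAnnulus ρ) : (A.eval z).det = 1 := by
  have hd := LoopMatrix.differentiableOn_eval hρ A
  have h1 : DifferentiableOn ℂ (fun z => (A.eval z).det) (openAnnulus ρ) := by
    simp only [Matrix.det_fin_two]
    exact ((hd 0 0).mul (hd 1 1)).sub ((hd 0 1).mul (hd 1 0))
  exact eqOn_openAnnulus_of_eqOn_sphere hρ h1 (differentiableOn_const 1) (fun z hz => hA z hz) hz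

theorem LoopMatrix.eval_eq_of_sphere (hρ : 1 < ρ) {A : LoopMatrix ρ}
    {B : ℂ → Matrix (Fin 2) (Fin 2) ℂ}
    (hB : ∀ i j, DifferentiableOn ℂ (fun z => B z i j) (openAnnulus ρ))
    (h : ∀ z ∈ sphere (0 : ℂ) 1, A.eval z = B z) {z : ℂ} (hz : z ∈ openAnnulus ρ) :
    A.eval z = B z := by
  ext i j
  exact eqOn_openAnnulus_of_eqOn_sphere hρ (LoopMatrix.differentiableOn_eval hρ A i j) (hB i j)
    (fun z hz => congrFun (congrFun (h z hz) i) j) hz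

/-- The differential equation `dΦ = Φ η` on the unit circle extends to the annulus. -/
theorem SolvesPotential.hasDerivAt [hρ : Fact (1 < ρ)] {A Φ : ℂ → LoopMatrix ρ} {r : ℝ}
    (h : SolvesPotential A Φ r)
    (hΦ : ∀ i j, ContDiffOn ℝ 1 (fun w => Φ w i j) (coverOfPuncturedDisc r))
    {w : ℂ} (hw : w ∈ coverOfPuncturedDisc r) {z : ℂ} (hz : z ∈ openAnnulus ρ) :
    HasDerivAt (fun u => (Φ u).eval z)
      ((Φ w).eval z * (Complex.exp w • (A (Complex.exp w)).eval z)) w := by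
  refine hasDerivAt_matrix fun i j => ?_
  have hdiff : DifferentiableAt ℝ (fun w => Φ w i j) w :=
    ((hΦ i j).differentiableOn one_ne_zero).differentiableAt
      ((isOpen_coverOfPuncturedDisc r).mem_nhds hw)
  set L := fderiv ℝ (fun w => Φ w i j) w with hL
  have hfd : ∀ z (h1 : z ∈ openAnnulus ρ), HasFDerivAt (fun u => (Φ u).eval z i j)
      (((Wiener.evalCLM z h1.1.le h1.2.le).restrictScalars ℝ).comp L) w := fun z h1 =>
    ((Wiener.evalCLM z h1.1.le h1.2.le).restrictScalars ℝ).hasFDerivAt.comp w hdiff.hasFDerivAt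
  have hrhs : DifferentiableOn ℂ (fun z => ((Φ w).eval z *
      (Complex.exp w • (A (Complex.exp w)).eval z)) i j) (openAnnulus ρ) := by
    simp only [Matrix.mul_apply, Fin.sum_univ_two, Matrix.smul_apply, smul_eq_mul]
    have h1 := LoopMatrix.differentiableOn_eval hρ.out (Φ w)
    have h2 := LoopMatrix.differentiableOn_eval hρ.out (A (Complex.exp w))
    exact ((h1 i 0).mul ((h2 0 j).const_mul _)).add ((h1 i 1).mul ((h2 1 j).const_mul _))
  -- The real derivative in direction `v` is itself a loop, hence holomorphic in the loop parameter,
  -- so its formula on the circle extends. The formula is complex linear in `v`, which gives a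
  -- complex derivative.
  have hS : ∀ (v : ℂ), EqOn (fun z => (L v).eval z) (fun z => v * ((Φ w).eval z *
      (Complex.exp w • (A (Complex.exp w)).eval z)) i j) (openAnnulus ρ) := by
    intro v
    refine eqOn_openAnnulus_of_eqOn_sphere hρ.out (Wiener.differentiableOn_eval hρ.out _)
      (hrhs.const_mul v) fun z hz => ?_
    have h1 := hfd z (sphere_subset_openAnnulus hρ.out hz)
    have h2 := (h w hw z hz i j).hasFDerivAt.restrictScalars ℝ
    have h3 := congrArg (fun l : ℂ →L[ℝ] ℂ => l v) (h1.unique h2)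
    simpa [Wiener.evalCLM_apply] using h3
  have h4 : HasFDerivAt (fun u => (Φ u).eval z i j) (ContinuousLinearMap.toSpanSingleton ℂ
      (((Φ w).eval z * (Complex.exp w • (A (Complex.exp w)).eval z)) i j)) w := by
    refine hasFDerivAt_of_restrictScalars ℝ (hfd z hz) ?_
    ext v
    simpa [Wiener.evalCLM_apply] using (hS v hz).symm
  simpa using h4.hasDerivAt

end Loops

section Loops

variable {ρ : ℝ}

theorem eval_principal_eq (hρ : 1 < ρ) {A Ξ : LoopMatrix ρ} {a b c : Wiener ρ} {x y v : ℂ}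
    (h : ∀ z ∈ sphere (0 : ℂ) 1, A.eval z =
      (a.eval z / x + b.eval z / y + c.eval z / v) • !![0, z⁻¹; 0, 0] + Ξ.eval z)
    {z : ℂ} (hz : z ∈ openAnnulus ρ) : A.eval z =
      (a.eval z / x + b.eval z / y + c.eval z / v) • !![0, z⁻¹; 0, 0] + Ξ.eval z := by
  refine LoopMatrix.eval_eq_of_sphere hρ (B := fun z =>
    (a.eval z / x + b.eval z / y + c.eval z / v) • !![0, z⁻¹; 0, 0] + Ξ.eval z) ?_ h hz
  have hΞ := LoopMatrix.differentiableOn_eval hρ Ξ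
  have hf : DifferentiableOn ℂ (fun z => a.eval z / x + b.eval z / y + c.eval z / v)
      (openAnnulus ρ) :=
    (((Wiener.differentiableOn_eval hρ a).div_const _).add
      ((Wiener.differentiableOn_eval hρ b).div_const _)).add
      ((Wiener.differentiableOn_eval hρ c).div_const _)
  have hi : DifferentiableOn ℂ (fun z : ℂ => z⁻¹) (openAnnulus ρ) := fun z hz =>
    (differentiableAt_inv (ne_zero_of_mem_openAnnulus hρ hz)).differentiableWithinAt
  intro i j
  simp only [Matrix.add_apply, Matrix.smul_apply, smul_eq_mul]
  refine DifferentiableOn.add (hf.mul ?_) (hΞ i j)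
  fin_cases i <;> fin_cases j
  · exact differentiableOn_const 0
  · exact hi
  · exact differentiableOn_const 0
  · exact differentiableOn_const 0

/-- In the upper right entry the coefficient of $\lambda^{k-1}$ vanishes for a DPW potential. The
principal part in `z` formed from the `k`-th coefficients is thus minus a function holomorphic at `z
= 0`, and is zero by the Cauchy estimate with bound `0`. -/
theorem principal_coeff_eq_zero [hρ : Fact (1 < ρ)] {m : ℕ} (hm : 1 ≤ m) {r : ℝ} (hr : 0 < r)
    {A Ξ : ℂ → LoopMatrix ρ} {a b c : Wiener ρ} (hA : IsDPWPotential A (puncturedDisc r))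
    (hΞ : LoopHolomorphicOn Ξ (ball 0 r))
    (h : ∀ z ∈ puncturedDisc r, ∀ lam ∈ sphere (0 : ℂ) 1, (A z).eval lam =
      (a.eval lam / z ^ (2 * m + 1) + b.eval lam / z ^ (m + 1) + c.eval lam / z) •
        !![0, lam⁻¹; 0, 0] + (Ξ z).eval lam) {k : ℤ} (hk : k < 0) :
    a.coeff k = 0 ∧ b.coeff k = 0 ∧ c.coeff k = 0 := by
  have hcoeff : ∀ z ∈ puncturedDisc r, a.coeff k / z ^ (2 * m + 1) + b.coeff k / z ^ (m + 1) +
      c.coeff k / z + (Ξ z 0 1).coeff (k - 1) = 0 := by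
    intro z hz
    have h1 := Wiener.coeff_eq_of_zpow_mul_eval_eq hρ.out (n := 1)
      (f := (z ^ (2 * m + 1))⁻¹ • a + (z ^ (m + 1))⁻¹ • b + z⁻¹ • c) (g := A z 0 1 - Ξ z 0 1)
      (fun lam hlam => ?_) (k - 1)
    · rw [sub_add_cancel] at h1
      have h2 : (A z 0 1).coeff (k - 1) = 0 :=
        congrFun (congrFun (hA.coeff_eq_zero z hz (k - 1) (by omega)) 0) 1
      have h3 : (A z 0 1 - Ξ z 0 1).coeff (k - 1) =
          (A z 0 1).coeff (k - 1) - (Ξ z 0 1).coeff (k - 1) :=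
        map_sub (Wiener.coeffCLM (k - 1)) _ _
      rw [h3, h2, Wiener.coeff_add, Wiener.coeff_add, Wiener.coeff_smul, Wiener.coeff_smul,
        Wiener.coeff_smul] at h1
      rw [div_eq_inv_mul, div_eq_inv_mul, div_eq_inv_mul, h1]
      ring
    · have hl := sphere_subset_openAnnulus hρ.out hlam
      have hl0 : lam ≠ 0 := ne_zero_of_mem_openAnnulus hρ.out hl
      have h2 := congrFun (congrFun (h z hz lam hlam) 0) 1
      rw [zpow_one]
      simp only [← Wiener.evalCLM_apply lam hl.1.le hl.2.le, map_add, map_sub, map_smul,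
        smul_eq_mul]
      simp only [Matrix.add_apply, Matrix.smul_apply, smul_eq_mul, LoopMatrix.eval_apply] at h2
      simp only [Wiener.evalCLM_apply]
      rw [h2]
      simp only [Matrix.of_apply, Matrix.cons_val', Matrix.cons_val_one, Matrix.cons_val_zero,
        Matrix.cons_val_fin_one]
      rw [add_sub_cancel_right]
      simp only [div_eq_mul_inv]
      field_simp
  have hd : DifferentiableOn ℂ (fun z => (Ξ z 0 1).coeff (k - 1)) (ball 0 r) := fun z hz =>
    ((Wiener.coeffCLM (k - 1)).differentiableAt.comp_differentiableWithinAt z (hΞ 0 1 z hz))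
  obtain ⟨h1, h2, h3⟩ := norm_principal_coeff_le hm (half_pos hr) (half_lt_self hr) hd (e := 0)
    (α := a.coeff k) (β := b.coeff k) (γ := c.coeff k) fun z hz => by
      rw [mem_sphere_zero_iff_norm] at hz
      rw [hcoeff z (mem_puncturedDisc.mpr ⟨by linarith, norm_pos_iff.mp (by linarith)⟩), norm_zero]
  simp only [zero_mul, norm_le_zero_iff] at h1 h2 h3
  exact ⟨h1, h2, h3⟩

end Loops

/-! ### Monodromy as a holomorphic matrix on the annulus, unitary on the circle. -/

section Monodromy

variable {ρ : ℝ} {Φ : ℂ → LoopMatrix ρ} {r : ℝ} {w₀ : ℂ}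

theorem segment_subset_cover (hw₀ : w₀ ∈ coverOfPuncturedDisc r) :
    segment ℝ w₀ (w₀ + 2 * Real.pi * I) ⊆ coverOfPuncturedDisc r := by
  intro w hw
  rw [segment_eq_image'] at hw
  obtain ⟨τ, -, rfl⟩ := hw
  rw [mem_coverOfPuncturedDisc, Complex.norm_exp] at hw₀ ⊢
  simpa using hw₀

theorem monodromy_mul_eval (hρ : 1 < ρ) (hw₀ : w₀ ∈ coverOfPuncturedDisc r)
    (hΦ : ∀ w ∈ coverOfPuncturedDisc r, Φ w ∈ LoopSL ρ) {z : ℂ} (hz : z ∈ openAnnulus ρ) :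
    monodromy Φ w₀ z * (Φ w₀).eval z = (Φ (w₀ + 2 * Real.pi * I)).eval z := by
  have h1 : IsUnit ((Φ w₀).eval z).det := by
    rw [LoopSL.det_eval hρ (hΦ w₀ hw₀) hz]; exact isUnit_one
  rw [monodromy, Matrix.nonsing_inv_mul_cancel_right _ _ h1]

theorem differentiableOn_monodromy (hρ : 1 < ρ) (hw₀ : w₀ ∈ coverOfPuncturedDisc r)
    (hΦ : ∀ w ∈ coverOfPuncturedDisc r, Φ w ∈ LoopSL ρ) (i j : Fin 2) :
    DifferentiableOn ℂ (fun z => monodromy Φ w₀ z i j) (openAnnulus ρ) := by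
  have h1 := LoopMatrix.differentiableOn_eval hρ (Φ w₀)
  have h2 := LoopMatrix.differentiableOn_eval hρ (Φ (w₀ + 2 * Real.pi * I))
  have h3 : ∀ i j, DifferentiableOn ℂ (fun z => ((Φ w₀).eval z).adjugate i j) (openAnnulus ρ) := by
    intro i j
    simp only [Matrix.adjugate_fin_two]
    fin_cases i <;> fin_cases j
    · exact h1 1 1
    · exact (h1 0 1).neg
    · exact (h1 1 0).neg
    · exact h1 0 0
  refine DifferentiableOn.congr (f := fun z => (Φ (w₀ + 2 * Real.pi * I)).eval z i 0 *
    ((Φ w₀).eval z).adjugate 0 j + (Φ (w₀ + 2 * Real.pi * I)).eval z i 1 *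
    ((Φ w₀).eval z).adjugate 1 j) (((h2 i 0).mul (h3 0 j)).add ((h2 i 1).mul (h3 1 j))) ?_
  intro z hz
  rw [monodromy, Matrix.inv_def, LoopSL.det_eval hρ (hΦ w₀ hw₀) hz, Ring.inverse_one, one_smul,
    Matrix.mul_apply, Fin.sum_univ_two]

/-- The adjoint of such a matrix is its inverse, which is its adjugate. So its trace-free part is
exactly skew-Hermitian. -/
theorem Matrix.conj_eq_of_mem_specialUnitaryGroup {M : Matrix (Fin 2) (Fin 2) ℂ}
    (hM : M ∈ Matrix.specialUnitaryGroup (Fin 2) ℂ) :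
    starRingEnd ℂ (M 0 0) = M 1 1 ∧ starRingEnd ℂ (M 1 1) = M 0 0 ∧
      starRingEnd ℂ (M 0 1) = -M 1 0 := by
  rw [Matrix.mem_specialUnitaryGroup_iff, Matrix.mem_unitaryGroup_iff'] at hM
  have h1 : star M = M.adjugate := by
    have h2 : M * M.adjugate = 1 := by rw [Matrix.mul_adjugate, hM.2, one_smul]
    calc star M = star M * (M * M.adjugate) := by rw [h2, mul_one]
      _ = M.adjugate := by rw [← mul_assoc, hM.1, one_mul]
  rw [Matrix.adjugate_fin_two, Matrix.star_eq_conjTranspose] at h1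
  have e := fun i j => congrFun (congrFun h1 i) j
  refine ⟨by simpa using e 0 0, by simpa using e 1 1, by simpa using e 1 0⟩

/-- `M - 1` need not be skew-Hermitian, so rigidity is applied to its trace-free part. The
comparison matrix has trace zero, so the projection costs only a factor `2`. -/
theorem Matrix.norm_traceFree_sub_le {A B : Matrix (Fin 2) (Fin 2) ℂ} (hB : B.trace = 0) :
    ‖!![(A 0 0 - A 1 1) / 2, A 0 1; A 1 0, -((A 0 0 - A 1 1) / 2)] - B‖ ≤ 2 * ‖A - B‖ := by
  have hE := Matrix.norm_entry_le_linftyOp (A - B)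
  refine Matrix.linftyOp_norm_le_of_entries fun i j => ?_
  rw [Matrix.trace_fin_two] at hB
  have h1 : ‖((A - B) 0 0 - (A - B) 1 1) / 2‖ ≤ ‖A - B‖ := by
    rw [norm_div, Complex.norm_ofNat, div_le_iff₀ two_pos]
    linarith [norm_sub_le ((A - B) 0 0) ((A - B) 1 1), hE 0 0, hE 1 1]
  fin_cases i <;> fin_cases j
  · refine le_of_eq_of_le (congrArg norm ?_) h1
    simp
    linear_combination (-1 / 2) * hB
  · simpa using hE 0 1
  · simpa using hE 1 0
  · rw [← norm_neg] at h1
    refine le_of_eq_of_le (congrArg norm ?_) h1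
    simp
    linear_combination (-1 / 2) * hB

end Monodromy

/-! ### The frame of the unperturbed problem and the uniform monodromy estimate. -/

/-- The elementary matrix with lower left entry `1`. -/
def lowerUnit : Matrix (Fin 2) (Fin 2) ℂ := !![0, 0; 1, 0]

/-- The elementary matrix with upper right entry `1`. -/
def upperUnit : Matrix (Fin 2) (Fin 2) ℂ := !![0, 1; 0, 0]

theorem lowerUnit_mul_self : lowerUnit * lowerUnit = 0 := by
  ext i j; fin_cases i <;> fin_cases j <;> simp [lowerUnit]

theorem residueMatrix_eq (a b c : ℂ) :
    c • upperUnit + b • (lowerUnit * upperUnit - upperUnit * lowerUnit) -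
      a • (lowerUnit * upperUnit * lowerUnit) = residueMatrix a b c := by
  ext i j; fin_cases i <;> fin_cases j <;> simp [lowerUnit, upperUnit, residueMatrix]

theorem residueMatrix_smul (x a b c : ℂ) :
    residueMatrix (x * a) (x * b) (x * c) = x • residueMatrix a b c := by
  ext i j; fin_cases i <;> fin_cases j <;> simp [residueMatrix]

section Frame

variable {ρ : ℝ}

/-- The frame of the unperturbed problem in the gauge of the potential with lower left entry
`m z^{m-1}`. -/
noncomputable def gaugedFrame (m : ℕ) (Φ : ℂ → LoopMatrix ρ) (w z : ℂ) :
    Matrix (Fin 2) (Fin 2) ℂ :=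
  (Φ w).eval z * (1 - Complex.exp w ^ m • lowerUnit)

/-- The inverse of `gaugedFrame` for frames of determinant `1`. -/
noncomputable def gaugedFrameInv (m : ℕ) (Φ : ℂ → LoopMatrix ρ) (w z : ℂ) :
    Matrix (Fin 2) (Fin 2) ℂ :=
  (1 + Complex.exp w ^ m • lowerUnit) * ((Φ w).eval z).adjugate

theorem gaugedFrame_mul_inv (hρ : 1 < ρ) {m : ℕ} {Φ : ℂ → LoopMatrix ρ} {w : ℂ}
    (hΦ : Φ w ∈ LoopSL ρ) {z : ℂ} (hz : z ∈ openAnnulus ρ) :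
    gaugedFrame m Φ w z * gaugedFrameInv m Φ w z = 1 := by
  rw [gaugedFrame, gaugedFrameInv, mul_assoc, mul_conj_cancel lowerUnit_mul_self,
    Matrix.mul_adjugate, LoopSL.det_eval hρ hΦ hz, one_smul]

theorem exists_norm_gaugedFrame_le [hρ : Fact (1 < ρ)] (m : ℕ) (Φ : ℂ → LoopMatrix ρ) (w : ℂ) :
    ∃ κ : ℝ, ∀ z ∈ openAnnulus ρ, ‖gaugedFrame m Φ w z‖ ≤ κ ∧ ‖gaugedFrameInv m Φ w z‖ ≤ κ := by
  set B : ℝ := ∑ i, ∑ j, ‖Φ w i j‖ with hB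
  have hBij : ∀ i j, ‖Φ w i j‖ ≤ B := fun i j =>
    (Finset.single_le_sum (f := fun j => ‖Φ w i j‖) (fun _ _ => norm_nonneg _)
      (Finset.mem_univ j)).trans
      (Finset.single_le_sum (f := fun i => ∑ j, ‖Φ w i j‖)
        (fun _ _ => Finset.sum_nonneg fun _ _ => norm_nonneg _) (Finset.mem_univ i))
  set g := ‖(1 - Complex.exp w ^ m • lowerUnit : Matrix (Fin 2) (Fin 2) ℂ)‖
  set g' := ‖(1 + Complex.exp w ^ m • lowerUnit : Matrix (Fin 2) (Fin 2) ℂ)‖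
  have hB0 : 0 ≤ 2 * B := by
    have := (norm_nonneg _).trans (hBij 0 0)
    linarith
  refine ⟨max (2 * B * g) (g' * (2 * B)), fun z hz => ⟨?_, ?_⟩⟩
  · refine le_trans ?_ (le_max_left _ _)
    exact (norm_mul_le _ _).trans (mul_le_mul_of_nonneg_right
      (LoopMatrix.norm_eval_le hρ.out (Φ w) hBij hz) (norm_nonneg _))
  · refine le_trans ?_ (le_max_right _ _)
    refine (norm_mul_le _ _).trans (mul_le_mul_of_nonneg_left ?_ (norm_nonneg _))
    have hE : ∀ i j, ‖(Φ w).eval z i j‖ ≤ B := fun i j =>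
      (Wiener.norm_eval_le hρ.out (Φ w i j) hz.1.le hz.2.le).trans (hBij i j)
    refine Matrix.linftyOp_norm_le_of_entries fun i j => ?_
    rw [Matrix.adjugate_fin_two]
    fin_cases i <;> fin_cases j
    · exact hE 1 1
    · simpa using hE 0 1
    · simpa using hE 1 0
    · exact hE 0 0

/-- The gauged frame of the unperturbed problem is constant. -/
theorem gaugedFrame_eq_of_segment [hρ : Fact (1 < ρ)] {m : ℕ} {r : ℝ} {A Φ : ℂ → LoopMatrix ρ}
    (h : SolvesPotential A Φ r)
    (hΦ : ∀ i j, ContDiffOn ℝ 1 (fun w => Φ w i j) (coverOfPuncturedDisc r))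
    (hA : ∀ z ∈ puncturedDisc r, ∀ lam ∈ sphere (0 : ℂ) 1,
      (A z).eval lam = !![0, 0; (m : ℂ) * z ^ (m - 1), 0])
    {w₀ : ℂ} (hw₀ : w₀ ∈ coverOfPuncturedDisc r) {z : ℂ} (hz : z ∈ openAnnulus ρ) {w : ℂ}
    (hw : w ∈ segment ℝ w₀ (w₀ + 2 * Real.pi * I)) :
    gaugedFrame m Φ w z = gaugedFrame m Φ w₀ z := by
  have hd : ∀ w ∈ segment ℝ w₀ (w₀ + 2 * Real.pi * I),
      HasDerivWithinAt (fun w => gaugedFrame m Φ w z) 0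
        (segment ℝ w₀ (w₀ + 2 * Real.pi * I)) w := by
    intro w hw
    have hwc := segment_subset_cover hw₀ hw
    have h1 : HasDerivAt (fun w => (1 - Complex.exp w ^ m • lowerUnit : Matrix (Fin 2) (Fin 2) ℂ))
        (-((Complex.exp w * ((m : ℂ) * Complex.exp w ^ (m - 1))) • lowerUnit)) w := by
      have := ((((Complex.hasDerivAt_exp w).fun_pow m).smul_const lowerUnit).const_sub 1)
      refine this.congr_deriv ?_
      rw [mul_comm (Complex.exp w)]
    have h2 := (h.hasDerivAt hΦ hwc hz).mul h1
    have h3 : (A (Complex.exp w)).eval z =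
        (0 : ℂ) • upperUnit + ((m : ℂ) * Complex.exp w ^ (m - 1)) • lowerUnit := by
      rw [LoopMatrix.eval_eq_of_sphere hρ.out
        (B := fun _ => !![0, 0; (m : ℂ) * Complex.exp w ^ (m - 1), 0])
        (fun i j => differentiableOn_const _) (hA _ hwc) hz]
      ext i j; fin_cases i <;> fin_cases j <;> simp [lowerUnit, upperUnit]
    refine (h2.congr_deriv ?_).hasDerivWithinAt
    have h4 := gauge_derivative lowerUnit_mul_self upperUnit ((Φ w).eval z) 1
      (((m : ℂ) * Complex.exp w ^ (m - 1)) • lowerUnit) (Complex.exp w ^ m) (Complex.exp w) 0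
      ((m : ℂ) * Complex.exp w ^ (m - 1))
    simp only [sub_self, mul_zero, zero_mul, neg_zero, smul_zero, add_zero, zero_smul, mul_one]
      at h4
    rw [h3, zero_smul]
    exact h4
  have h5 := (convex_segment w₀ (w₀ + 2 * Real.pi * I)).norm_image_sub_le_of_norm_hasDerivWithin_le
    (C := 0) hd (fun w _ => by rw [norm_zero]) (left_mem_segment ℝ _ _) hw
  rw [zero_mul, norm_le_zero_iff, sub_eq_zero] at h5
  exact h5

/-- Evaluation on the annulus is bounded by the norm of the loop, so closeness of `Φ t` and `η t` to
their values at `t = 0` holds uniformly in `z`, here the loop parameter. A single threshold `ε₁`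
then applies to all `z`. -/
theorem exists_monodromy_estimate [hρ : Fact (1 < ρ)] {m : ℕ} (hm : 1 ≤ m) {r ε s : ℝ}
    (hε : 0 < ε) (hs : 1 < s) (hsρ : s < ρ) {η Φ : ℝ → ℂ → LoopMatrix ρ}
    (hΦSL : ∀ t ∈ Ioo (-ε) ε, ∀ w ∈ coverOfPuncturedDisc r, Φ t w ∈ LoopSL ρ)
    (hΦ : ∀ t ∈ Ioo (-ε) ε, SolvesPotential (η t) (Φ t) r)
    (hηC1 : LoopC1On η (Ioo (-ε) ε) (puncturedDisc r))
    (hΦC1 : LoopC1On Φ (Ioo (-ε) ε) (coverOfPuncturedDisc r))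
    {a b c : ℝ → Wiener ρ} {Ξ : ℝ → ℂ → LoopMatrix ρ}
    (hΞ : ∀ t ∈ Ioo (-ε) ε, LoopHolomorphicOn (Ξ t) (ball 0 r))
    (hprincipal : ∀ t ∈ Ioo (-ε) ε, ∀ z ∈ puncturedDisc r, ∀ lam ∈ sphere (0 : ℂ) 1,
        (η t z).eval lam =
          ((a t).eval lam / z ^ (2 * m + 1) + (b t).eval lam / z ^ (m + 1) + (c t).eval lam / z) •
            !![0, lam⁻¹; 0, 0] + (Ξ t z).eval lam)
    (hη0 : ∀ z ∈ puncturedDisc r, ∀ lam ∈ sphere (0 : ℂ) 1,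
      (η 0 z).eval lam = !![0, 0; (m : ℂ) * z ^ (m - 1), 0])
    {w₀ : ℂ} (hw₀ : w₀ ∈ coverOfPuncturedDisc r) {e : ℝ} (he : 0 < e) :
    ∃ δ > 0, δ ≤ ε ∧ ∀ t ∈ Ioo (-δ) δ, ∀ z : ℂ, s⁻¹ ≤ ‖z‖ → ‖z‖ ≤ s →
      ‖monodromy (Φ t) w₀ z - 1 - (2 * Real.pi * I * z⁻¹) • (gaugedFrame m (Φ 0) w₀ z *
        residueMatrix ((a t).eval z) ((b t).eval z) ((c t).eval z) *
        gaugedFrameInv m (Φ 0) w₀ z)‖ ≤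
        e * (‖(a t).eval z‖ + ‖(b t).eval z‖ + ‖(c t).eval z‖) := by
  have hs0 : 0 < s := by linarith
  have hρs : ρ⁻¹ < s⁻¹ := (inv_lt_inv₀ (by linarith) hs0).mpr hsρ
  have h0I : (0 : ℝ) ∈ Ioo (-ε) ε := ⟨by linarith, hε⟩
  obtain ⟨R, hwR, hRr⟩ := exists_between (mem_coverOfPuncturedDisc.mp hw₀)
  have hR : 0 < R := (norm_nonneg _).trans_lt hwR
  obtain ⟨κ, hκ⟩ := exists_norm_gaugedFrame_le m (Φ 0) w₀
  -- The coefficients carry the factor $z^{-1}$ of size at most `s`, whence the tolerance `e / s`.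
  obtain ⟨ε₁, hε₁, hest⟩ := monodromy_estimate (𝔸 := Matrix (Fin 2) (Fin 2) ℂ) hm (w₀ := w₀)
    (κ := κ) hwR hRr upperUnit lowerUnit_mul_self (div_pos he hs0)
  set g : ℝ := 1 + R ^ m * ‖lowerUnit‖ with hg
  have hg0 : 0 < g := by positivity
  -- closeness of the frames on the segment, and of the potentials on a circle
  have hK₁ : IsCompact (segment ℝ w₀ (w₀ + 2 * Real.pi * I)) := by
    rw [segment_eq_image']; exact isCompact_Icc.image (by fun_prop)
  have hKsub : sphere (0 : ℂ) R ⊆ puncturedDisc r := fun z hz => by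
    rw [mem_sphere_zero_iff_norm] at hz
    exact mem_puncturedDisc.mpr ⟨by linarith, norm_pos_iff.mp (by linarith)⟩
  have hc₁ : ∀ i j, ∃ δ > 0, ∀ t : ℝ, |t| < δ → ∀ w ∈ segment ℝ w₀ (w₀ + 2 * Real.pi * I),
      ‖Φ t w i j - Φ 0 w i j‖ ≤ ε₁ / (2 * g) := fun i j =>
    exists_forall_norm_sub_le (f := fun p : ℝ × ℂ => Φ p.1 p.2 i j) isOpen_Ioo
      (isOpen_coverOfPuncturedDisc r) (hΦC1 i j).continuousOn h0I hK₁ (segment_subset_cover hw₀)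
      (by positivity)
  have hc₂ : ∀ i j, ∃ δ > 0, ∀ t : ℝ, |t| < δ → ∀ z ∈ sphere (0 : ℂ) R,
      ‖η t z i j - η 0 z i j‖ ≤ ε₁ / 8 := fun i j =>
    exists_forall_norm_sub_le (f := fun p : ℝ × ℂ => η p.1 p.2 i j) isOpen_Ioo
      (isOpen_puncturedDisc r) (hηC1 i j).continuousOn h0I (isCompact_sphere 0 R) hKsub
      (by positivity)
  choose δ₁ hδ₁ hΦδ using hc₁
  choose δ₂ hδ₂ hηδ using hc₂
  obtain ⟨δ, hδ, hδε, hδij⟩ : ∃ δ > 0, δ ≤ ε ∧ ∀ i j, δ ≤ δ₁ i j ∧ δ ≤ δ₂ i j := by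
    have hev : ∀ᶠ δ in 𝓝[>] (0 : ℝ), δ ≤ ε ∧ ∀ i j, δ ≤ δ₁ i j ∧ δ ≤ δ₂ i j := by
      have hle : ∀ x : ℝ, 0 < x → ∀ᶠ δ in 𝓝[>] (0 : ℝ), δ ≤ x := fun x hx => by
        filter_upwards [Ioo_mem_nhdsGT hx] with δ hδ using hδ.2.le
      refine (hle ε hε).and ?_
      simp only [eventually_all]
      exact fun i j => (hle _ (hδ₁ i j)).and (hle _ (hδ₂ i j))
    obtain ⟨δ, h1, h2⟩ := (hev.and self_mem_nhdsWithin).exists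
    exact ⟨δ, h2, h1⟩
  refine ⟨δ, hδ, hδε, fun t ht z hz₁ hz₂ => ?_⟩
  have htI : t ∈ Ioo (-ε) ε := ⟨by linarith [ht.1], by linarith [ht.2]⟩
  have htδ : |t| < δ := abs_lt.mpr ht
  have hzA : z ∈ openAnnulus ρ := ⟨hρs.trans_le hz₁, hz₂.trans_lt hsρ⟩
  have hz0 : z ≠ 0 := ne_zero_of_mem_openAnnulus hρ.out hzA
  have hpr : ∀ u ∈ puncturedDisc r, (η t u).eval z =
      (z⁻¹ * (a t).eval z / u ^ (2 * m + 1) + z⁻¹ * (b t).eval z / u ^ (m + 1) +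
        z⁻¹ * (c t).eval z / u) • upperUnit + (Ξ t u).eval z := by
    intro u hu
    rw [eval_principal_eq hρ.out (hprincipal t htI u hu) hzA]
    congr 1
    ext i j; fin_cases i <;> fin_cases j <;> simp [upperUnit]
    ring
  have hC1t : ∀ i j, ContDiffOn ℝ 1 (fun w => Φ t w i j) (coverOfPuncturedDisc r) := fun i j =>
    (hΦC1 i j).comp (contDiff_const.prodMk contDiff_id).contDiffOn fun w hw => ⟨htI, hw⟩
  have hC10 : ∀ i j, ContDiffOn ℝ 1 (fun w => Φ 0 w i j) (coverOfPuncturedDisc r) := fun i j =>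
    (hΦC1 i j).comp (contDiff_const.prodMk contDiff_id).contDiffOn fun w hw => ⟨h0I, hw⟩
  have hη0z : ∀ u ∈ puncturedDisc r, (η 0 u).eval z = ((m : ℂ) * u ^ (m - 1)) • lowerUnit := by
    intro u hu
    rw [LoopMatrix.eval_eq_of_sphere hρ.out (B := fun _ => !![0, 0; (m : ℂ) * u ^ (m - 1), 0])
      (fun i j => differentiableOn_const _) (hη0 u hu) hzA]
    ext i j; fin_cases i <;> fin_cases j <;> simp [lowerUnit]
  have hmain := hest (gaugedFrame m (Φ 0) w₀ z) (gaugedFrameInv m (Φ 0) w₀ z)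
    (monodromy (Φ t) w₀ z - 1) (fun w => (Φ t w).eval z) (fun u => (Ξ t u).eval z)
    (z⁻¹ * (a t).eval z) (z⁻¹ * (b t).eval z) (z⁻¹ * (c t).eval z)
    (gaugedFrame_mul_inv hρ.out (hΦSL 0 h0I w₀ hw₀) hzA) (hκ z hzA).1 (hκ z hzA).2
    ?_ ?_ ?_ ?_ ?_
  · rw [residueMatrix_eq, residueMatrix_smul, mul_smul_comm, smul_mul_assoc, smul_smul] at hmain
    refine hmain.trans ?_
    simp only [norm_mul, norm_inv]
    have h1 : ‖z‖⁻¹ ≤ s := inv_le_of_inv_le₀ hs0 hz₁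
    have h2 : ‖z‖⁻¹ * ‖(a t).eval z‖ + ‖z‖⁻¹ * ‖(b t).eval z‖ + ‖z‖⁻¹ * ‖(c t).eval z‖ ≤
        s * (‖(a t).eval z‖ + ‖(b t).eval z‖ + ‖(c t).eval z‖) := by
      rw [← mul_add, ← mul_add]
      exact mul_le_mul_of_nonneg_right h1 (by positivity)
    calc _ ≤ e / s * (s * (‖(a t).eval z‖ + ‖(b t).eval z‖ + ‖(c t).eval z‖)) :=
          mul_le_mul_of_nonneg_left h2 (by positivity)
      _ = _ := by field_simp
  · exact differentiableOn_matrix isOpen_ball fun i j u hu =>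
      (Wiener.evalCLM z hzA.1.le hzA.2.le).differentiableAt.comp_differentiableWithinAt u
        (hΞ t htI i j u hu)
  · intro w hw
    have hwc := segment_subset_cover hw₀ hw
    rw [← hpr _ hwc]
    exact (hΦ t htI).hasDerivAt hC1t hwc hzA
  -- Closeness is known for `η`, not for `Ξ`. Cauchy estimates bound the principal part on the
  -- circle by `3 * (ε₁ / 8)`, so each entry of the remainder is within `ε₁ / 2`, and the row-sum
  -- norm doubles this.
  · have hdiff : ∀ u ∈ sphere (0 : ℂ) R, ∀ i j,
        ‖((η t u).eval z - ((m : ℂ) * u ^ (m - 1)) • lowerUnit) i j‖ ≤ ε₁ / 8 := by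
      intro u hu i j
      rw [← hη0z u (hKsub hu)]
      exact LoopMatrix.norm_eval_sub_le _ _
        (fun i j => hηδ i j t (htδ.trans_le (hδij i j).2) u hu) hzA i j
    have hΞd : DifferentiableOn ℂ (fun u => (Ξ t u).eval z 0 1) (ball 0 r) := fun u hu =>
      (Wiener.evalCLM z hzA.1.le hzA.2.le).differentiableAt.comp_differentiableWithinAt u
        (hΞ t htI 0 1 u hu)
    obtain ⟨b1, b2, b3⟩ := norm_principal_coeff_le hm hR hRr hΞd (e := ε₁ / 8)
      (α := z⁻¹ * (a t).eval z) (β := z⁻¹ * (b t).eval z) (γ := z⁻¹ * (c t).eval z)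
      fun u hu => by
        have h1 := hdiff u hu 0 1
        rw [hpr u (hKsub hu)] at h1
        simpa [upperUnit, lowerUnit] using h1
    intro u hu
    have hun : ‖u‖ = R := mem_sphere_zero_iff_norm.mp hu
    have hf : ‖z⁻¹ * (a t).eval z / u ^ (2 * m + 1) + z⁻¹ * (b t).eval z / u ^ (m + 1) +
        z⁻¹ * (c t).eval z / u‖ ≤ 3 * (ε₁ / 8) := by
      refine norm_add₃_le.trans ?_
      rw [norm_div _ (u ^ (2 * m + 1)), norm_div _ (u ^ (m + 1)), norm_div _ u, norm_pow, norm_pow,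
        hun]
      have d1 := (div_le_iff₀ (by positivity : 0 < R ^ (2 * m + 1))).mpr b1
      have d2 := (div_le_iff₀ (by positivity : 0 < R ^ (m + 1))).mpr b2
      have d3 := (div_le_iff₀ hR).mpr b3
      linarith
    refine (Matrix.linftyOp_norm_le_of_entries (x := ε₁ / 2) fun i j => ?_).trans_eq (by ring)
    have h1 : (Ξ t u).eval z - ((m : ℂ) * u ^ (m - 1)) • lowerUnit =
        ((η t u).eval z - ((m : ℂ) * u ^ (m - 1)) • lowerUnit) -
          (z⁻¹ * (a t).eval z / u ^ (2 * m + 1) + z⁻¹ * (b t).eval z / u ^ (m + 1) +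
        z⁻¹ * (c t).eval z / u) • upperUnit := by
      rw [hpr u (hKsub hu)]; abel
    rw [h1, Matrix.sub_apply]
    have h2 : ∀ x : ℂ, ‖(x • upperUnit) i j‖ ≤ ‖x‖ := fun x => by
      fin_cases i <;> fin_cases j <;> simp [upperUnit]
    linarith [norm_sub_le (((η t u).eval z - ((m : ℂ) * u ^ (m - 1)) • lowerUnit) i j)
      (((z⁻¹ * (a t).eval z / u ^ (2 * m + 1) + z⁻¹ * (b t).eval z / u ^ (m + 1) +
        z⁻¹ * (c t).eval z / u) • upperUnit) i j), hdiff u hu i j, h2 (z⁻¹ * (a t).eval z /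
        u ^ (2 * m + 1) + z⁻¹ * (b t).eval z / u ^ (m + 1) + z⁻¹ * (c t).eval z / u)]
  · intro w hw
    rw [← gaugedFrame_eq_of_segment (hΦ 0 h0I) hC10 hη0 hw₀ hzA hw, gaugedFrame, ← sub_mul]
    have h1 : ‖(Φ t w).eval z - (Φ 0 w).eval z‖ ≤ 2 * (ε₁ / (2 * g)) :=
      Matrix.linftyOp_norm_le_of_entries fun i j => LoopMatrix.norm_eval_sub_le _ _
        (fun i j => hΦδ i j t (htδ.trans_le (hδij i j).1) w hw) hzA i j
    have h2 : ‖(1 - Complex.exp w ^ m • lowerUnit : Matrix (Fin 2) (Fin 2) ℂ)‖ ≤ g := by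
      refine (norm_sub_le _ _).trans ?_
      rw [norm_one, norm_smul, norm_pow, hg]
      have h3 : ‖Complex.exp w‖ ≤ R := by
        rw [segment_eq_image'] at hw
        obtain ⟨τ, -, rfl⟩ := hw
        rw [Complex.norm_exp] at hwR ⊢
        simpa using hwR.le
      gcongr
    calc _ ≤ 2 * (ε₁ / (2 * g)) * g :=
          (norm_mul_le _ _).trans (mul_le_mul h1 h2 (norm_nonneg _) (by positivity))
      _ = ε₁ := by field_simp
  · rw [add_sub_cancel]
    exact monodromy_mul_eval hρ.out hw₀ (hΦSL t htI) hzA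

end Frame

end Preliminaries

/-! ### The main theorem. -/

theorem mainTheorem7 (ρ : ℝ) [Fact (1 < ρ)]
    -- the Sym points
    (θ : ℝ) (l₁ l₂ : ℂ) (hl₁ : ‖l₁‖ < ρ) (hl₂ : ‖l₂‖ < ρ)
    (hsum : ∃ s : ℝ, l₁ + l₂ = Complex.exp (θ * Complex.I) * s)
    (hprod : l₁ * l₂ = Complex.exp (2 * θ * Complex.I))
    -- the potentials `η t z dz` on the punctured disc and the solutions on its universal cover
    (m : ℕ) (hm : 1 ≤ m) (r ε : ℝ) (hr : 0 < r) (hε : 0 < ε)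
    (η Φ : ℝ → ℂ → LoopMatrix ρ)
    (hη : ∀ t ∈ Set.Ioo (-ε) ε, IsDPWPotential (η t) (puncturedDisc r))
    (hΦSL : ∀ t ∈ Set.Ioo (-ε) ε, ∀ w ∈ coverOfPuncturedDisc r, Φ t w ∈ LoopSL ρ)
    (hΦ : ∀ t ∈ Set.Ioo (-ε) ε, SolvesPotential (η t) (Φ t) r)
    (hηC1 : LoopC1On η (Set.Ioo (-ε) ε) (puncturedDisc r))
    (hΦC1 : LoopC1On Φ (Set.Ioo (-ε) ε) (coverOfPuncturedDisc r))
    -- the principal part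
    (a b c : ℝ → Wiener ρ) (Ξ : ℝ → ℂ → LoopMatrix ρ)
    (hΞ : ∀ t ∈ Set.Ioo (-ε) ε, LoopHolomorphicOn (Ξ t) (Metric.ball 0 r))
    (hprincipal : ∀ t ∈ Set.Ioo (-ε) ε, ∀ z ∈ puncturedDisc r,
      ∀ lam ∈ Metric.sphere (0 : ℂ) 1,
        (η t z).eval lam =
          ((a t).eval lam / z ^ (2 * m + 1) + (b t).eval lam / z ^ (m + 1) + (c t).eval lam / z) •
            !![0, lam⁻¹; 0, 0] + (Ξ t z).eval lam)
    -- the potential at `t = 0`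
    (hη0 : ∀ z ∈ puncturedDisc r, ∀ lam ∈ Metric.sphere (0 : ℂ) 1,
      (η 0 z).eval lam = !![0, 0; (m : ℂ) * z ^ (m - 1), 0])
    -- the Monodromy Problem
    (w₀ : ℂ) (hw₀ : w₀ ∈ coverOfPuncturedDisc r)
    (hmon : ∀ t ∈ Set.Ioo (-ε) ε, MonodromyProblem (monodromy (Φ t) w₀) l₁ l₂)
    -- the normalisations
    (ha0 : ∀ t ∈ Set.Ioo (-ε) ε, (a t).coeff 0 = 0)
    (hb0 : ∀ t ∈ Set.Ioo (-ε) ε, (Complex.exp (-θ * Complex.I) * (b t).coeff 0).re = 0) :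
    ∃ δ > 0, δ ≤ ε ∧ ∀ t ∈ Set.Ioo (-δ) δ,
      (a t = 0 ∧ b t = 0 ∧ c t = 0) ∧
      ∃ H : ℂ → LoopMatrix ρ, LoopHolomorphicOn H (Metric.ball 0 r) ∧
        ∀ z ∈ puncturedDisc r, η t z = H z := by
  have hρ : 1 < ρ := Fact.out
  have hnorm : ‖l₁‖ * ‖l₂‖ = 1 := by
    rw [← norm_mul, hprod, show (2 * θ * Complex.I : ℂ) = ((2 * θ : ℝ) : ℂ) * Complex.I by
      push_cast; ring, Complex.norm_exp_ofReal_mul_I]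
  -- As `‖l₁‖ * ‖l₂‖ = 1`, the bounds `‖lᵢ‖ < s` also give `s⁻¹ < ‖lᵢ‖`.
  obtain ⟨s, hmax, hsρ⟩ := exists_between (max_lt hρ (max_lt hl₁ hl₂))
  have hs : 1 < s := (le_max_left _ _).trans_lt hmax
  have hs0 : 0 < s := by linarith
  have h₁s : ‖l₁‖ < s := ((le_max_left _ _).trans (le_max_right _ _)).trans_lt hmax
  have h₂s : ‖l₂‖ < s := ((le_max_right _ _).trans (le_max_right _ _)).trans_lt hmax
  have h₁p : 0 < ‖l₁‖ := (norm_nonneg _).lt_of_ne' fun h => by simp [h] at hnorm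
  have h₂p : 0 < ‖l₂‖ := (norm_nonneg _).lt_of_ne' fun h => by simp [h] at hnorm
  have h₁s' : s⁻¹ < ‖l₁‖ := by
    rw [eq_inv_of_mul_eq_one_left hnorm]; exact (inv_lt_inv₀ hs0 h₂p).mpr h₂s
  have h₂s' : s⁻¹ < ‖l₂‖ := by
    rw [eq_inv_of_mul_eq_one_right hnorm]; exact (inv_lt_inv₀ hs0 h₁p).mpr h₁s
  have hρs : ρ⁻¹ < s⁻¹ := (inv_lt_inv₀ (by linarith) hs0).mpr hsρ
  have hcl : ∀ z : ℂ, s⁻¹ ≤ ‖z‖ → ‖z‖ ≤ s → z ∈ openAnnulus ρ := fun z h1 h2 =>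
    ⟨hρs.trans_le h1, h2.trans_lt hsρ⟩
  have h0I : (0 : ℝ) ∈ Set.Ioo (-ε) ε := ⟨by linarith, hε⟩
  obtain ⟨κ, hκ⟩ := exists_norm_gaugedFrame_le m (Φ 0) w₀
  obtain ⟨e, he, hrigid⟩ := residue_eq_zero_of_estimate (κ := κ) (θ := θ) hs hsρ ⟨h₁s', h₁s⟩
    ⟨h₂s', h₂s⟩ hsum hprod (C := gaugedFrame m (Φ 0) w₀) (C' := gaugedFrameInv m (Φ 0) w₀)
    (fun z hz => gaugedFrame_mul_inv hρ (hΦSL 0 h0I w₀ hw₀) hz)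
    (fun z h1 h2 => hκ z (hcl z h1 h2))
  -- Half of the tolerance, since passing to the trace-free part doubles the error.
  obtain ⟨δ, hδ, hδε, hest⟩ := exists_monodromy_estimate hm hε hs hsρ hΦSL hΦ hηC1 hΦC1 hΞ
    hprincipal hη0 hw₀ (half_pos he)
  refine ⟨δ, hδ, hδε, fun t ht => ?_⟩
  have htI : t ∈ Set.Ioo (-ε) ε := ⟨by linarith [ht.1], by linarith [ht.2]⟩
  obtain ⟨hSU, hM₁, hM₂, hM₃⟩ := hmon t htI
  have hneg : ∀ k < 0, (a t).coeff k = 0 ∧ (b t).coeff k = 0 ∧ (c t).coeff k = 0 := fun k hk =>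
    principal_coeff_eq_zero hm hr (hη t htI) (hΞ t htI) (hprincipal t htI) hk
  have hMd := differentiableOn_monodromy hρ hw₀ (hΦSL t htI)
  have hzero := hrigid (a t).eval (b t).eval (c t).eval
    (fun z => (monodromy (Φ t) w₀ z 0 0 - monodromy (Φ t) w₀ z 1 1) / 2)
    (fun z => monodromy (Φ t) w₀ z 0 1) (fun z => monodromy (Φ t) w₀ z 1 0)
    (Wiener.differentiableOn_eval_ball hρ _ fun k hk => (hneg k hk).1)
    (Wiener.differentiableOn_eval_ball hρ _ fun k hk => (hneg k hk).2.1)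
    (Wiener.differentiableOn_eval_ball hρ _ fun k hk => (hneg k hk).2.2)
    (((hMd 0 0).sub (hMd 1 1)).div_const 2) (hMd 0 1) (hMd 1 0)
    (by rw [Wiener.eval_zero_eq_coeff]; exact ha0 t htI)
    (by rw [Wiener.eval_zero_eq_coeff]; exact hb0 t htI)
    (by simp [hM₁]) (fun h => by simp [hM₂ h])
    (fun h => ⟨by simpa using ((hM₃ h 0 0).fun_sub (hM₃ h 1 1)).div_const 2, hM₃ h 0 1, hM₃ h 1 0⟩)
    (fun z hz => by
      obtain ⟨u1, u2, -⟩ := Matrix.conj_eq_of_mem_specialUnitaryGroup (hSU z hz)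
      rw [map_div₀, map_sub, u1, u2, Complex.conj_ofNat]
      ring)
    (fun z hz => (Matrix.conj_eq_of_mem_specialUnitaryGroup (hSU z hz)).2.2)
    (fun z h1 h2 => by
      set X := residueMatrix ((a t).eval z) ((b t).eval z) ((c t).eval z) with hX
      have hzA := hcl z h1 h2
      have htr : ((2 * Real.pi * Complex.I * z⁻¹) • (gaugedFrame m (Φ 0) w₀ z * X *
          gaugedFrameInv m (Φ 0) w₀ z)).trace = 0 := by
        rw [Matrix.trace_smul, Matrix.trace_mul_comm, ← mul_assoc,
          mul_eq_one_comm.mp (gaugedFrame_mul_inv hρ (hΦSL 0 h0I w₀ hw₀) hzA), one_mul, hX]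
        simp [residueMatrix, Matrix.trace_fin_two]
      have h3 := Matrix.norm_traceFree_sub_le (A := monodromy (Φ t) w₀ z - 1) htr
      have h4 := hest t ht z h1 h2
      have h5 : !![((monodromy (Φ t) w₀ z - 1) 0 0 - (monodromy (Φ t) w₀ z - 1) 1 1) / 2,
          (monodromy (Φ t) w₀ z - 1) 0 1; (monodromy (Φ t) w₀ z - 1) 1 0,
          -(((monodromy (Φ t) w₀ z - 1) 0 0 - (monodromy (Φ t) w₀ z - 1) 1 1) / 2)] =
        !![(monodromy (Φ t) w₀ z 0 0 - monodromy (Φ t) w₀ z 1 1) / 2, monodromy (Φ t) w₀ z 0 1;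
          monodromy (Φ t) w₀ z 1 0,
          -((monodromy (Φ t) w₀ z 0 0 - monodromy (Φ t) w₀ z 1 1) / 2)] := by
        simp
      rw [h5] at h3
      linarith)
  have hsph : ∀ z ∈ Metric.sphere (0 : ℂ) 1, z ∈ Metric.closedBall (0 : ℂ) s := fun z hz => by
    rw [mem_sphere_zero_iff_norm] at hz
    rw [mem_closedBall_zero_iff, hz]
    exact hs.le
  have hev0 : ∀ z, (0 : Wiener ρ).eval z = 0 := fun z => by
    simp [Wiener.eval, Wiener.coeff_zero]
  have ha : a t = 0 := Wiener.ext_eval_sphere hρ fun z hz => by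
    rw [hev0]; exact (hzero z (hsph z hz)).1
  have hb : b t = 0 := Wiener.ext_eval_sphere hρ fun z hz => by
    rw [hev0]; exact (hzero z (hsph z hz)).2.1
  have hc : c t = 0 := Wiener.ext_eval_sphere hρ fun z hz => by
    rw [hev0]; exact (hzero z (hsph z hz)).2.2
  -- With the principal part gone, `Ξ t` itself is the extension; loops are compared through their
  -- values on the circle.
  refine ⟨⟨ha, hb, hc⟩, Ξ t, hΞ t htI, fun z hz => ?_⟩
  ext i j : 2
  refine Wiener.ext_eval_sphere hρ fun lam hlam => ?_
  have h1 := congrFun (congrFun (hprincipal t htI z hz lam hlam) i) j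
  rw [ha, hb, hc, hev0] at h1
  simpa [LoopMatrix.eval_apply] using h1
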